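/- Let $K$ be an algebraically closed field (of arbitrary characteristic), let $d \ge n \ge 3$ be integers, and let $W \subset \mathbb{P}^n_K$ be a quadric hypersurface of rank at least $4$ (that is, $n+1$ minus the dimension of the linear subspace of $K^{n+1}$ defining the vertex of $W$ is at least $4$; in characteristic $\ne 2$ this is the rank of the symmetric matrix of an equation of $W$). A degree $d$ bamboo in $\mathbb{P}^n$ is a union $T = L_1 \cup \dots \cup L_d$ of $d$ distinct lines such that $L_i \cap L_j \ne \emptyset$ if and only if $|i-j| \le 1$ (so $T$ is a connected nodal curve of arithmetic genus $0$). Then there is a degree $d$ bamboo $T \subset \mathbb{P}^n$ that intersects $W$ transversally, so that $T \cap W$ consists of $2d$ points, and such that $T \cap W$ has maximal rank in $W$: for every integer $t \ge 0$ the restriction map $$H^0(W, \mathcal{O}_W(t)) \to H^0(T \cap W, \mathcal{O}_{T \cap W}(t))$$ is injective or surjective. -/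

import Mathlib

open scoped LinearAlgebra.Projectivization

noncomputable section

namespace BambooQuadric

variable {K : Type*} [Field K] {n : ℕ}

/-- The projective space `ℙⁿ` over `K`: lines through the origin in `K ^ (n + 1)`. -/
abbrev PSpace (K : Type*) [Field K] (n : ℕ) : Type _ := ℙ K (Fin (n + 1) → K)

/-! ### Sections of twisting sheaves and maximal rank -/

/-- The affine cone over `X ⊆ ℙⁿ` without its vertex, i.e. all homogeneous coordinate vectors of
points of `X`. -/
def puncturedCone (X : Set (PSpace K n)) : Set (Fin (n + 1) → K) :=
  {v | ∃ h : v ≠ 0, Projectivization.mk K v h ∈ X}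

theorem puncturedCone_mono {E X : Set (PSpace K n)} (h : E ⊆ X) :
    puncturedCone E ⊆ puncturedCone X :=
  fun _ ⟨h0, hv⟩ => ⟨h0, h hv⟩

/-- `H⁰(X, 𝒪_X(t))` for a closed algebraic subset `X` of `ℙⁿ` with its reduced structure: the
functions `s` on the punctured cone of `X` which on every standard affine chart `xᵢ ≠ 0` of `X`
are of the form `F / xᵢ ^ N` with `F` a homogeneous polynomial of degree `t + N`. -/
def sections (X : Set (PSpace K n)) (t : ℕ) : Submodule K (puncturedCone X → K) where
  carrier := {s | ∀ i : Fin (n + 1), ∃ (N : ℕ) (F : MvPolynomial (Fin (n + 1)) K),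
    F.IsHomogeneous (t + N) ∧
      ∀ v : puncturedCone X, v.1 i ≠ 0 → s v = MvPolynomial.eval v.1 F / v.1 i ^ N}
  zero_mem' := fun i => ⟨0, 0, MvPolynomial.isHomogeneous_zero _ _ _, by simp⟩
  smul_mem' := by
    intro c s hs i
    obtain ⟨N, F, hF, h⟩ := hs i
    refine ⟨N, MvPolynomial.C c * F, ?_, ?_⟩
    · simpa using (MvPolynomial.isHomogeneous_C (Fin (n + 1)) c).mul hF
    · intro v hv
      simp [h v hv, mul_div_assoc]
  add_mem' := by
    intro s s' hs hs' i
    obtain ⟨N, F, hF, h⟩ := hs i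
    obtain ⟨N', F', hF', h'⟩ := hs' i
    refine ⟨N + N', F * MvPolynomial.X i ^ N' + F' * MvPolynomial.X i ^ N, ?_, ?_⟩
    · refine MvPolynomial.IsHomogeneous.add ?_ ?_
      · have := hF.mul (MvPolynomial.isHomogeneous_X_pow (R := K) i N')
        rwa [add_assoc] at this
      · have := hF'.mul (MvPolynomial.isHomogeneous_X_pow (R := K) i N)
        rwa [add_assoc, add_comm N' N] at this
    · intro v hv
      simp only [Pi.add_apply, h v hv, h' v hv, map_add, map_mul, map_pow, MvPolynomial.eval_X]
      field_simp
      ring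

/-- The restriction map `H⁰(X, 𝒪_X(t)) → H⁰(E, 𝒪_E(t))` for `E ⊆ X`. -/
def restriction {E X : Set (PSpace K n)} (hEX : E ⊆ X) (t : ℕ) :
    sections X t →ₗ[K] sections E t where
  toFun s := ⟨fun v => s.1 ⟨v.1, puncturedCone_mono hEX v.2⟩, fun i => by
    obtain ⟨N, F, hF, h⟩ := s.2 i
    exact ⟨N, F, hF, fun v hv => h ⟨v.1, puncturedCone_mono hEX v.2⟩ hv⟩⟩
  map_add' _ _ := rfl
  map_smul' _ _ := rfl

/-- `E` has maximal rank in `X`: for every `t ∈ ℕ` the restriction map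
`H⁰(X, 𝒪_X(t)) → H⁰(E, 𝒪_E(t))` is injective or surjective. -/
def HasMaximalRank {E X : Set (PSpace K n)} (hEX : E ⊆ X) : Prop :=
  ∀ t : ℕ, Function.Injective (restriction hEX t) ∨ Function.Surjective (restriction hEX t)

/-! ### Quadric hypersurfaces -/

/-- The set of points of the quadric hypersurface `Q = 0` of `ℙⁿ`. -/
def quadric (Q : QuadraticForm K (Fin (n + 1) → K)) : Set (PSpace K n) :=
  {p | Q p.rep = 0}

theorem mk_mem_quadric_iff (Q : QuadraticForm K (Fin (n + 1) → K)) {v : Fin (n + 1) → K}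
    (hv : v ≠ 0) : Projectivization.mk K v hv ∈ quadric Q ↔ Q v = 0 := by
  obtain ⟨a, ha⟩ := Projectivization.exists_smul_eq_mk_rep K v hv
  simp [quadric, ← ha, Units.smul_def, QuadraticMap.map_smul]

/-- The rank of the quadric `Q = 0`, i.e. `n + 1` minus the dimension of the linear subspace of
`K ^ (n + 1)` defining the vertex. In characteristic different from `2` this is the rank of a
symmetric matrix of `Q`; over an algebraically closed field of any characteristic it is the least
number of variables in which `Q` can be written after a linear change of coordinates. -/
def quadricRank (Q : QuadraticForm K (Fin (n + 1) → K)) : ℕ :=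
  Module.finrank K ((Fin (n + 1) → K) ⧸ Q.radical)

/-! ### Bamboos -/

/-- A bamboo of degree `d` in `ℙⁿ`: `d` distinct lines `L₀, …, L_{d-1}` such that `Lᵢ` and `Lⱼ`
meet if and only if `|i - j| ≤ 1`. (No three of the lines then pass through one point, so
their union is a connected nodal curve of arithmetic genus `0`.) A line of `ℙⁿ` is given by the
corresponding two-dimensional linear subspace of `K ^ (n + 1)`. -/
structure Bamboo (K : Type*) [Field K] (n d : ℕ) where
  /-- The lines, as planes through the origin. -/
  line : Fin d → Submodule K (Fin (n + 1) → K)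
  finrank_line : ∀ i, Module.finrank K (line i) = 2
  line_injective : Function.Injective line
  meet_iff : ∀ i j, (∃ p : PSpace K n, p ∈ (line i).projectivization ∧
    p ∈ (line j).projectivization) ↔ (i : ℕ) ≤ j + 1 ∧ (j : ℕ) ≤ i + 1

/-- The set of points of a bamboo. -/
def Bamboo.carrier {d : ℕ} (T : Bamboo K n d) : Set (PSpace K n) :=
  {p | ∃ i, p ∈ (T.line i).projectivization}

/-- The bamboo `T` meets the quadric `W : Q = 0` transversally: at each common point `[v]`, lying
on the line `Lᵢ` of `T` say, `T` is smooth (no other line of `T` contains the point), and `Lᵢ` is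
not contained in the projective tangent space `{[w] | polar Q v w = 0}` of `W` at `[v]`. (So
`W` is smooth at `[v]`, and the scheme `T ∩ W` is finite and reduced.) -/
def Bamboo.Transverse {d : ℕ} (T : Bamboo K n d) (Q : QuadraticForm K (Fin (n + 1) → K)) : Prop :=
  ∀ (i : Fin d) (v : Fin (n + 1) → K), v ∈ T.line i → v ≠ 0 → Q v = 0 →
    (∀ j, v ∈ T.line j → j = i) ∧ ∃ w ∈ T.line i, QuadraticMap.polar Q v w ≠ 0

end BambooQuadric

end

/-!
The proof is elementary and works with functions on vector spaces. Over the field `K`, the sections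
over a quadric of rank at least `4` are the restrictions of forms
(`exists_form_of_mem_sections`), so maximal rank of the bamboo means that for every degree `t`
the values of the forms of degree `t` at the `2 d` points of the bamboo on the quadric are either
arbitrary, or determine the restriction of a form to the quadric.

A bamboo comes from a `Chain`: a sequence of lines, each of which starts at a point of the preceding
one and is spanned by this point and by a marked point of the quadric; its second point on the
quadric is then given by a formula without square roots. The smooth points of a quadric of rank at
least `3` can be joined by rational curves in the quadric, so any two chains belong to a
one-parameter family with polynomial coordinates. Therefore open conditions on chains which can be
satisfied separately can be satisfied simultaneously (`Chain.OpenCond.exists_and`). Being in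
general position is such a condition, and so is maximal rank in a given degree. For `t ≥ 2 d` the
latter holds automatically, since products of linear forms separate the points. Thus it remains to
find, for each `t < 2 d` separately, a chain of maximal rank in degree `t`.

For `t ≤ 1` this is easy. For `t ≥ 2` it suffices to find a chain of some length `k` at whose points
the forms take arbitrary values, and for which the dimension of the space of forms on the quadric is
at most `2 k + 1`: such a chain can be truncated, or extended by lines through a further
point in general position (`HasGoodChain`, `HasGoodChain.exists_surj_or_inj`).

* If `t = 2`, a quadratic form which vanishes at the two points of a line is proportional to the
  equation of the quadric on the line. The assertion is deduced from the fact that a general path of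
  lines imposes independent conditions on quadratic forms (`exists_pathInterp`).
* For larger `t` a chain in the whole space for degree `t - 1` is continued by a chain in a
  hyperplane for degree `t`. This uses the exact sequence which relates the forms on the quadric
  to the forms on its hyperplane section (`exists_eq_linear_mul`, `formsRank_succ_le`). If both
  chains leave one form undetermined, a line with one point in the hyperplane and one point outside
  is put in front of them (`HasGoodChain.succ`). The existence of this line is a matter of plane
  geometry (`exists_secondPoint_eq`).

Of the quadratic form one mainly uses that there are vectors `e₁`, `e₂`, `e₃` on whose span it is
`x y + z ^ 2` (`ConicFrame`). This makes sense in every characteristic, and all arguments are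
uniform in it.
-/

noncomputable section

namespace BambooQuadric

open Module Filter

/-! ### Polynomial functions and polynomial curves -/

section Forms

variable {K : Type*} [Field K] {E : Type*} [AddCommGroup E] [Module K E]

/-- The functions `K → K` given by polynomials. -/
def polyFun (K : Type*) [Field K] : Subalgebra K (K → K) :=
  (AlgHom.pi fun s : K => Polynomial.aeval (R := K) s).range

theorem mem_polyFun {g : K → K} : g ∈ polyFun K ↔ ∃ P : Polynomial K, ∀ s, P.eval s = g s := by
  simp [polyFun, funext_iff, Polynomial.aeval_def, Polynomial.eval₂_eq_eval_map]

theorem const_mem_polyFun (c : K) : (fun _ => c) ∈ polyFun K :=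
  mem_polyFun.2 ⟨Polynomial.C c, by simp⟩

theorem id_mem_polyFun : (fun s => s) ∈ polyFun K :=
  mem_polyFun.2 ⟨Polynomial.X, by simp⟩

theorem eventually_ne_zero_of_polyFun {g : K → K} (hg : g ∈ polyFun K) {s : K} (hs : g s ≠ 0) :
    ∀ᶠ r in cofinite, g r ≠ 0 := by
  obtain ⟨P, hP⟩ := mem_polyFun.1 hg
  have hP0 : P ≠ 0 := by
    rintro rfl
    exact hs (by simp [← hP])
  rw [eventually_cofinite]
  refine (P.rootSet_finite K).subset fun r hr => ?_
  simp only [not_not, Set.mem_ofPred_eq] at hr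
  simp [Polynomial.mem_rootSet, hP0, hP, hr]

theorem det_mem_polyFun {ι : Type*} [Fintype ι] [DecidableEq ι] {A : K → Matrix ι ι K}
    (hA : ∀ i j, (fun s => A s i j) ∈ polyFun K) : (fun s => (A s).det) ∈ polyFun K := by
  have : (fun s => (A s).det) =
      ∑ σ : Equiv.Perm ι, Equiv.Perm.sign σ • ∏ i, fun s => A s (σ i) i := by
    ext s
    simp [Matrix.det_apply]
  rw [this]
  refine sum_mem fun σ _ => ?_
  have h := prod_mem (t := Finset.univ) fun i _ => hA (σ i) i
  rcases Int.units_eq_one_or (Equiv.Perm.sign σ) with h1 | h1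
  · simpa [h1] using h
  · simpa [h1] using h

/-- A curve in `E` all of whose coordinates are polynomial functions of the parameter. -/
def PolyCurve (γ : K → E) : Prop :=
  ∀ φ : Dual K E, (fun s => φ (γ s)) ∈ polyFun K

/-- A function on `E` which is polynomial along every polynomial curve. -/
def RegFun (P : E → K) : Prop :=
  ∀ γ : K → E, PolyCurve γ → (fun s => P (γ s)) ∈ polyFun K

theorem PolyCurve.const (v : E) : PolyCurve fun _ : K => v := fun φ => const_mem_polyFun (φ v)

theorem PolyCurve.add {γ δ : K → E} (hγ : PolyCurve γ) (hδ : PolyCurve δ) :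
    PolyCurve fun s => γ s + δ s := fun φ => by
  simp_rw [map_add]
  exact add_mem (hγ φ) (hδ φ)

theorem PolyCurve.smul {g : K → K} {γ : K → E} (hg : g ∈ polyFun K) (hγ : PolyCurve γ) :
    PolyCurve fun s => g s • γ s := fun φ => by
  simp_rw [map_smul, smul_eq_mul]
  exact mul_mem hg (hγ φ)

theorem PolyCurve.sub {γ δ : K → E} (hγ : PolyCurve γ) (hδ : PolyCurve δ) :
    PolyCurve fun s => γ s - δ s := fun φ => by
  simp_rw [map_sub]
  exact sub_mem (hγ φ) (hδ φ)

theorem PolyCurve.line (v w : E) : PolyCurve fun s : K => v + s • (w - v) :=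
  (PolyCurve.const v).add ((PolyCurve.const (w - v)).smul id_mem_polyFun)

theorem PolyCurve.map {F : Type*} [AddCommGroup F] [Module K F] {γ : K → E} (hγ : PolyCurve γ)
    (f : E →ₗ[K] F) : PolyCurve fun s => f (γ s) := fun φ => hγ (φ ∘ₗ f)

theorem RegFun.mul {P R : E → K} (hP : RegFun P) (hR : RegFun R) : RegFun fun v => P v * R v :=
  fun γ hγ => mul_mem (hP γ hγ) (hR γ hγ)

theorem RegFun.sub {P R : E → K} (hP : RegFun P) (hR : RegFun R) : RegFun fun v => P v - R v :=
  fun γ hγ => sub_mem (hP γ hγ) (hR γ hγ)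

theorem RegFun.linear (φ : Dual K E) : RegFun (φ : E → K) := fun _ hγ => hγ φ

/-- Two functions which are polynomial along lines have a common point where they do not vanish. -/
theorem RegFun.exists_ne_zero [Infinite K] {P R : E → K} (hP : RegFun P) (hR : RegFun R) {v w : E}
    (hv : P v ≠ 0) (hw : R w ≠ 0) : ∃ x, P x ≠ 0 ∧ R x ≠ 0 := by
  have h1 := eventually_ne_zero_of_polyFun (hP _ (PolyCurve.line v w)) (s := 0) (by simpa using hv)
  have h2 := eventually_ne_zero_of_polyFun (hR _ (PolyCurve.line v w)) (s := 1) (by simpa using hw)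
  obtain ⟨s, hs⟩ := (h1.and h2).exists
  exact ⟨_, hs⟩

/-- The forms of degree `t` on `E`: the span of the products of `t` linear forms, as functions. -/
def forms (K : Type*) [Field K] (E : Type*) [AddCommGroup E] [Module K E] (t : ℕ) :
    Submodule K (E → K) :=
  LinearMap.range (LinearMap.ltoFun K E K K) ^ t

theorem forms_zero_induction {F : E → K} (hF : F ∈ forms K E 0) : ∃ c : K, F = fun _ => c := by
  rw [forms, pow_zero, Submodule.mem_one] at hF
  obtain ⟨c, rfl⟩ := hF
  exact ⟨c, rfl⟩

theorem const_mem_forms (c : K) : (fun _ => c) ∈ forms K E 0 := by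
  rw [forms, pow_zero, Submodule.mem_one]
  exact ⟨c, rfl⟩

theorem mul_mem_forms {F G : E → K} {s t : ℕ} (hF : F ∈ forms K E s) (hG : G ∈ forms K E t) :
    (fun v => F v * G v) ∈ forms K E (s + t) := by
  rw [forms, pow_add]
  exact Submodule.mul_mem_mul hF hG

theorem linear_mem_forms (φ : Dual K E) : (φ : E → K) ∈ forms K E 1 := by
  rw [forms, pow_one]
  exact ⟨φ, rfl⟩

theorem exists_linear_of_mem_forms_one {F : E → K} (hF : F ∈ forms K E 1) :
    ∃ φ : Dual K E, F = φ := by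
  rw [forms, pow_one] at hF
  obtain ⟨φ, h⟩ := hF
  exact ⟨φ, h.symm⟩

theorem linear_mul_mem_forms (φ : Dual K E) {G : E → K} {t : ℕ} (hG : G ∈ forms K E t) :
    (fun v => φ v * G v) ∈ forms K E (t + 1) := by
  rw [add_comm]
  exact mul_mem_forms (linear_mem_forms φ) hG

theorem forms_succ_induction {t : ℕ} {p : (E → K) → Prop}
    (hmul : ∀ φ : Dual K E, ∀ G ∈ forms K E t, p fun v => φ v * G v)
    (hadd : ∀ F G, p F → p G → p (F + G)) {F : E → K} (hF : F ∈ forms K E (t + 1)) : p F := by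
  rw [forms, pow_succ'] at hF
  refine Submodule.mul_induction_on hF ?_ hadd
  rintro _ ⟨φ, rfl⟩ G hG
  exact hmul φ G hG

theorem forms_regFun {t : ℕ} {F : E → K} (hF : F ∈ forms K E t) : RegFun F := by
  induction t generalizing F with
  | zero =>
    obtain ⟨c, rfl⟩ := forms_zero_induction hF
    exact fun _ _ => const_mem_polyFun c
  | succ t ih =>
    refine forms_succ_induction (fun φ G hG γ hγ => mul_mem (hγ φ) (ih hG γ hγ))
      (fun F G hF hG γ hγ => add_mem (hF γ hγ) (hG γ hγ)) hF

theorem forms_smul {t : ℕ} {F : E → K} (hF : F ∈ forms K E t) (c : K) (v : E) :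
    F (c • v) = c ^ t * F v := by
  induction t generalizing F with
  | zero =>
    obtain ⟨c, rfl⟩ := forms_zero_induction hF
    simp
  | succ t ih =>
    refine forms_succ_induction (p := fun F => F (c • v) = c ^ (t + 1) * F v) ?_ ?_ hF
    · intro φ G hG
      simp only [ih hG, map_smul, smul_eq_mul]
      ring
    · intro F G hF hG
      simp [hF, hG, mul_add]

theorem forms_comp {E' : Type*} [AddCommGroup E'] [Module K E'] (f : E' →ₗ[K] E) {t : ℕ}
    {F : E → K} (hF : F ∈ forms K E t) : (fun v => F (f v)) ∈ forms K E' t := by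
  induction t generalizing F with
  | zero =>
    obtain ⟨c, rfl⟩ := forms_zero_induction hF
    exact const_mem_forms c
  | succ t ih =>
    exact forms_succ_induction (p := fun F => (fun v => F (f v)) ∈ forms K E' (t + 1))
      (fun φ G hG => linear_mul_mem_forms (φ ∘ₗ f) (ih hG)) (fun F G hF hG => add_mem hF hG) hF

instance [FiniteDimensional K E] (t : ℕ) : FiniteDimensional K (forms K E t) := by
  rw [← Submodule.fg_iff_finiteDimensional]
  refine Submodule.FG.pow ?_ t
  rw [Submodule.fg_iff_finiteDimensional]
  infer_instance

theorem pow_mem_forms (φ : Dual K E) (t : ℕ) : (fun v => φ v ^ t) ∈ forms K E t := by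
  induction t with
  | zero => simpa using const_mem_forms (E := E) (1 : K)
  | succ t ih => simpa [pow_succ'] using linear_mul_mem_forms φ ih

theorem prod_mem_forms {ι : Type*} (s : Finset ι) (φ : ι → Dual K E) :
    (fun v => ∏ i ∈ s, φ i v) ∈ forms K E s.card := by
  classical
  induction s using Finset.induction_on with
  | empty => simpa using const_mem_forms (E := E) (1 : K)
  | insert a s ha ih => simpa [ha] using linear_mul_mem_forms (φ a) ih

theorem quadraticForm_mem_forms [FiniteDimensional K E] (Q : QuadraticForm K E) :
    (Q : E → K) ∈ forms K E 2 := by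
  obtain ⟨B, rfl⟩ := LinearMap.BilinMap.toQuadraticMap_surjective Q
  set b := finBasis K E
  have : (LinearMap.BilinMap.toQuadraticMap B : E → K) =
      ∑ i, fun v => b.coord i v * B (b i) v := by
    ext v
    have h : B v v = B (∑ i, b.repr v i • b i) v := by rw [b.sum_repr]
    rw [LinearMap.BilinMap.toQuadraticMap_apply, h, map_sum, LinearMap.sum_apply]
    simp
  rw [this]
  exact sum_mem fun i _ => linear_mul_mem_forms _ (linear_mem_forms _)

theorem quadraticForm_regFun [FiniteDimensional K E] (Q : QuadraticForm K E) :
    RegFun (Q : E → K) :=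
  forms_regFun (quadraticForm_mem_forms Q)

theorem polar_mem_polyFun [FiniteDimensional K E] (Q : QuadraticForm K E) {γ δ : K → E}
    (hγ : PolyCurve γ) (hδ : PolyCurve δ) :
    (fun s => QuadraticMap.polar Q (γ s) (δ s)) ∈ polyFun K :=
  sub_mem (sub_mem (quadraticForm_regFun Q _ (hγ.add hδ)) (quadraticForm_regFun Q _ hγ))
    (quadraticForm_regFun Q _ hδ)

/-- The domain property of the algebra of polynomial functions on `E`. -/
theorem eq_zero_of_mul_eq_zero [Infinite K] {P R : E → K} (hP : RegFun P) (hR : RegFun R)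
    (h : ∀ v, P v * R v = 0) {w : E} (hw : R w ≠ 0) (v : E) : P v = 0 := by
  by_contra hv
  obtain ⟨x, hx, hx'⟩ := hP.exists_ne_zero hR hv hw
  exact mul_ne_zero hx hx' (h x)

/-! ### Linear maps depending polynomially on a parameter -/

/-- Injectivity is an open condition. -/
theorem eventually_injective {V ι : Type*} [AddCommGroup V] [Module K V] [FiniteDimensional K V]
    [Finite ι] {A : K → V →ₗ[K] (ι → K)} (hA : ∀ v i, (fun s => A s v i) ∈ polyFun K) {s₀ : K}
    (h : Function.Injective (A s₀)) : ∀ᶠ s in cofinite, Function.Injective (A s) := by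
  classical
  have := Fintype.ofFinite ι
  obtain ⟨L, hL⟩ := (A s₀).exists_leftInverse_of_injective (LinearMap.ker_eq_bot.2 h)
  set b := finBasis K V
  have hdet : (fun s => (L ∘ₗ A s).det) ∈ polyFun K := by
    simp_rw [← LinearMap.det_toMatrix b]
    refine det_mem_polyFun fun i j => ?_
    have : (fun s => LinearMap.toMatrix b b (L ∘ₗ A s) i j) =
        ∑ k, (fun s => A s (b j) k) * fun _ => b.repr (L (Pi.single k 1)) i := by
      ext s
      rw [LinearMap.toMatrix_apply, LinearMap.comp_apply]
      conv_lhs => enter [1, 2, 2]; rw [← Finset.univ_sum_single (A s (b j))]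
      have (k : ι) (c : K) : (Pi.single k c : ι → K) = c • Pi.single k 1 := by
        rw [← Pi.single_smul]; simp
      simp_rw [this _ (A s (b j) _)]
      simp
    rw [this]
    exact sum_mem fun k _ => mul_mem (hA _ _) (const_mem_polyFun _)
  refine (eventually_ne_zero_of_polyFun hdet (s := s₀) (by simp [hL])).mono fun s hs => ?_
  have : Function.Injective (L ∘ₗ A s) := by
    have := (LinearMap.equivOfDetNeZero _ hs).injective
    exact this
  exact Function.Injective.of_comp (f := L) (by simpa using this)

/-- If all members of a family vanish on `N`, then having kernel `N` is an open condition. -/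
theorem eventually_ker_le {V ι : Type*} [AddCommGroup V] [Module K V] [FiniteDimensional K V]
    [Finite ι] {A : K → V →ₗ[K] (ι → K)} (hA : ∀ v i, (fun s => A s v i) ∈ polyFun K)
    {N : Submodule K V} (hN : ∀ s, N ≤ LinearMap.ker (A s)) {s₀ : K}
    (h : LinearMap.ker (A s₀) ≤ N) : ∀ᶠ s in cofinite, LinearMap.ker (A s) ≤ N := by
  obtain ⟨C, hC⟩ := N.exists_isCompl
  have h1 : Function.Injective ((A s₀).domRestrict C) := by
    rw [injective_iff_map_eq_zero]
    intro F hF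
    exact Subtype.ext (Submodule.disjoint_def.1 hC.disjoint _ (h hF) F.2)
  refine (eventually_injective (A := fun s => (A s).domRestrict C) (fun F i => hA F.1 i)
    h1).mono fun s hs F hF => ?_
  obtain ⟨F₁, hF₁, F₂, hF₂, rfl⟩ := Submodule.mem_sup.1
    (show F ∈ N ⊔ C by rw [hC.sup_eq_top]; trivial)
  have h2 : A s F₂ = 0 := by simpa [LinearMap.mem_ker.1 (hN s hF₁)] using hF
  have h3 : (⟨F₂, hF₂⟩ : C) = 0 := (injective_iff_map_eq_zero _).1 hs _ h2
  have h4 : F₂ = 0 := congrArg Subtype.val h3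
  simpa [h4] using hF₁

theorem exists_smul_eq_of_finrank_le {V W : Type*} [AddCommGroup V] [Module K V]
    [FiniteDimensional K V] [AddCommGroup W] [Module K W] {A : V →ₗ[K] W}
    (hA : Function.Surjective A) (h : finrank K V ≤ finrank K W + 1) {F₀ F : V} (hF₀ : F₀ ≠ 0)
    (hA₀ : A F₀ = 0) (hF : A F = 0) : ∃ c : K, c • F₀ = F := by
  have h1 := LinearMap.finrank_range_add_finrank_ker A
  rw [LinearMap.range_eq_top.2 hA, finrank_top] at h1
  obtain ⟨g, hg⟩ := finrank_le_one_iff.1 (show finrank K (LinearMap.ker A) ≤ 1 by omega)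
  obtain ⟨c, hc⟩ := hg ⟨F₀, hA₀⟩
  obtain ⟨d, hd⟩ := hg ⟨F, hF⟩
  have hc' : c • (g : V) = F₀ := congrArg Subtype.val hc
  have hd' : d • (g : V) = F := congrArg Subtype.val hd
  have hc0 : c ≠ 0 := by
    rintro rfl
    exact hF₀ (by rw [← hc', zero_smul])
  exact ⟨d / c, by rw [← hc', smul_smul, div_mul_cancel₀ _ hc0, hd']⟩

/-- Surjectivity is an open condition. -/
theorem eventually_surjective {V ι : Type*} [AddCommGroup V] [Module K V]
    [Finite ι] {A : K → V →ₗ[K] (ι → K)} (hA : ∀ v i, (fun s => A s v i) ∈ polyFun K) {s₀ : K}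
    (h : Function.Surjective (A s₀)) : ∀ᶠ s in cofinite, Function.Surjective (A s) := by
  classical
  have := Fintype.ofFinite ι
  obtain ⟨R, hR⟩ := (A s₀).exists_rightInverse_of_surjective (LinearMap.range_eq_top.2 h)
  have hdet : (fun s => (A s ∘ₗ R).det) ∈ polyFun K := by
    simp_rw [← LinearMap.det_toMatrix (Pi.basisFun K ι)]
    refine det_mem_polyFun fun i j => ?_
    simpa [LinearMap.toMatrix_apply] using hA (R (Pi.single j 1)) i
  refine (eventually_ne_zero_of_polyFun hdet (s := s₀) (by simp [hR])).mono fun s hs => ?_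
  have : Function.Surjective (A s ∘ₗ R) := (LinearMap.equivOfDetNeZero _ hs).surjective
  exact Function.Surjective.of_comp (g := R) (by simpa using this)

end Forms

/-! ### Points on the affine cone of a quadric -/

section Quadric

variable {K : Type*} [Field K] {E : Type*} [AddCommGroup E] [Module K E]

/-- For an isotropic vector `a`, the second point of the line through `[a]` and `[p]` on the
quadric `Q = 0`, in a form which is polynomial in `a` and `p`. -/
def secondPoint (Q : QuadraticForm K E) (a p : E) : E :=
  Q p • a - QuadraticMap.polar Q a p • p

/-- The vector `a` represents a smooth point of the quadric `Q = 0`. -/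
def SmoothVec (Q : QuadraticForm K E) (a : E) : Prop :=
  Q a = 0 ∧ ∃ w, QuadraticMap.polar Q a w ≠ 0

/-- Isotropic vectors `e₁`, `e₂` with `Q (x e₁ + y e₂) = x y`. -/
structure HypPair (Q : QuadraticForm K E) (e₁ e₂ : E) : Prop where
  fst : Q e₁ = 0
  snd : Q e₂ = 0
  polar : QuadraticMap.polar Q e₁ e₂ = 1

/-- Vectors with `Q (x e₁ + y e₂ + z e₃) = x y + z ^ 2`. They exist if `Q` has rank at
least `3`, and they are what the argument needs of `Q`, in any characteristic. -/
structure ConicFrame (Q : QuadraticForm K E) (e₁ e₂ e₃ : E) : Prop extends HypPair Q e₁ e₂ where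
  thd : Q e₃ = 1
  polar₁ : QuadraticMap.polar Q e₁ e₃ = 0
  polar₂ : QuadraticMap.polar Q e₂ e₃ = 0

variable {Q : QuadraticForm K E}

theorem exists_root_quadratic [IsAlgClosed K] {a b c : K} (ha : a ≠ 0) :
    ∃ z : K, a * z ^ 2 + b * z + c = 0 := by
  obtain ⟨z, hz⟩ := IsAlgClosed.exists_root
    (Polynomial.C a * Polynomial.X ^ 2 + Polynomial.C b * Polynomial.X + Polynomial.C c) (by
      rw [Polynomial.degree_quadratic ha]
      simp)
  exact ⟨z, by simpa using hz⟩

theorem map_comb (Q : QuadraticForm K E) (x y : K) (v w : E) :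
    Q (x • v + y • w) = x ^ 2 * Q v + y ^ 2 * Q w + x * y * QuadraticMap.polar Q v w := by
  rw [QuadraticMap.map_add Q, QuadraticMap.map_smul, QuadraticMap.map_smul,
    QuadraticMap.polar_smul_left, QuadraticMap.polar_smul_right]
  simp only [smul_eq_mul]
  ring

theorem polar_self_eq_zero {a : E} (ha : Q a = 0) : QuadraticMap.polar Q a a = 0 := by
  simp [ha]

theorem map_secondPoint {a : E} (ha : Q a = 0) (p : E) : Q (secondPoint Q a p) = 0 := by
  rw [secondPoint, sub_eq_add_neg, ← neg_smul, map_comb, ha]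
  ring

theorem polar_secondPoint (a p w : E) : QuadraticMap.polar Q (secondPoint Q a p) w =
    Q p * QuadraticMap.polar Q a w - QuadraticMap.polar Q a p * QuadraticMap.polar Q p w := by
  simp [secondPoint, QuadraticMap.polar_sub_left, QuadraticMap.polar_smul_left]

theorem polar_secondPoint_self {a : E} (ha : Q a = 0) (p : E) :
    QuadraticMap.polar Q (secondPoint Q a p) a = - QuadraticMap.polar Q a p ^ 2 := by
  rw [polar_secondPoint, polar_self_eq_zero ha, QuadraticMap.polar_comm Q p a]
  ring

theorem secondPoint_of_isotropic {a v : E} (hv : Q v = 0) :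
    secondPoint Q a v = (- QuadraticMap.polar Q a v) • v := by
  simp [secondPoint, hv]

theorem PolyCurve.secondPoint [FiniteDimensional K E] {γ δ : K → E} (hγ : PolyCurve γ)
    (hδ : PolyCurve δ) : PolyCurve fun s => secondPoint Q (γ s) (δ s) :=
  (hγ.smul (quadraticForm_regFun Q _ hδ)).sub (hδ.smul (polar_mem_polyFun Q hγ hδ))

theorem HypPair.smooth₁ {e₁ e₂ : E} (h : HypPair Q e₁ e₂) : SmoothVec Q e₁ :=
  ⟨h.fst, e₂, by simp [h.polar]⟩

theorem HypPair.smooth₂ {e₁ e₂ : E} (h : HypPair Q e₁ e₂) : SmoothVec Q e₂ :=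
  ⟨h.snd, e₁, by simp [QuadraticMap.polar_comm Q e₂ e₁, h.polar]⟩

theorem SmoothVec.polarBilin_ne_zero {a : E} (ha : SmoothVec Q a) :
    QuadraticMap.polarBilin Q a ≠ 0 := by
  obtain ⟨w, hw⟩ := ha.2
  exact DFunLike.ne_iff.2 ⟨w, hw⟩

section

variable [Infinite K] {e₁ e₂ e₃ : E}

/-- The points of the quadric which are obtained by projection from `e₁` are not contained in a
hyperplane. -/
theorem ConicFrame.exists_secondPoint_ne_zero (h : ConicFrame Q e₁ e₂ e₃) {m : Dual K E}
    (hm : m ≠ 0) : ∃ v, m (secondPoint Q e₁ v) ≠ 0 := by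
  by_cases h1 : m e₁ = 0
  · obtain ⟨w, hw⟩ := DFunLike.ne_iff.1 hm
    obtain ⟨v, hv, hv'⟩ := (RegFun.linear m).exists_ne_zero
      (RegFun.linear (QuadraticMap.polarBilin Q e₁)) hw (w := e₂) (by simp [h.polar])
    refine ⟨v, ?_⟩
    simp only [QuadraticMap.polarBilin_apply_apply] at hv'
    simp [secondPoint, h1, hv, hv']
  · exact ⟨e₃, by simpa [secondPoint, h.polar₁, h.thd] using h1⟩

/-- The smooth points are dense in the quadric. -/
theorem HypPair.exists_smooth (h : HypPair Q e₁ e₂) {P : E → K} (hP : RegFun P) {y : E}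
    (hy : Q y = 0) (hPy : P y ≠ 0) : ∃ z, SmoothVec Q z ∧ P z ≠ 0 := by
  by_cases hs : ∃ w, QuadraticMap.polar Q y w ≠ 0
  · exact ⟨y, ⟨hy, hs⟩, hPy⟩
  push Not at hs
  -- The line which joins a singular point `y` to `e₁` lies on the quadric.
  have h1 := eventually_ne_zero_of_polyFun (hP _ (PolyCurve.line y (y + e₁))) (s := 0) (by simpa)
  obtain ⟨s, hs1, hs2⟩ := (h1.and (Set.finite_singleton (0 : K)).compl_mem_cofinite).exists
  refine ⟨_, ⟨?_, e₂, ?_⟩, hs1⟩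
  · simp [QuadraticMap.map_add, hy, QuadraticMap.map_smul, h.fst, hs]
  · simpa [QuadraticMap.polar_add_left, hs, QuadraticMap.polar_smul_left, h.polar] using hs2

variable [FiniteDimensional K E]

/-- The isotropic vectors are not contained in the union of two hyperplanes. -/
theorem ConicFrame.exists_isotropic_ne_zero (h : ConicFrame Q e₁ e₂ e₃) {m₀ m₁ : Dual K E}
    (h₀ : m₀ ≠ 0) (h₁ : m₁ ≠ 0) : ∃ o, Q o = 0 ∧ m₀ o ≠ 0 ∧ m₁ o ≠ 0 := by
  obtain ⟨v, hv⟩ := h.exists_secondPoint_ne_zero h₀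
  obtain ⟨w, hw⟩ := h.exists_secondPoint_ne_zero h₁
  have key (m : Dual K E) : RegFun fun v => m (secondPoint Q e₁ v) := fun γ hγ =>
    ((PolyCurve.const e₁).secondPoint hγ) m
  obtain ⟨x, hx⟩ := (key m₀).exists_ne_zero (key m₁) hv hw
  exact ⟨_, map_secondPoint h.fst x, hx⟩

/-- Two smooth points of the cone are joined by a polynomial curve in the cone: project from a
point `o` of the quadric in general position, and pull back a line. -/
theorem ConicFrame.exists_curve (h : ConicFrame Q e₁ e₂ e₃) {a b : E} (ha : SmoothVec Q a)
    (hb : SmoothVec Q b) : ∃ γ : K → E, PolyCurve γ ∧ (∀ s, Q (γ s) = 0) ∧ γ 0 = a ∧ γ 1 = b := by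
  obtain ⟨o, ho, hoa, hob⟩ :=
    h.exists_isotropic_ne_zero ha.polarBilin_ne_zero hb.polarBilin_ne_zero
  simp only [QuadraticMap.polarBilin_apply_apply] at hoa hob
  rw [QuadraticMap.polar_comm] at hoa hob
  set x := - (QuadraticMap.polar Q o a)⁻¹
  set y := - (QuadraticMap.polar Q o b)⁻¹
  refine ⟨fun s => (x + s * (y - x)) • secondPoint Q o (a + s • (b - a)), ?_, ?_, ?_, ?_⟩
  · refine PolyCurve.smul ?_ ((PolyCurve.const o).secondPoint (PolyCurve.line a b))
    exact add_mem (const_mem_polyFun x) (mul_mem id_mem_polyFun (const_mem_polyFun (y - x)))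
  · intro s
    simp [QuadraticMap.map_smul, map_secondPoint ho]
  · simp [secondPoint_of_isotropic ha.1, x, smul_smul, hoa]
  · simp [secondPoint_of_isotropic hb.1, y, smul_smul, hob]

/-- The quadric is irreducible. -/
theorem ConicFrame.exists_common (h : ConicFrame Q e₁ e₂ e₃) {P R : E → K} (hP : RegFun P)
    (hR : RegFun R) {y z : E} (hy : Q y = 0) (hPy : P y ≠ 0) (hz : Q z = 0) (hRz : R z ≠ 0) :
    ∃ x, SmoothVec Q x ∧ P x ≠ 0 ∧ R x ≠ 0 := by
  obtain ⟨a, ha, hPa⟩ := h.exists_smooth hP hy hPy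
  obtain ⟨b, hb, hRb⟩ := h.exists_smooth hR hz hRz
  obtain ⟨γ, hγ, hQ, rfl, rfl⟩ := h.exists_curve ha hb
  have h1 := eventually_ne_zero_of_polyFun (hP _ hγ) hPa
  have h2 := eventually_ne_zero_of_polyFun (hR _ hγ) hRb
  obtain ⟨s, hs1, hs2⟩ := (h1.and h2).exists
  obtain ⟨x, hx, hx'⟩ := h.exists_smooth (hP.mul hR) (hQ s) (mul_ne_zero hs1 hs2)
  exact ⟨x, hx, left_ne_zero_of_mul hx', right_ne_zero_of_mul hx'⟩

end

end Quadric

/-! ### Forms vanishing on a quadric -/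

section Nullstellensatz

variable {K : Type*} [Field K] {E : Type*} [AddCommGroup E] [Module K E]

/-- The forms of degree `t - 1`, which is to mean `0` for `t = 0`. -/
def predForms (K : Type*) [Field K] (E : Type*) [AddCommGroup E] [Module K E] :
    ℕ → Submodule K (E → K)
  | 0 => ⊥
  | t + 1 => forms K E t

theorem linear_mul_mem_of_mem_predForms (φ : Dual K E) {t : ℕ} {G : E → K}
    (hG : G ∈ predForms K E t) : (fun v => φ v * G v) ∈ forms K E t := by
  cases t with
  | zero =>
    rw [predForms, Submodule.mem_bot] at hG
    subst hG
    simp only [Pi.zero_apply, mul_zero]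
    exact zero_mem _
  | succ t => exact linear_mul_mem_forms φ hG

theorem predForms_comp {E' : Type*} [AddCommGroup E'] [Module K E'] (f : E' →ₗ[K] E) {t : ℕ}
    {F : E → K} (hF : F ∈ predForms K E t) : (fun v => F (f v)) ∈ predForms K E' t := by
  cases t with
  | zero =>
    rw [predForms, Submodule.mem_bot] at hF
    subst hF
    exact zero_mem _
  | succ t => exact forms_comp f hF

/-- The projection of `E` to the kernel of the linear form `l` along a vector `e` with `l e = 1`. -/
def proj (l : Dual K E) (e : E) : E →ₗ[K] E :=
  LinearMap.id - l.smulRight e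

theorem proj_apply (l : Dual K E) (e v : E) : proj l e v = v - l v • e := rfl

theorem proj_add (l : Dual K E) (e v : E) : proj l e v + l v • e = v := by
  simp [proj_apply]

theorem linear_proj {l : Dual K E} {e : E} (he : l e = 1) (v : E) : l (proj l e v) = 0 := by
  simp [proj_apply, he]

theorem proj_eq_self {l : Dual K E} (e : E) {v : E} (hv : l v = 0) : proj l e v = v := by
  simp [proj_apply, hv]

/-- Division of a form by a quadratic form `Q` with respect to the variable `l`, which occurs in
`Q` with a nonzero pure square. -/
theorem exists_division [FiniteDimensional K E] (Q : QuadraticForm K E) {l : Dual K E} {e : E}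
    (hQe : Q e ≠ 0) {t : ℕ} {F : E → K} (hF : F ∈ forms K E (t + 1)) :
    ∃ G ∈ predForms K E t, ∃ A ∈ forms K E t, ∃ B ∈ forms K E (t + 1),
      ∀ v, F v = Q v * G v + A (proj l e v) * l v + B (proj l e v) := by
  have hsq (v : E) : l v ^ 2 = (Q e)⁻¹ * (Q v - Q (proj l e v)
      - l v * QuadraticMap.polar Q (proj l e v) e) := by
    have h1 := map_comb Q 1 (l v) (proj l e v) e
    rw [one_smul, proj_add] at h1
    rw [h1]
    field_simp
    ring
  have hlin (φ : Dual K E) (v : E) : φ v = φ (proj l e v) + φ e * l v := by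
    conv_lhs => rw [← proj_add l e v]
    simp [mul_comm]
  induction t generalizing F with
  | zero =>
    obtain ⟨φ, rfl⟩ := exists_linear_of_mem_forms_one hF
    refine ⟨0, zero_mem _, _, const_mem_forms (φ e), φ, linear_mem_forms φ, fun v => ?_⟩
    rw [hlin φ v]
    simp
    ring
  | succ t ih =>
    have hadd : ∀ F G : E → K,
        (∃ G ∈ predForms K E (t + 1), ∃ A ∈ forms K E (t + 1), ∃ B ∈ forms K E (t + 1 + 1),
          ∀ v, F v = Q v * G v + A (proj l e v) * l v + B (proj l e v)) →
        (∃ H ∈ predForms K E (t + 1), ∃ A ∈ forms K E (t + 1), ∃ B ∈ forms K E (t + 1 + 1),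
          ∀ v, G v = Q v * H v + A (proj l e v) * l v + B (proj l e v)) →
        ∃ H ∈ predForms K E (t + 1), ∃ A ∈ forms K E (t + 1), ∃ B ∈ forms K E (t + 1 + 1),
          ∀ v, (F + G) v = Q v * H v + A (proj l e v) * l v + B (proj l e v) := by
      rintro F₁ F₂ ⟨G₁, hG₁, A₁, hA₁, B₁, hB₁, h₁⟩ ⟨G₂, hG₂, A₂, hA₂, B₂, hB₂, h₂⟩
      refine ⟨G₁ + G₂, add_mem hG₁ hG₂, A₁ + A₂, add_mem hA₁ hA₂, B₁ + B₂, add_mem hB₁ hB₂,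
        fun v => ?_⟩
      simp only [Pi.add_apply, h₁, h₂]
      ring
    refine forms_succ_induction (p := fun F => ∃ G ∈ predForms K E (t + 1),
      ∃ A ∈ forms K E (t + 1), ∃ B ∈ forms K E (t + 1 + 1),
      ∀ v, F v = Q v * G v + A (proj l e v) * l v + B (proj l e v)) ?_ hadd hF
    intro φ F' hF'
    obtain ⟨G, hG, A, hA, B, hB, h⟩ := ih hF'
    -- `φ v * (A l + B)` is expanded, and `l ^ 2` is eliminated by means of `hsq`.
    set k := φ e * (Q e)⁻¹
    have hAQ : (fun v => Q v * A v) ∈ forms K E (t + 1 + 1) := by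
      have := mul_mem_forms (quadraticForm_mem_forms Q) hA
      rwa [add_comm 2 t] at this
    refine ⟨(fun v => φ v * G v) + k • fun v => A (proj l e v),
      add_mem (linear_mul_mem_of_mem_predForms φ hG) (Submodule.smul_mem _ _ (forms_comp _ hA)),
      (fun v => φ v * A v) + φ e • B - k • fun v => QuadraticMap.polarBilin Q e v * A v,
      sub_mem (add_mem (linear_mul_mem_forms φ hA) (Submodule.smul_mem _ _ hB))
        (Submodule.smul_mem _ _ (linear_mul_mem_forms _ hA)),
      (fun v => φ v * B v) - k • fun v => Q v * A v,
      sub_mem (linear_mul_mem_forms φ hB) (Submodule.smul_mem _ _ hAQ), fun v => ?_⟩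
    have h2 := hsq v
    rw [QuadraticMap.polar_comm] at h2
    simp only [h, Pi.add_apply, Pi.sub_apply, Pi.smul_apply, smul_eq_mul,
      QuadraticMap.polarBilin_apply_apply, k]
    generalize QuadraticMap.polar Q e (proj l e v) = r at *
    linear_combination (A (proj l e v) * l v + B (proj l e v)) * hlin φ v +
      φ e * A (proj l e v) * h2

/-- A form which vanishes on the quadric is a multiple of its equation: on the lines in a fixed
direction which meet the quadric in two points, the remainder of the division by `Q` vanishes. -/
theorem HypPair.exists_eq_mul [IsAlgClosed K] [FiniteDimensional K E] {Q : QuadraticForm K E}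
    {e₁ e₂ : E} (h : HypPair Q e₁ e₂) {t : ℕ} {F : E → K} (hF : F ∈ forms K E (t + 1))
    (hF0 : ∀ v, Q v = 0 → F v = 0) : ∃ G ∈ predForms K E t, ∀ v, F v = Q v * G v := by
  have : Infinite K := IsAlgClosed.instInfinite
  set e := e₁ + e₂
  set l : Dual K E := QuadraticMap.polarBilin Q e₂
  have hQe : Q e = 1 := by simp [e, QuadraticMap.map_add Q, h.fst, h.snd, h.polar]
  have hle : l e = 1 := by
    simp [l, e, QuadraticMap.polar_comm Q e₂ e₁, h.polar, h.snd]
  have hp1 : QuadraticMap.polar Q e₁ e = 1 := by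
    simp [e, h.polar, h.fst, QuadraticMap.polar_add_right]
  obtain ⟨G, hG, A, hA, B, hB, hdiv⟩ := exists_division Q (l := l) (e := e) (by simp [hQe]) hF
  -- On the lines in direction `e` on which the discriminant of `Q` does not vanish, the remainder
  -- is an affine function with two zeros.
  have hdisc : RegFun fun v => QuadraticMap.polar Q v e ^ 2 - 4 * Q v := fun γ hγ =>
    sub_mem (pow_mem (polar_mem_polyFun Q hγ (PolyCurve.const e)) 2)
      (mul_mem (const_mem_polyFun 4) (quadraticForm_regFun Q γ hγ))
  have hAB (v : E) (hv : QuadraticMap.polar Q v e ^ 2 - 4 * Q v ≠ 0) :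
      A (proj l e v) = 0 ∧ B (proj l e v) = 0 := by
    set w := proj l e v
    have hvw : v = (1 : K) • w + l v • e := by rw [one_smul]; exact (proj_add l e v).symm
    set p := QuadraticMap.polar Q w e
    have hd : p ^ 2 - 4 * Q w ≠ 0 := by
      convert hv using 1
      have h1 : Q v = _ := (congrArg Q hvw).trans (map_comb Q _ _ _ _)
      have h2 : QuadraticMap.polar Q v e = p + l v * 2 := by
        conv_lhs => rw [hvw]
        simp [QuadraticMap.polar_add_left, QuadraticMap.polar_smul_left, hQe, p]
      rw [h1, h2, hQe]
      ring
    obtain ⟨z, hz⟩ := exists_root_quadratic (b := p) (c := Q w) (one_ne_zero (α := K))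
    rw [one_mul] at hz
    have hroot (x : K) (hx : x ^ 2 + p * x + Q w = 0) : A w * x + B w = 0 := by
      have hl : l (w + x • e) = x := by simp [w, linear_proj hle, hle]
      have hw : proj l e (w + x • e) = w := by simp [proj_apply, hl]
      have hQ : Q (w + x • e) = 0 := by
        have := map_comb Q 1 x w e
        rw [one_smul] at this
        rw [this, hQe, ← hx]
        ring
      have := hdiv (w + x • e)
      rw [hF0 _ hQ, hQ, hl, hw] at this
      linear_combination -this
    have h1 := hroot z hz
    have h2 := hroot (-p - z) (by linear_combination hz)
    have hne : 2 * z + p ≠ 0 := fun h0 => hd (by linear_combination (2 * z + p) * h0 - 4 * hz)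
    have hA0 : A w = 0 := by
      refine (mul_eq_zero.1 (?_ : A w * (2 * z + p) = 0)).resolve_right hne
      linear_combination h1 - h2
    exact ⟨hA0, by simpa [hA0] using h1⟩
  have h1 : QuadraticMap.polar Q e₁ e ^ 2 - 4 * Q e₁ ≠ 0 := by simp [hp1, h.fst]
  have hA0 := eq_zero_of_mul_eq_zero (forms_regFun (forms_comp (proj l e) hA)) hdisc
    (fun v => by by_cases hv : QuadraticMap.polar Q v e ^ 2 - 4 * Q v = 0
                 · simp [hv]
                 · simp [(hAB v hv).1]) h1
  have hB0 := eq_zero_of_mul_eq_zero (forms_regFun (forms_comp (proj l e) hB)) hdisc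
    (fun v => by by_cases hv : QuadraticMap.polar Q v e ^ 2 - 4 * Q v = 0
                 · simp [hv]
                 · simp [(hAB v hv).2]) h1
  exact ⟨G, hG, fun v => by rw [hdiv, hA0, hB0]; simp⟩

/-- A form is determined modulo `l` by its restriction to the hyperplane `l = 0`. -/
theorem exists_eq_add_linear_mul (l : Dual K E) (e : E) {t : ℕ} {F : E → K}
    (hF : F ∈ forms K E (t + 1)) :
    ∃ G ∈ forms K E t, ∀ v, F v = F (proj l e v) + l v * G v := by
  have hlin (φ : Dual K E) (v : E) : φ v = φ (proj l e v) + φ e * l v := by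
    conv_lhs => rw [← proj_add l e v]
    simp [mul_comm]
  induction t generalizing F with
  | zero =>
    obtain ⟨φ, rfl⟩ := exists_linear_of_mem_forms_one hF
    exact ⟨_, const_mem_forms (φ e), fun v => by rw [hlin φ v]; simp [mul_comm]⟩
  | succ t ih =>
    refine forms_succ_induction (p := fun F => ∃ G ∈ forms K E (t + 1),
      ∀ v, F v = F (proj l e v) + l v * G v) ?_ ?_ hF
    · intro φ F' hF'
      obtain ⟨G, hG, h⟩ := ih hF'
      refine ⟨_, add_mem (linear_mul_mem_forms (φ ∘ₗ proj l e) hG)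
        (Submodule.smul_mem _ (φ e) hF'), fun v => ?_⟩
      have h1 := h v
      have h2 := hlin φ v
      simp only [Pi.add_apply, Pi.smul_apply, smul_eq_mul, LinearMap.comp_apply]
      linear_combination F' v * h2 + φ (proj l e v) * h1
    · rintro F₁ F₂ ⟨G₁, hG₁, h₁⟩ ⟨G₂, hG₂, h₂⟩
      refine ⟨G₁ + G₂, add_mem hG₁ hG₂, fun v => ?_⟩
      simp only [Pi.add_apply]
      linear_combination h₁ v + h₂ v

/-- The restriction of a quadratic form to a hyperplane. -/
def restrictKer (Q : QuadraticForm K E) (l : Dual K E) : QuadraticForm K (LinearMap.ker l) :=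
  Q.comp (LinearMap.ker l).subtype

/-- The projection onto the hyperplane `l = 0` along `e`. -/
def projKer (l : Dual K E) (e : E) (he : l e = 1) : E →ₗ[K] LinearMap.ker l :=
  (proj l e).codRestrict _ fun v => linear_proj he v

theorem projKer_coe {l : Dual K E} {e : E} (he : l e = 1) (v : LinearMap.ker l) :
    projKer l e he v = v :=
  Subtype.ext (proj_eq_self e v.2)

/-- A form which vanishes on the section of the quadric by the hyperplane `l = 0` is, on the
quadric, a multiple of `l`. -/
theorem exists_eq_linear_mul [IsAlgClosed K] [FiniteDimensional K E] {Q : QuadraticForm K E}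
    {l : Dual K E} {e : E} (he : l e = 1) {e₁ e₂ : LinearMap.ker l}
    (h : HypPair (restrictKer Q l) e₁ e₂) {t : ℕ} {F : E → K} (hF : F ∈ forms K E (t + 1))
    (hF0 : ∀ v, Q v = 0 → l v = 0 → F v = 0) :
    ∃ G ∈ forms K E t, ∀ v, Q v = 0 → F v = l v * G v := by
  obtain ⟨G, hG, hFG⟩ := h.exists_eq_mul (forms_comp (LinearMap.ker l).subtype hF)
    fun v hv => hF0 v hv v.2
  obtain ⟨G₁, hG₁, hF₁⟩ := exists_eq_add_linear_mul l e hF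
  set m : Dual K E := Q e • l + QuadraticMap.polarBilin Q e ∘ₗ proj l e
  refine ⟨_, sub_mem hG₁ (linear_mul_mem_of_mem_predForms m (predForms_comp (projKer l e he) hG)),
    fun v hv => ?_⟩
  have h1 := hFG (projKer l e he v)
  change F (proj l e v) = Q (proj l e v) * _ at h1
  have h2 : Q (proj l e v) = - (l v * m v) := by
    have := map_comb Q 1 (l v) (proj l e v) e
    rw [one_smul, proj_add, hv, QuadraticMap.polar_comm] at this
    simp only [m, LinearMap.add_apply, LinearMap.smul_apply, LinearMap.comp_apply,
      QuadraticMap.polarBilin_apply_apply, smul_eq_mul]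
    linear_combination -this
  rw [hF₁, h1, h2]
  simp only [Pi.sub_apply]
  ring

/-- The dimension of a subspace is bounded by means of its image and its kernel under a linear
map. -/
theorem finrank_le_add {V V' : Type*} [AddCommGroup V] [Module K V] [AddCommGroup V']
    [Module K V'] {ρ : V →ₗ[K] V'} {S B : Submodule K V} {A : Submodule K V'}
    [FiniteDimensional K S] [FiniteDimensional K A] [FiniteDimensional K B]
    (h₁ : S.map ρ ≤ A) (h₂ : LinearMap.ker ρ ⊓ S ≤ B) :
    finrank K S ≤ finrank K A + finrank K B := by
  have h3 := LinearMap.finrank_range_add_finrank_ker (ρ.domRestrict S)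
  rw [LinearMap.range_domRestrict, LinearMap.ker_domRestrict] at h3
  have h4 := Submodule.finrank_mono h₁
  have h5 := Submodule.finrank_mono h₂
  rw [inf_comm, ← Submodule.map_comap_subtype, Submodule.finrank_map_subtype_eq] at h5
  omega

/-- The dimension of the space of forms of degree `t` on the quadric `Q = 0`. -/
def formsRank (Q : QuadraticForm K E) (t : ℕ) : ℕ :=
  finrank K ((forms K E t).map (LinearMap.funLeft K K (Subtype.val : {v // Q v = 0} → E)))

/-- The restriction to a hyperplane section bounds the dimension of the space of forms on the
quadric: the kernel consists of the multiples of the equation of the hyperplane. -/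
theorem formsRank_succ_le [IsAlgClosed K] [FiniteDimensional K E] {Q : QuadraticForm K E}
    {l : Dual K E} {e : E} (he : l e = 1) {e₁ e₂ : LinearMap.ker l}
    (h : HypPair (restrictKer Q l) e₁ e₂) (t : ℕ) :
    formsRank Q (t + 1) ≤ formsRank Q t + formsRank (restrictKer Q l) (t + 1) := by
  set r := LinearMap.funLeft K K (Subtype.val : {v // Q v = 0} → E)
  set rH := LinearMap.funLeft K K
    (Subtype.val : {v // restrictKer Q l v = 0} → LinearMap.ker l)
  set ρ : ({v // Q v = 0} → K) →ₗ[K] ({v // restrictKer Q l v = 0} → K) :=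
    LinearMap.funLeft K K fun v => ⟨v.1.1, v.2⟩
  set μ : ({v // Q v = 0} → K) →ₗ[K] ({v // Q v = 0} → K) :=
    LinearMap.mulLeft K fun v => l v.1
  set S := (forms K E (t + 1)).map r
  have h1 : S.map ρ ≤ (forms K (LinearMap.ker l) (t + 1)).map rH := by
    rintro _ ⟨_, ⟨F, hF, rfl⟩, rfl⟩
    exact ⟨_, forms_comp (LinearMap.ker l).subtype hF, rfl⟩
  have h2 : LinearMap.ker ρ ⊓ S ≤ ((forms K E t).map r).map μ := by
    rintro _ ⟨hk, F, hF, rfl⟩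
    obtain ⟨G, hG, hFG⟩ := exists_eq_linear_mul he h hF fun v hv hlv =>
      congrFun (LinearMap.mem_ker.1 hk) ⟨⟨v, hlv⟩, hv⟩
    exact ⟨_, ⟨G, hG, rfl⟩, funext fun v => (hFG v.1 v.2).symm⟩
  exact (finrank_le_add h1 h2).trans
    (by rw [add_comm]; exact Nat.add_le_add_right (Submodule.finrank_map_le μ _) _)

end Nullstellensatz

/-! ### Paths imposing independent conditions on quadrics -/

section Path

variable {K : Type*} [Field K] {E : Type*} [AddCommGroup E] [Module K E]

/-- The path of lines through consecutive points of `p 0, …, p k` imposes independent conditions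
on quadrics: a quadratic form is determined on it by its values at the nodes and the values of
its polar form at consecutive nodes, and these `2 k + 1` values can be prescribed. -/
def PathInterp (p : ℕ → E) (k : ℕ) : Prop :=
  ∀ x y : ℕ → K, ∃ F ∈ forms K E 2, (∀ i ≤ k, F (p i) = x i) ∧
    ∀ i < k, QuadraticMap.polar F (p i) (p (i + 1)) = y i

theorem forms_two_induction {p : (E → K) → Prop} (h : ∀ φ ψ : Dual K E, p fun v => φ v * ψ v)
    (hadd : ∀ F G, p F → p G → p (F + G)) {F : E → K} (hF : F ∈ forms K E 2) : p F := by
  refine forms_succ_induction (fun φ G hG => ?_) hadd hF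
  obtain ⟨ψ, rfl⟩ := exists_linear_of_mem_forms_one hG
  exact h φ ψ

theorem polar_add_self_of_mem_forms {F : E → K} (hF : F ∈ forms K E 2) (v w : E) :
    QuadraticMap.polar F v (v + w) = F v + F (v + w) - F w := by
  refine forms_two_induction (p := fun F => QuadraticMap.polar F v (v + w) =
    F v + F (v + w) - F w) (fun φ ψ => ?_) (fun F G hF hG => ?_) hF
  · simp only [QuadraticMap.polar, map_add]
    ring
  · simp only [QuadraticMap.polar, Pi.add_apply] at *
    linear_combination hF + hG

theorem finrank_forms_one_le [FiniteDimensional K E] : finrank K (forms K E 1) ≤ finrank K E := by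
  rw [forms, pow_one, ← Subspace.dual_finrank_eq (K := K) (V := E)]
  exact LinearMap.finrank_range_le _

theorem finrank_forms_succ_le [FiniteDimensional K E] {l : Dual K E} {e : E} (he : l e = 1)
    (t : ℕ) : finrank K (forms K E (t + 1)) ≤
      finrank K (forms K (LinearMap.ker l) (t + 1)) + finrank K (forms K E t) := by
  have h1 : (forms K E (t + 1)).map (LinearMap.funLeft K K (Subtype.val : LinearMap.ker l → E)) ≤
      forms K (LinearMap.ker l) (t + 1) := by
    rintro _ ⟨F, hF, rfl⟩
    exact forms_comp (LinearMap.ker l).subtype hF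
  have h2 : LinearMap.ker (LinearMap.funLeft K K (Subtype.val : LinearMap.ker l → E)) ⊓
      forms K E (t + 1) ≤ (forms K E t).map (LinearMap.mulLeft K (l : E → K)) := by
    rintro F ⟨hk, hF⟩
    obtain ⟨G, hG, hFG⟩ := exists_eq_add_linear_mul l e hF
    refine ⟨G, hG, funext fun v => ?_⟩
    rw [hFG v, show F (proj l e v) = 0 from
      congrFun (LinearMap.mem_ker.1 hk) ⟨_, linear_proj he v⟩]
    simp
  exact (finrank_le_add h1 h2).trans (Nat.add_le_add_left (Submodule.finrank_map_le _ _) _)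

theorem exists_ne_zero_of_finrank_lt {V W : Type*} [AddCommGroup V] [Module K V]
    [FiniteDimensional K V] [AddCommGroup W] [Module K W] [FiniteDimensional K W] (A : V →ₗ[K] W)
    (h : finrank K W < finrank K V) : ∃ v ≠ 0, A v = 0 := by
  obtain ⟨v, hv, hv0⟩ := (Submodule.ne_bot_iff _).1 (LinearMap.ker_ne_bot_of_finrank_lt (f := A) h)
  exact ⟨v, hv0, hv⟩

/-- The values of quadratic forms at the nodes of a path and at further points, and the values
of their polar forms at consecutive nodes. -/
def pathEval (p q : ℕ → E) (k j : ℕ) :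
    (E → K) →ₗ[K] (Fin (k + 1) → K) × (Fin k → K) × (Fin j → K) where
  toFun F := (fun i => F (p i), fun i => QuadraticMap.polar F (p i) (p (i + 1)),
    fun i => F (q i))
  map_add' F G := by
    ext <;> simp [QuadraticMap.polar]
    ring
  map_smul' c F := by
    ext <;> simp [QuadraticMap.polar, mul_sub]

theorem PathInterp.le_finrank [FiniteDimensional K E] {p : ℕ → E} {k : ℕ}
    (h : PathInterp (K := K) p k) : 2 * k + 1 ≤ finrank K (forms K E 2) := by
  have hs : Function.Surjective ((pathEval p p k 0).domRestrict (forms K E 2)) := by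
    rintro ⟨x, y, z⟩
    obtain ⟨F, hF, h1, h2⟩ := h (fun i => if hi : i < k + 1 then x ⟨i, hi⟩ else 0)
      (fun i => if hi : i < k then y ⟨i, hi⟩ else 0)
    refine ⟨⟨F, hF⟩, Prod.ext (funext fun i => ?_) (Prod.ext (funext fun i => ?_)
      (funext fun i => i.elim0))⟩
    · exact (h1 i (by omega)).trans (dif_pos i.2)
    · exact (h2 i i.2).trans (dif_pos i.2)
  have := LinearMap.finrank_le_finrank_of_surjective hs
  simp at this
  omega

/-- Points in general position added to a path: together with the path they impose independent
conditions on quadrics, as long as there are enough of these, and together with its first node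
they are linearly independent. -/
theorem exists_extra_points [Infinite K] [FiniteDimensional K E] {r : ℕ → E} {m n : ℕ}
    (hr : PathInterp (K := K) r m) (hE : finrank K E = n + 1)
    (hm : 2 * m + n + 1 ≤ finrank K (forms K E 2)) :
    ∀ j ≤ n, ∃ q : ℕ → E,
      (∀ x y u : ℕ → K, ∃ F ∈ forms K E 2, (∀ i ≤ m, F (r i) = x i) ∧
        (∀ i < m, QuadraticMap.polar F (r i) (r (i + 1)) = y i) ∧ ∀ i < j, F (q i) = u i) ∧
      ∀ (c : K) (u : ℕ → K), ∃ φ : Dual K E, φ (r 0) = c ∧ ∀ i < j, φ (q i) = u i := by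
  intro j
  induction j with
  | zero =>
    intro _
    refine ⟨0, fun x y u => ?_, fun c u => ?_⟩
    · obtain ⟨F, hF, h1, h2⟩ := hr x y
      exact ⟨F, hF, h1, h2, by simp⟩
    · obtain ⟨F, hF, h1, -⟩ := hr (fun _ => 1) 0
      have h0 : r 0 ≠ 0 := by
        intro h0
        have h2 := h1 0 (Nat.zero_le _)
        have h3 := forms_smul hF 0 (r 0)
        rw [zero_smul, ← h0, h2] at h3
        simp at h3
      obtain ⟨φ, hφ⟩ : ∃ φ : Dual K E, φ (r 0) ≠ 0 := by
        by_contra! hcon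
        exact h0 ((forall_dual_apply_eq_zero_iff K _).1 hcon)
      exact ⟨(c / φ (r 0)) • φ, by simp [hφ], by simp⟩
  | succ j ih =>
    intro hj
    obtain ⟨q, hq, hq'⟩ := ih (by omega)
    obtain ⟨⟨F₀, hF₀⟩, hne, hz⟩ := exists_ne_zero_of_finrank_lt
      ((pathEval r q m j).domRestrict (forms K E 2)) (by simp; omega)
    obtain ⟨φ₀, hφne, hφz⟩ := exists_ne_zero_of_finrank_lt
      (LinearMap.pi (fun i : Fin (j + 1) => Dual.eval K E (if (i : ℕ) = j then r 0 else q i)))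
      (by simp [Subspace.dual_finrank_eq, hE]; omega)
    obtain ⟨w, hw⟩ : ∃ w, F₀ w ≠ 0 := by
      by_contra! hcon
      exact hne (Subtype.ext (funext hcon))
    obtain ⟨w', hw'⟩ := DFunLike.ne_iff.1 hφne
    obtain ⟨v, hv, hv'⟩ := (forms_regFun hF₀).exists_ne_zero (RegFun.linear φ₀) hw hw'
    simp only [pathEval, LinearMap.domRestrict_apply, LinearMap.coe_mk, AddHom.coe_mk,
      Prod.mk_eq_zero] at hz
    obtain ⟨hz1, hz2, hz3⟩ := hz
    refine ⟨fun i => if i = j then v else q i, fun x y u => ?_, fun c u => ?_⟩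
    · obtain ⟨F, hF, h1, h2, h3⟩ := hq x y u
      refine ⟨F + ((u j - F v) / F₀ v) • F₀, add_mem hF (Submodule.smul_mem _ _ hF₀), ?_, ?_, ?_⟩
      · intro i hi
        have := congrFun hz1 ⟨i, by omega⟩
        simp only [Pi.zero_apply] at this
        simp [h1 i hi, this]
      · intro i hi
        have := congrFun hz2 ⟨i, hi⟩
        simp only [Pi.zero_apply] at this
        rw [QuadraticMap.polar_add, QuadraticMap.polar_smul, this, h2 i hi]
        simp
      · intro i hi
        by_cases hij : i = j
        · subst hij
          simp [hv]
        · have := congrFun hz3 ⟨i, by omega⟩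
          simp only [Pi.zero_apply] at this
          simp [hij, h3 i (by omega), this]
    · obtain ⟨φ, h1, h2⟩ := hq' c u
      refine ⟨φ + ((u j - φ v) / φ₀ v) • φ₀, ?_, ?_⟩
      · have := congrFun hφz ⟨j, by omega⟩
        simp at this
        simp [h1, this]
      · intro i hi
        by_cases hij : i = j
        · subst hij
          simp [hv']
        · have := congrFun hφz ⟨i, by omega⟩
          simp [hij] at this
          simp [hij, h2 i (by omega), this]

theorem exists_linear_eq_one [Nontrivial E] : ∃ (l : Dual K E) (e : E), l e = 1 := by
  obtain ⟨v, hv⟩ := exists_ne (0 : E)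
  obtain ⟨φ, hφ⟩ : ∃ φ : Dual K E, φ v ≠ 0 := by
    by_contra! hcon
    exact hv ((forall_dual_apply_eq_zero_iff K _).1 hcon)
  exact ⟨(φ v)⁻¹ • φ, v, by simp [hφ]⟩

theorem finrank_ker_of_eq_one [FiniteDimensional K E] {l : Dual K E} {e : E} (he : l e = 1) :
    finrank K (LinearMap.ker l) + 1 = finrank K E := by
  refine Module.Dual.finrank_ker_add_one_of_ne_zero ?_
  rintro rfl
  simp at he

end Path

section PathExistence

variable {K : Type*} [Field K] [Infinite K]

/-- There is a path of lines of maximal rank with respect to quadrics. By induction on the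
dimension, it is composed of as long a path in a hyperplane as the dimension count permits, and
of a path which meets the hyperplane in points in general position. -/
theorem exists_pathInterp (n : ℕ) : ∀ (E : Type*) [AddCommGroup E] [Module K E]
    [FiniteDimensional K E], finrank K E = n + 1 → ∃ k ≥ n, ∃ p : ℕ → E,
      PathInterp (K := K) p k ∧ finrank K (forms K E 2) ≤ 2 * k + 2 := by
  induction n with
  | zero =>
    intro E _ _ _ hE
    have : Nontrivial E := nontrivial_of_finrank_pos (R := K) (by omega)
    obtain ⟨l, e, he⟩ := exists_linear_eq_one (K := K) (E := E)
    refine ⟨0, le_rfl, fun _ => e, fun x y => ?_, ?_⟩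
    · exact ⟨fun v => x 0 * (l v * l v), Submodule.smul_mem _ (x 0)
        (linear_mul_mem_forms l (linear_mem_forms l)), by simp [he], by simp⟩
    · have h1 : finrank K (forms K E 2) ≤
        finrank K (forms K (LinearMap.ker l) 2) + finrank K (forms K E 1) :=
        finrank_forms_succ_le he 1
      have h2 := finrank_forms_one_le (K := K) (E := E)
      have h3 := finrank_ker_of_eq_one he
      have : Subsingleton (LinearMap.ker l) := finrank_zero_iff.1 (by omega : finrank K _ = 0)
      have h4 : finrank K (forms K (LinearMap.ker l) 2) ≤ 1 := by
        refine (Submodule.finrank_le _).trans ?_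
        have : Unique (LinearMap.ker l) := ⟨⟨0⟩, fun _ => Subsingleton.elim _ _⟩
        simp
      omega
  | succ n ih =>
    intro E _ _ _ hE
    have : Nontrivial E := nontrivial_of_finrank_pos (R := K) (by omega)
    obtain ⟨l, e, he⟩ := exists_linear_eq_one (K := K) (E := E)
    have hH := finrank_ker_of_eq_one he
    obtain ⟨M, hM, r, hr, hP⟩ := ih (LinearMap.ker l) (by omega)
    have hP' := hr.le_finrank
    obtain ⟨m, hm⟩ : ∃ m, m = (finrank K (forms K (LinearMap.ker l) 2) - n - 1) / 2 := ⟨_, rfl⟩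
    have hrm : PathInterp (K := K) r m := fun x y => by
      obtain ⟨F, hF, h1, h2⟩ := hr x y
      exact ⟨F, hF, fun i hi => h1 i (by omega), fun i hi => h2 i (by omega)⟩
    obtain ⟨q, hq, hq'⟩ := exists_extra_points hrm (n := n) (by omega) (by omega) n le_rfl
    -- The path starts with the points `σ 0, …, σ n` outside of the hyperplane, whose differences are
    -- the extra points `q i`, and continues with the points `r 0, …, r m` in the hyperplane.
    set σ : ℕ → E := fun i => e + ∑ j ∈ Finset.range i, (q j : E) with hσ
    have hσs (i : ℕ) : σ (i + 1) = σ i + q i := by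
      simp [hσ, Finset.sum_range_succ, add_assoc]
    have hlσ (i : ℕ) : l (σ i) = 1 := by simp [hσ, he, map_sum]
    refine ⟨n + 1 + m, by omega, fun i => if i ≤ n then σ i else r (i - (n + 1)), fun x y => ?_, ?_⟩
    · obtain ⟨FH, hFH, h1, h2, h3⟩ := hq (fun i => x (n + 1 + i)) (fun i => y (n + 1 + i))
        (fun i => x i + x (i + 1) - y i)
      -- A quadratic form `FH` on the hyperplane takes care of the values at `r`. It is extended and
      -- corrected by a multiple `l * g` of `l`, where the linear form `g` has to satisfy
      -- `n + 1` conditions at the points `σ i`, and one at `r 0`.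
      set π := projKer l e he
      set F₁ : E → K := fun v => FH (π v)
      have hF₁ : F₁ ∈ forms K E 2 := forms_comp π hFH
      set w : ℕ → K := fun i => x i - F₁ (σ i)
      obtain ⟨φ, hφ0, hφ⟩ := hq' (y n - QuadraticMap.polar F₁ (σ n) (r 0))
        (fun i => w (i + 1) - w i)
      set g : Dual K E := φ ∘ₗ π + w 0 • l
      have hπe : π e = 0 := Subtype.ext (by
        change proj l e e = 0
        simp [proj_apply, he])
      have hg (i : ℕ) (hi : i ≤ n) : g (σ i) = w i := by
        have h4 : π (σ i) = ∑ j ∈ Finset.range i, q j := by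
          simp [hσ, hπe, π, projKer_coe]
        have h5 : ∑ j ∈ Finset.range i, φ (q j) = w i - w 0 := by
          rw [← Finset.sum_range_sub]
          exact Finset.sum_congr rfl fun j hj => hφ j (by
            have := Finset.mem_range.1 hj
            omega)
        simp [g, h4, h5, hlσ]
      have hgr : g (r 0) = y n - QuadraticMap.polar F₁ (σ n) (r 0) := by
        simp [g, π, projKer_coe, hφ0]
      have hF : F₁ + (fun v => l v * g v) ∈ forms K E 2 :=
        add_mem hF₁ (linear_mul_mem_forms l (linear_mem_forms g))
      set F := F₁ + fun v => l v * g v with hFdef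
      have hFH' (v : LinearMap.ker l) : F v = FH v := by
        simp [hFdef, F₁, π, projKer_coe]
      have hFσ (i : ℕ) (hi : i ≤ n) : F (σ i) = x i := by
        simp [hFdef, hlσ, hg i hi, w]
      refine ⟨F, hF, fun i hi => ?_, fun i hi => ?_⟩
      · by_cases hin : i ≤ n
        · simp [hin, hFσ]
        · simp only [hin, if_false, hFH', h1 (i - (n + 1)) (by omega)]
          congr 1
          omega
      · rcases lt_trichotomy i n with hin | rfl | hin
        · beta_reduce
          rw [if_pos (by omega), if_pos (by omega), hσs, polar_add_self_of_mem_forms hF, ← hσs,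
            hFσ i (by omega), hFσ (i + 1) (by omega), hFH', h3 i hin]
          ring
        · beta_reduce
          rw [if_pos le_rfl, if_neg (by omega)]
          simp only [Nat.sub_self, QuadraticMap.polar, hFdef, Pi.add_apply, map_add, hlσ,
            LinearMap.map_coe_ker, hgr]
          ring
        · beta_reduce
          rw [if_neg (by omega), if_neg (by omega),
            show i + 1 - (n + 1) = i - (n + 1) + 1 by omega]
          have h4 := h2 (i - (n + 1)) (by omega)
          simp only [QuadraticMap.polar] at h4 ⊢
          rw [← Submodule.coe_add, hFH', hFH', hFH', h4]
          congr 1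
          omega
    · have h1 : finrank K (forms K E 2) ≤
        finrank K (forms K (LinearMap.ker l) 2) + finrank K (forms K E 1) :=
        finrank_forms_succ_le he 1
      have h2 := finrank_forms_one_le (K := K) (E := E)
      omega

end PathExistence

/-! ### Chains of lines and open conditions on them -/

/-- A sequence of lines, each of which meets the preceding one, with a marked vector on each of
them. The line number `i` is spanned by its initial node and the marked vector `dir i`; the next
node is a combination of these two vectors, with coefficients `c i` and `e i`. In the applications
the marked vectors are isotropic for a quadratic form. -/
structure Chain (K E : Type*) where
  /-- The initial node. -/
  start : E
  /-- The marked vectors. -/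
  dir : ℕ → E
  /-- The coefficients of the nodes in the next nodes. -/
  c : ℕ → K
  /-- The coefficients of the marked vectors in the next nodes. -/
  e : ℕ → K

namespace Chain

variable {K : Type*} [Field K] {E : Type*} [AddCommGroup E] [Module K E]

/-- The nodes of a chain. -/
def node (x : Chain K E) : ℕ → E
  | 0 => x.start
  | i + 1 => x.c i • node x i + x.e i • x.dir i

theorem node_zero (x : Chain K E) : x.node 0 = x.start := rfl

theorem node_succ (x : Chain K E) (i : ℕ) :
    x.node (i + 1) = x.c i • x.node i + x.e i • x.dir i := rfl

/-- A chain all of whose lines pass through `p`. -/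
def star (p : E) (a : ℕ → E) : Chain K E := ⟨p, a, fun _ => 1, fun _ => 0⟩

omit [AddCommGroup E] [Module K E] in
theorem star_dir (p : E) (a : ℕ → E) (i : ℕ) : (star (K := K) p a).dir i = a i := rfl

theorem star_node (p : E) (a : ℕ → E) (i : ℕ) : (star (K := K) p a).node i = p := by
  induction i with
  | zero => rfl
  | succ i ih =>
    rw [node_succ, ih]
    simp [star]

/-- The second point on the quadric of a line of the chain. -/
def second (Q : QuadraticForm K E) (x : Chain K E) (i : ℕ) : E :=
  secondPoint Q (x.dir i) (x.node i)

/-- The forms of degree `t` take arbitrary values at the `2 k` points of the first `k` lines. -/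
def Surj (Q : QuadraticForm K E) (t k : ℕ) (x : Chain K E) : Prop :=
  ∀ y z : ℕ → K, ∃ F ∈ forms K E t, ∀ i < k, F (x.dir i) = y i ∧ F (x.second Q i) = z i

/-- A form of degree `t` which vanishes at the `2 k` points of the first `k` lines vanishes on the
quadric. -/
def Inj (Q : QuadraticForm K E) (t k : ℕ) (x : Chain K E) : Prop :=
  ∀ F ∈ forms K E t, (∀ i < k, F (x.dir i) = 0 ∧ F (x.second Q i) = 0) → ∀ v, Q v = 0 → F v = 0

/-- The first `k` marked vectors are isotropic. -/
def OnQuadric (Q : QuadraticForm K E) (k : ℕ) (x : Chain K E) : Prop :=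
  ∀ i < k, Q (x.dir i) = 0

/-- The first `k` marked vectors are smooth points of the quadric. -/
def Smooth (Q : QuadraticForm K E) (k : ℕ) (x : Chain K E) : Prop :=
  ∀ i < k, SmoothVec Q (x.dir i)

theorem Smooth.onQuadric {Q : QuadraticForm K E} {k : ℕ} {x : Chain K E} (h : x.Smooth Q k) :
    x.OnQuadric Q k := fun i hi => (h i hi).1

/-- A polynomial one-parameter family of chains whose first `k` marked vectors are isotropic. -/
structure IsCurve (Q : QuadraticForm K E) (k : ℕ) (x : K → Chain K E) : Prop where
  start : PolyCurve fun s => (x s).start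
  dir : ∀ i, PolyCurve fun s => (x s).dir i
  c : ∀ i, (fun s => (x s).c i) ∈ polyFun K
  e : ∀ i, (fun s => (x s).e i) ∈ polyFun K
  onQuadric : ∀ s, (x s).OnQuadric Q k

/-- A condition which holds for almost all members of a one-parameter family as soon as it holds
for one of them. -/
def OpenCond (Q : QuadraticForm K E) (k : ℕ) (U : Chain K E → Prop) : Prop :=
  ∀ x : K → Chain K E, IsCurve Q k x → ∀ s₀, U (x s₀) → ∀ᶠ s in cofinite, U (x s)

variable {Q : QuadraticForm K E} {k : ℕ}

theorem IsCurve.node {x : K → Chain K E} (hx : IsCurve Q k x) (i : ℕ) :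
    PolyCurve fun s => (x s).node i := by
  induction i with
  | zero => exact hx.start
  | succ i ih => exact (ih.smul (hx.c i)).add ((hx.dir i).smul (hx.e i))

theorem IsCurve.second [FiniteDimensional K E] {x : K → Chain K E} (hx : IsCurve Q k x) (i : ℕ) :
    PolyCurve fun s => (x s).second Q i :=
  (hx.dir i).secondPoint (hx.node i)

theorem OpenCond.and {U V : Chain K E → Prop} (hU : OpenCond Q k U) (hV : OpenCond Q k V) :
    OpenCond Q k fun x => U x ∧ V x := fun x hx s h =>
  (hU x hx s h.1).and (hV x hx s h.2)

theorem OpenCond.or {U V : Chain K E → Prop} (hU : OpenCond Q k U) (hV : OpenCond Q k V) :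
    OpenCond Q k fun x => U x ∨ V x := fun x hx s h => by
  rcases h with h | h
  · exact (hU x hx s h).mono fun _ => Or.inl
  · exact (hV x hx s h).mono fun _ => Or.inr

theorem OpenCond.imp {p : Prop} {U : Chain K E → Prop} (hU : p → OpenCond Q k U) :
    OpenCond Q k fun x => p → U x := fun x hx s h => by
  by_cases hp : p
  · exact (hU hp x hx s (h hp)).mono fun _ hr _ => hr
  · exact Eventually.of_forall fun _ hp' => (hp hp').elim

theorem OpenCond.forall_lt {m : ℕ} {U : ℕ → Chain K E → Prop}
    (hU : ∀ i < m, OpenCond Q k (U i)) : OpenCond Q k fun x => ∀ i < m, U i x := fun x hx s h => by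
  have := (eventually_all_finite (Set.finite_lt_nat m)).2
    fun i (hi : i < m) => hU i hi x hx s (h i hi)
  exact this

theorem OpenCond.of_ne_zero {g : Chain K E → K}
    (hg : ∀ x, IsCurve Q k x → (fun s => g (x s)) ∈ polyFun K) :
    OpenCond Q k fun x => g x ≠ 0 := fun x hx _ h =>
  eventually_ne_zero_of_polyFun (hg x hx) h

theorem openCond_smooth [FiniteDimensional K E] : OpenCond Q k (Smooth Q k) := by
  refine OpenCond.forall_lt fun i hi x hx s h => ?_
  obtain ⟨-, w, hw⟩ := h
  filter_upwards [eventually_ne_zero_of_polyFun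
    (polar_mem_polyFun Q (hx.dir i) (PolyCurve.const w)) hw] with r hr
  exact ⟨hx.onQuadric r i hi, w, hr⟩

/-- The evaluation of functions at the points of the first `k` lines of a chain. -/
def eval (Q : QuadraticForm K E) (k : ℕ) (x : Chain K E) :
    (E → K) →ₗ[K] (Fin k ⊕ Fin k → K) :=
  LinearMap.funLeft K K (Sum.elim (fun i : Fin k => x.dir i) fun i : Fin k => x.second Q i)

theorem eval_eq_zero_iff {x : Chain K E} {F : E → K} :
    x.eval Q k F = 0 ↔ ∀ i < k, F (x.dir i) = 0 ∧ F (x.second Q i) = 0 := by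
  constructor
  · intro h i hi
    exact ⟨congrFun h (Sum.inl ⟨i, hi⟩), congrFun h (Sum.inr ⟨i, hi⟩)⟩
  · intro h
    ext (i | i)
    · exact (h i i.2).1
    · exact (h i i.2).2

theorem surj_iff {t : ℕ} {x : Chain K E} :
    x.Surj Q t k ↔ Function.Surjective ((x.eval Q k).domRestrict (forms K E t)) := by
  constructor
  · intro h y
    obtain ⟨F, hF, h⟩ := h (fun i => if hi : i < k then y (Sum.inl ⟨i, hi⟩) else 0)
      (fun i => if hi : i < k then y (Sum.inr ⟨i, hi⟩) else 0)
    refine ⟨⟨F, hF⟩, funext fun i => ?_⟩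
    rcases i with i | i
    · exact (h i i.2).1.trans (dif_pos i.2)
    · exact (h i i.2).2.trans (dif_pos i.2)
  · intro h y z
    obtain ⟨⟨F, hF⟩, h⟩ := h (Sum.elim (fun i => y i) fun i => z i)
    exact ⟨F, hF, fun i hi => ⟨congrFun h (Sum.inl ⟨i, hi⟩), congrFun h (Sum.inr ⟨i, hi⟩)⟩⟩

theorem IsCurve.eval_mem_polyFun [FiniteDimensional K E] {x : K → Chain K E}
    (hx : IsCurve Q k x) {F : E → K} (hF : RegFun F) (i : Fin k ⊕ Fin k) :
    (fun s => (x s).eval Q k F i) ∈ polyFun K := by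
  rcases i with i | i
  · exact hF _ (hx.dir i)
  · exact hF _ (hx.second i)

theorem openCond_surj [FiniteDimensional K E] (t m : ℕ) (hm : m ≤ k) :
    OpenCond Q k (Surj Q t m) := by
  intro x hx s h
  have hx' : IsCurve Q m x :=
    { hx with onQuadric := fun s i hi => hx.onQuadric s i (hi.trans_le hm) }
  simp only [surj_iff] at h ⊢
  exact eventually_surjective (fun F i => hx'.eval_mem_polyFun (forms_regFun F.2) i) h

theorem OnQuadric.second {x : Chain K E} (hx : x.OnQuadric Q k) {i : ℕ} (hi : i < k) :
    Q (x.second Q i) = 0 :=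
  map_secondPoint (hx i hi) _

theorem openCond_inj [FiniteDimensional K E] (t : ℕ) : OpenCond Q k (Inj Q t k) := by
  intro x hx s h
  set N : Submodule K (forms K E t) :=
    LinearMap.ker ((LinearMap.funLeft K K (Subtype.val : {v // Q v = 0} → E)).domRestrict
      (forms K E t))
  have hN (F : forms K E t) : F ∈ N ↔ ∀ v, Q v = 0 → F.1 v = 0 :=
    ⟨fun h v hv => congrFun (LinearMap.mem_ker.1 h) ⟨v, hv⟩,
      fun h => LinearMap.mem_ker.2 (funext fun v => h v.1 v.2)⟩
  have key := eventually_ker_le (A := fun s => ((x s).eval Q k).domRestrict (forms K E t))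
    (fun F i => hx.eval_mem_polyFun (forms_regFun F.2) i) (N := N)
    (fun r F hF => eval_eq_zero_iff.2 fun i hi => ⟨(hN F).1 hF _ (hx.onQuadric r i hi),
      (hN F).1 hF _ ((hx.onQuadric r).second hi)⟩)
    (s₀ := s) fun F hF => (hN F).2 (h F.1 F.2 (eval_eq_zero_iff.1 hF))
  exact key.mono fun r hr F hF hF0 => (hN ⟨F, hF⟩).1 (hr (eval_eq_zero_iff.2 hF0))

theorem OpenCond.linearIndependent [FiniteDimensional K E] {ι : Type*} [Finite ι]
    {g : ι → Chain K E → E}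
    (hg : ∀ x, IsCurve Q k x → ∀ i, PolyCurve fun s => g i (x s)) :
    OpenCond Q k fun x => LinearIndependent K fun i => g i x := by
  intro x hx s h
  have := Fintype.ofFinite ι
  set b := finBasis K E
  set A : K → (ι → K) →ₗ[K] (Fin (finrank K E) → K) := fun s =>
    b.equivFun.toLinearMap ∘ₗ Fintype.linearCombination K fun i => g i (x s)
  have hA (s : K) : Function.Injective (A s) ↔ LinearIndependent K fun i => g i (x s) := by
    rw [linearIndependent_iff_injective_fintypeLinearCombination]
    exact b.equivFun.injective.of_comp_iff _
  have hpoly (v : ι → K) (i : Fin (finrank K E)) : (fun s => A s v i) ∈ polyFun K := by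
    have : (fun s => A s v i) = ∑ j, (fun _ => v j) * fun s => b.coord i (g j (x s)) := by
      ext s
      simp [A, Fintype.linearCombination_apply]
    rw [this]
    exact sum_mem fun j _ => mul_mem (const_mem_polyFun _) (hg x hx j _)
  simp only [← hA] at h ⊢
  exact eventually_injective hpoly h

/-- Open conditions which can be satisfied separately can be satisfied simultaneously: any two
chains of smooth points are members of a one-parameter family. -/
theorem OpenCond.exists_and [Infinite K] [FiniteDimensional K E] {e₁ e₂ e₃ : E}
    (hQ : ConicFrame Q e₁ e₂ e₃) {U V : Chain K E → Prop} (hU : OpenCond Q k U)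
    (hV : OpenCond Q k V) (hx : ∃ x, Smooth Q k x ∧ U x) (hy : ∃ y, Smooth Q k y ∧ V y) :
    ∃ x, Smooth Q k x ∧ U x ∧ V x := by
  obtain ⟨x, hx, hUx⟩ := hx
  obtain ⟨y, hy, hVy⟩ := hy
  have h (i : ℕ) : ∃ γ : K → E, PolyCurve γ ∧ (i < k → ∀ s, Q (γ s) = 0) ∧ γ 0 = x.dir i ∧
      γ 1 = y.dir i := by
    by_cases hi : i < k
    · obtain ⟨γ, h1, h2, h3⟩ := hQ.exists_curve (hx i hi) (hy i hi)
      exact ⟨γ, h1, fun _ => h2, h3⟩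
    · exact ⟨_, PolyCurve.line (x.dir i) (y.dir i), by simp [hi], by simp, by simp⟩
  choose γ hγ hγQ hγ0 hγ1 using h
  have hline (a b : K) : (fun s => a + s * (b - a)) ∈ polyFun K :=
    add_mem (const_mem_polyFun a) (mul_mem id_mem_polyFun (const_mem_polyFun (b - a)))
  set z : K → Chain K E := fun s => ⟨x.start + s • (y.start - x.start), fun i => γ i s,
    fun i => x.c i + s * (y.c i - x.c i), fun i => x.e i + s * (y.e i - x.e i)⟩
  have hz : IsCurve Q k z := ⟨PolyCurve.line _ _, hγ, fun i => hline _ _, fun i => hline _ _,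
    fun s i hi => hγQ i hi s⟩
  have h0 : z 0 = x := by simp [z, hγ0]
  have h1 : z 1 = y := by simp [z, hγ1]
  obtain ⟨s, hs⟩ := ((openCond_smooth z hz 0 (h0 ▸ hx)).and
    ((hU z hz 0 (h0 ▸ hUx)).and (hV z hz 1 (h1 ▸ hVy)))).exists
  exact ⟨z s, hs⟩

theorem OpenCond.exists_forall_lt [Infinite K] [FiniteDimensional K E] {e₁ e₂ e₃ : E}
    (hQ : ConicFrame Q e₁ e₂ e₃) {m : ℕ} {U : ℕ → Chain K E → Prop}
    (hU : ∀ i < m, OpenCond Q k (U i)) (hx : ∀ i < m, ∃ x, Smooth Q k x ∧ U i x) :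
    ∃ x, Smooth Q k x ∧ ∀ i < m, U i x := by
  induction m with
  | zero => exact ⟨⟨0, fun _ => e₁, 0, 0⟩, fun i _ => hQ.smooth₁, by simp⟩
  | succ m ih =>
    obtain ⟨x, hx, h1, h2⟩ := OpenCond.exists_and hQ
      (OpenCond.forall_lt fun i hi => hU i (Nat.lt_succ_of_lt hi)) (hU m (Nat.lt_succ_self m)) (ih (fun i hi => hU i (Nat.lt_succ_of_lt hi))
        fun i hi => hx i (Nat.lt_succ_of_lt hi)) (hx m (Nat.lt_succ_self m))
    refine ⟨x, hx, fun i hi => ?_⟩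
    rcases Nat.lt_succ_iff_lt_or_eq.1 hi with hi | rfl
    · exact h1 i hi
    · exact h2

/-- If there are more forms on the quadric than conditions, then there is a form which vanishes at
the points of the chain and not on the quadric. -/
theorem OnQuadric.exists_form [FiniteDimensional K E] {t : ℕ} {x : Chain K E}
    (hx : x.OnQuadric Q k) (h : 2 * k < formsRank Q t) :
    ∃ F ∈ forms K E t, (∀ i < k, F (x.dir i) = 0 ∧ F (x.second Q i) = 0) ∧
      ∃ v, Q v = 0 ∧ F v ≠ 0 := by
  set R := (forms K E t).map (LinearMap.funLeft K K (Subtype.val : {v // Q v = 0} → E))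
  set A : ({v // Q v = 0} → K) →ₗ[K] (Fin k ⊕ Fin k → K) := LinearMap.funLeft K K
    (Sum.elim (fun i => ⟨x.dir i, hx i i.2⟩) fun i => ⟨x.second Q i, hx.second i.2⟩)
  have hR : 2 * k < finrank K R := h
  obtain ⟨⟨_, F, hF, rfl⟩, h1, h2⟩ := exists_ne_zero_of_finrank_lt (A.domRestrict R)
    (by simpa [← two_mul] using hR)
  refine ⟨F, hF, fun i hi => ⟨congrFun h2 (Sum.inl ⟨i, hi⟩), congrFun h2 (Sum.inr ⟨i, hi⟩)⟩, ?_⟩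
  by_contra! hcon
  exact h1 (Subtype.ext (funext fun v => hcon v.1 v.2))

/-- If there is at most one form more than there are conditions, then vanishing at one further
point of general position suffices to vanish on the quadric. -/
theorem Surj.exists_form [FiniteDimensional K E] {t : ℕ} {x : Chain K E} {e₁ e₂ : E}
    (hQ : HypPair Q e₁ e₂) (hx : x.OnQuadric Q k) (hs : x.Surj Q t k)
    (h : formsRank Q t ≤ 2 * k + 1) :
    ∃ F₀ ∈ forms K E t, (∃ v, Q v = 0 ∧ F₀ v ≠ 0) ∧ ∀ a, Q a = 0 → F₀ a ≠ 0 → ∀ F ∈ forms K E t,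
      (∀ i < k, F (x.dir i) = 0 ∧ F (x.second Q i) = 0) → F a = 0 → ∀ v, Q v = 0 → F v = 0 := by
  by_cases hinj : x.Inj Q t k
  · exact ⟨_, pow_mem_forms (QuadraticMap.polarBilin Q e₂) t, ⟨e₁, hQ.fst, by
      simp [QuadraticMap.polar_comm Q e₂ e₁, hQ.polar]⟩, fun a _ _ F hF hF0 _ => hinj F hF hF0⟩
  unfold Inj at hinj
  push Not at hinj
  obtain ⟨F₀, hF₀, hF₀x, v, hv, hF₀v⟩ := hinj
  refine ⟨F₀, hF₀, ⟨v, hv, hF₀v⟩, fun a ha haF F hF hFx hFa w hw => ?_⟩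
  set r := LinearMap.funLeft K K (Subtype.val : {v // Q v = 0} → E)
  set R := (forms K E t).map r
  set A : ({v // Q v = 0} → K) →ₗ[K] (Fin k ⊕ Fin k → K) := LinearMap.funLeft K K
    (Sum.elim (fun i => ⟨x.dir i, hx i i.2⟩) fun i => ⟨x.second Q i, hx.second i.2⟩)
  have hsurj : Function.Surjective (A.domRestrict R) := fun y => by
    obtain ⟨⟨G, hG⟩, h⟩ := surj_iff.1 hs y
    exact ⟨⟨r G, G, hG, rfl⟩, h ▸ (by ext (i | i) <;> rfl)⟩
  have hR : finrank K R ≤ finrank K (Fin k ⊕ Fin k → K) + 1 := by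
    have hR : finrank K R ≤ 2 * k + 1 := h
    simpa [← two_mul] using hR
  have hmem (G : E → K) (hG : G ∈ forms K E t)
      (hGx : ∀ i < k, G (x.dir i) = 0 ∧ G (x.second Q i) = 0) :
      A.domRestrict R ⟨r G, G, hG, rfl⟩ = 0 := by
    ext (i | i)
    · exact (hGx i i.2).1
    · exact (hGx i i.2).2
  obtain ⟨c, hc⟩ := exists_smul_eq_of_finrank_le hsurj hR
    (fun h0 => hF₀v (congrFun (congrArg Subtype.val h0) ⟨v, hv⟩)) (hmem F₀ hF₀ hF₀x) (hmem F hF hFx)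
  have hc' (u : E) (hu : Q u = 0) : c * F₀ u = F u :=
    congrFun (congrArg Subtype.val hc) ⟨u, hu⟩
  have hc0 : c = 0 := by
    have := hc' a ha
    rw [hFa] at this
    exact (mul_eq_zero.1 this).resolve_right haF
  rw [← hc' w hw, hc0, zero_mul]

end Chain

/-! ### Chains of maximal rank for quadratic forms -/

section Quadrics

variable {K : Type*} [Field K] {E : Type*} [AddCommGroup E] [Module K E]

theorem map_add_smul_of_mem_forms_two {F : E → K} (hF : F ∈ forms K E 2) (v w : E) (c : K) :
    F (v + c • w) = F v + c * QuadraticMap.polar F w v + c ^ 2 * F w := by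
  refine forms_two_induction (p := fun F => F (v + c • w) =
    F v + c * QuadraticMap.polar F w v + c ^ 2 * F w) (fun φ ψ => ?_) (fun F G hF hG => ?_) hF
  · simp only [QuadraticMap.polar, map_add, map_smul, smul_eq_mul]
    ring
  · simp only [QuadraticMap.polar, Pi.add_apply] at *
    linear_combination hF + hG

/-- There is a chain of lines for which the forms of degree `t` can be interpolated at the points
on the quadric, and which is as long as the dimension count permits. -/
def HasGoodChain (Q : QuadraticForm K E) (t : ℕ) : Prop :=
  ∃ k ≥ 1, ∃ x : Chain K E, x.OnQuadric Q k ∧ x.Surj Q t k ∧ formsRank Q t ≤ 2 * k + 1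

theorem ConicFrame.linearIndependent {Q : QuadraticForm K E} {e₁ e₂ e₃ : E}
    (h : ConicFrame Q e₁ e₂ e₃) : LinearIndependent K ![e₁, e₂, e₃] := by
  rw [Fintype.linearIndependent_iff]
  intro g hg
  simp only [Fin.sum_univ_three, Matrix.cons_val_zero, Matrix.cons_val_one, Matrix.cons_val] at hg
  have h21 : QuadraticMap.polar Q e₂ e₁ = 1 := by rw [QuadraticMap.polar_comm, h.polar]
  have h0 : g 0 = 0 := by
    simpa [polar_self_eq_zero h.snd, h21, h.polar₂] using
      congrArg (QuadraticMap.polarBilin Q e₂) hg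
  have h1 : g 1 = 0 := by
    simpa [polar_self_eq_zero h.fst, h.polar, h.polar₁] using
      congrArg (QuadraticMap.polarBilin Q e₁) hg
  have h2 : g 2 = 0 := by
    simpa [h0, h1, QuadraticMap.map_smul, h.thd] using congrArg Q hg
  intro i
  fin_cases i <;> assumption

theorem span_range_lt_top (e₁ e₂ e₃ : E) (hE : 4 ≤ finrank K E) :
    Submodule.span K (Set.range ![e₁, e₂, e₃]) < ⊤ := by
  rw [lt_top_iff_ne_top]
  intro htop
  have h1 := finrank_range_le_card (R := K) ![e₁, e₂, e₃]
  rw [Set.finrank, htop, finrank_top, Fintype.card_fin] at h1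
  omega

/-- For paths, imposing independent conditions on quadrics is an open condition. -/
theorem eventually_pathInterp [FiniteDimensional K E] {k : ℕ} (p q : ℕ → E) {s₀ : K}
    (h : PathInterp (K := K) (fun i => p i + s₀ • (q i - p i)) k) :
    ∀ᶠ s : K in cofinite, PathInterp (K := K) (fun i => p i + s • (q i - p i)) k := by
  set γ : K → ℕ → E := fun s i => p i + s • (q i - p i)
  have hγ (i : ℕ) : PolyCurve fun s => γ s i := PolyCurve.line _ _
  set A : K → (E → K) →ₗ[K] (Fin (k + 1) ⊕ Fin k → K) := fun s =>
    { toFun := fun F => Sum.elim (fun i => F (γ s i))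
        fun i => QuadraticMap.polar F (γ s i) (γ s (i + 1))
      map_add' := fun F G => by
        ext (i | i)
        · rfl
        · simp [QuadraticMap.polar_add]
      map_smul' := fun c F => by
        ext (i | i)
        · rfl
        · simp [QuadraticMap.polar_smul] }
  have hA (s : K) : PathInterp (K := K) (γ s) k ↔
      Function.Surjective ((A s).domRestrict (forms K E 2)) := by
    constructor
    · intro h y
      obtain ⟨F, hF, h1, h2⟩ := h (fun i => if hi : i < k + 1 then y (Sum.inl ⟨i, hi⟩) else 0)
        (fun i => if hi : i < k then y (Sum.inr ⟨i, hi⟩) else 0)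
      refine ⟨⟨F, hF⟩, funext fun i => ?_⟩
      rcases i with i | i
      · exact (h1 i (by omega)).trans (dif_pos i.2)
      · exact (h2 i i.2).trans (dif_pos i.2)
    · intro h x y
      obtain ⟨⟨F, hF⟩, h⟩ := h (Sum.elim (fun i => x i) fun i => y i)
      exact ⟨F, hF, fun i hi => congrFun h (Sum.inl ⟨i, by omega⟩),
        fun i hi => congrFun h (Sum.inr ⟨i, hi⟩)⟩
  have hpoly (F : forms K E 2) (i : Fin (k + 1) ⊕ Fin k) :
      (fun s => (A s).domRestrict (forms K E 2) F i) ∈ polyFun K := by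
    have hF := forms_regFun F.2
    rcases i with i | i
    · exact hF _ (hγ i)
    · exact sub_mem (sub_mem (hF _ ((hγ i).add (hγ (i + 1)))) (hF _ (hγ i))) (hF _ (hγ (i + 1)))
  have h' := (hA s₀).1 h
  exact (eventually_surjective hpoly h').mono fun s hs => (hA s).2 hs

/-- A path of maximal rank in general position with respect to the quadric: the nodes are not on
the quadric, and the lines meet it in two points. -/
theorem ConicFrame.exists_path [Infinite K] [FiniteDimensional K E] {Q : QuadraticForm K E}
    {e₁ e₂ e₃ : E} (h : ConicFrame Q e₁ e₂ e₃) {k : ℕ} {p : ℕ → E}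
    (hp : PathInterp (K := K) p k) : ∃ q : ℕ → E, PathInterp (K := K) q k ∧
      (∀ i < k, Q (q i) ≠ 0) ∧
      ∀ i < k, QuadraticMap.polar Q (q i) (q (i + 1)) ^ 2 - 4 * Q (q i) * Q (q (i + 1)) ≠ 0 := by
  have h1 (p q : ℕ → E) (s₀ : K) (i : ℕ) (hs : Q (p i + s₀ • (q i - p i)) ≠ 0) :
      ∀ᶠ s : K in cofinite, Q (p i + s • (q i - p i)) ≠ 0 :=
    eventually_ne_zero_of_polyFun (quadraticForm_regFun Q _ (PolyCurve.line (p i) (q i))) hs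
  obtain ⟨r, hr, hrQ⟩ : ∃ q : ℕ → E, PathInterp (K := K) q k ∧ ∀ i < k, Q (q i) ≠ 0 := by
    have h2 := eventually_pathInterp (k := k) p (fun _ => e₃) (s₀ := (0 : K)) (by simpa using hp)
    have h3 := (eventually_all_finite (Set.finite_lt_nat k)).2 fun i (hi : i < k) =>
      h1 p (fun _ => e₃) 1 i (by simp [h.thd])
    obtain ⟨s, hs, hs'⟩ := (h2.and h3).exists
    exact ⟨_, hs, hs'⟩
  -- A path between `e₁` and `e₂` meets the quadric in two points on each line.
  set u : ℕ → E := fun i => if Even i then e₁ else e₂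
  have h2 := eventually_pathInterp (k := k) r u (s₀ := (0 : K)) (by simpa using hr)
  have h3 := (eventually_all_finite (Set.finite_lt_nat k)).2 fun i (hi : i < k) =>
      h1 r u 0 i (by simpa using hrQ i hi)
  have h4 := (eventually_all_finite (Set.finite_lt_nat k)).2 fun i (_ : i < k) =>
    eventually_ne_zero_of_polyFun (s := 1) (g := fun s =>
      QuadraticMap.polar Q (r i + s • (u i - r i)) (r (i + 1) + s • (u (i + 1) - r (i + 1))) ^ 2 -
      4 * Q (r i + s • (u i - r i)) * Q (r (i + 1) + s • (u (i + 1) - r (i + 1))))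
      (sub_mem (pow_mem (polar_mem_polyFun Q (PolyCurve.line _ _) (PolyCurve.line _ _)) 2)
        (mul_mem (mul_mem (const_mem_polyFun 4) (quadraticForm_regFun Q _ (PolyCurve.line _ _)))
          (quadraticForm_regFun Q _ (PolyCurve.line _ _)))) (by
        have h21 : QuadraticMap.polar Q e₂ e₁ = 1 := by rw [QuadraticMap.polar_comm, h.polar]
        by_cases hi : Even i
        · simp [u, hi, Nat.even_add_one, h.fst, h.polar]
        · simp [u, hi, Nat.even_add_one, h.snd, h21])
  obtain ⟨s, hs1, hs2, hs3⟩ := (h2.and (h3.and h4)).exists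
  exact ⟨_, hs1, hs2, hs3⟩

theorem finrank_range_lt {V W : Type*} [AddCommGroup V] [Module K V] [FiniteDimensional K V]
    [AddCommGroup W] [Module K W] {A : V →ₗ[K] W} {v : V} (hv : v ≠ 0) (hA : A v = 0) :
    finrank K (LinearMap.range A) < finrank K V := by
  have h1 := LinearMap.finrank_range_add_finrank_ker A
  have h2 : 0 < finrank K (LinearMap.ker A) :=
    finrank_pos_iff_exists_ne_zero.2 ⟨⟨v, hA⟩, fun h0 => hv (congrArg Subtype.val h0)⟩
  omega

theorem formsRank_two_lt [FiniteDimensional K E] {Q : QuadraticForm K E} (hQ : ∃ v, Q v ≠ 0) :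
    formsRank Q 2 < finrank K (forms K E 2) := by
  obtain ⟨v, hv⟩ := hQ
  have h := finrank_range_lt (A := (LinearMap.funLeft K K
    (Subtype.val : {v // Q v = 0} → E)).domRestrict (forms K E 2))
    (v := ⟨Q, quadraticForm_mem_forms Q⟩) (fun h0 => hv (congrFun (congrArg Subtype.val h0) v))
    (funext fun v => v.2)
  rwa [LinearMap.range_domRestrict] at h

/-- Chains of maximal rank for quadratic forms. A quadratic form vanishing at the two points of
a line on the quadric is proportional to `Q` on the line, so that this reduces to a
statement about quadratic forms on a path of lines. -/
theorem ConicFrame.hasGoodChain_two [IsAlgClosed K] [FiniteDimensional K E]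
    {Q : QuadraticForm K E} {e₁ e₂ e₃ : E} (h : ConicFrame Q e₁ e₂ e₃) : HasGoodChain Q 2 := by
  have : Infinite K := IsAlgClosed.instInfinite
  have hE : 3 ≤ finrank K E := by simpa using h.linearIndependent.fintype_card_le_finrank
  obtain ⟨k, hk, p, hp, hr⟩ := exists_pathInterp (K := K) (finrank K E - 1) E (by omega)
  obtain ⟨q, hq, hQ, hd⟩ := h.exists_path hp
  have hroot (i : ℕ) : ∃ α β : K, i < k → Q (q (i + 1) + α • q i) = 0 ∧ α ≠ β ∧
      QuadraticMap.polar Q (q (i + 1)) (q i) = - (α + β) * Q (q i) := by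
    by_cases hi : i < k
    · obtain ⟨z, hz⟩ := exists_root_quadratic (b := QuadraticMap.polar Q (q (i + 1)) (q i))
        (c := Q (q (i + 1))) (hQ i hi)
      refine ⟨z, - QuadraticMap.polar Q (q (i + 1)) (q i) / Q (q i) - z, fun _ => ⟨?_, ?_, ?_⟩⟩
      · have := map_comb Q 1 z (q (i + 1)) (q i)
        rw [one_smul] at this
        rw [this, ← hz]
        ring
      · intro hzz
        have h1 : 2 * z * Q (q i) = - QuadraticMap.polar Q (q (i + 1)) (q i) := by
          have := hQ i hi
          field_simp at hzz
          linear_combination hzz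
        refine hd i hi ?_
        rw [QuadraticMap.polar_comm]
        linear_combination (2 * z * Q (q i) + QuadraticMap.polar Q (q (i + 1)) (q i)) * h1 -
          4 * Q (q i) * hz
      · have := hQ i hi
        field_simp
        ring
    · exact ⟨0, 0, fun h => absurd h hi⟩
  -- The two points on the line number `i` are `q (i + 1) + α i • q i` and `q (i + 1) + β i • q i`.
  choose α β hαβ using hroot
  set x : Chain K E := ⟨q 0, fun i => q (i + 1) + α i • q i, fun i => - α i, fun _ => 1⟩
  have hnode (i : ℕ) : x.node i = q i := by
    induction i with
    | zero => rfl
    | succ i ih => rw [Chain.node_succ, ih]; simp [x]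
  have hsec (i : ℕ) (hi : i < k) : x.second Q i = Q (q i) • (q (i + 1) + β i • q i) := by
    have h1 : QuadraticMap.polar Q (q (i + 1) + α i • q i) (q i) = (α i - β i) * Q (q i) := by
      rw [QuadraticMap.polar_add_left, QuadraticMap.polar_smul_left, (hαβ i hi).2.2,
        QuadraticMap.polar_self]
      simp
      ring
    rw [Chain.second, hnode, secondPoint]
    change Q (q i) • (q (i + 1) + α i • q i) - _ = _
    rw [h1]
    module
  refine ⟨k, by omega, x, fun i hi => (hαβ i hi).1, fun y z => ?_, ?_⟩
  · -- The values at the nodes are chosen one after the other, starting with `0` at the first node.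
    set edge : ℕ → K → K := fun i w =>
      (y i - z i / Q (q i) ^ 2 - (α i ^ 2 - β i ^ 2) * w) / (α i - β i)
    set w : ℕ → K := fun i => Nat.rec 0 (fun i w => y i - α i * edge i w - α i ^ 2 * w) i
    have hw (i : ℕ) : w (i + 1) = y i - α i * edge i (w i) - α i ^ 2 * w i := rfl
    obtain ⟨F, hF, h1, h2⟩ := hq w fun i => edge i (w i)
    refine ⟨F, hF, fun i hi => ⟨?_, ?_⟩⟩
    · change F (q (i + 1) + α i • q i) = _
      rw [map_add_smul_of_mem_forms_two hF, h1 i hi.le, h1 (i + 1) hi, h2 i hi, hw]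
      ring
    · rw [hsec i hi, forms_smul hF, map_add_smul_of_mem_forms_two hF, h1 i hi.le, h1 (i + 1) hi,
        h2 i hi, hw]
      have h3 := hQ i hi
      have h4 : α i - β i ≠ 0 := sub_ne_zero.2 (hαβ i hi).2.1
      simp only [edge]
      field_simp
      ring
  · have := formsRank_two_lt (Q := Q) ⟨e₃, by simp [h.thd]⟩
    omega

end Quadrics

/-! ### Concatenation of chains -/

namespace Chain

variable {K : Type*} [Field K] {E : Type*} [AddCommGroup E] [Module K E]

theorem node_congr {x y : Chain K E} {k : ℕ} (hs : x.start = y.start)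
    (h : ∀ i < k, x.dir i = y.dir i ∧ x.c i = y.c i ∧ x.e i = y.e i) :
    ∀ i ≤ k, x.node i = y.node i := by
  intro i
  induction i with
  | zero => exact fun _ => hs
  | succ i ih =>
    intro hi
    obtain ⟨h1, h2, h3⟩ := h i hi
    rw [node_succ, node_succ, ih (by omega), h1, h2, h3]

/-- The first `k` lines of `x`, followed by the lines of `u`. -/
def append (x : Chain K E) (k : ℕ) (u : Chain K E) : Chain K E where
  start := x.start
  dir i := if i < k then x.dir i else u.dir (i - k)
  c i := if i < k then x.c i else u.c (i - k)
  e i := if i < k then x.e i else u.e (i - k)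

omit [Field K] [AddCommGroup E] [Module K E] in
theorem append_dir_of_lt (x u : Chain K E) {k i : ℕ} (hi : i < k) :
    (x.append k u).dir i = x.dir i := if_pos hi

omit [Field K] [AddCommGroup E] [Module K E] in
theorem append_dir_add (x u : Chain K E) (k i : ℕ) :
    (x.append k u).dir (k + i) = u.dir i := by
  simp [append]

theorem append_node_of_le (x u : Chain K E) {k i : ℕ} (hi : i ≤ k) :
    (x.append k u).node i = x.node i :=
  node_congr (x := x.append k u) (y := x) rfl (fun j hj => by simp [append, hj]) i hi

theorem append_node_add {x u : Chain K E} {k : ℕ} (h : x.node k = u.start) (i : ℕ) :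
    (x.append k u).node (k + i) = u.node i := by
  induction i with
  | zero => exact (append_node_of_le x u le_rfl).trans h
  | succ i ih =>
    rw [← add_assoc, node_succ, node_succ, ih]
    simp [append]

/-- A chain which starts at a different point `p = x.start + τ • x.dir 0` of the first line of
`x`, and has the line spanned by `p` and `a` in front of the lines of `x`. -/
def prepend (x : Chain K E) (a : E) (τ : K) : Chain K E where
  start := x.start + τ • x.dir 0
  dir i := Nat.casesOn i a x.dir
  c i := Nat.casesOn i 1 x.c
  e i := Nat.casesOn i 0 fun i => Nat.casesOn i (x.e 0 - τ * x.c 0) fun i => x.e (i + 1)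

theorem prepend_node_one (x : Chain K E) (a : E) (τ : K) :
    (x.prepend a τ).node 1 = x.start + τ • x.dir 0 := by
  simp [node_succ, node_zero, prepend]

theorem prepend_node_add_two (x : Chain K E) (a : E) (τ : K) (i : ℕ) :
    (x.prepend a τ).node (i + 2) = x.node (i + 1) := by
  induction i with
  | zero =>
    rw [node_succ, zero_add, prepend_node_one, node_succ, node_zero]
    change x.c 0 • _ + (x.e 0 - τ * x.c 0) • x.dir 0 = _
    module
  | succ i ih =>
    rw [node_succ, ih, node_succ _ (i + 1)]
    rfl

theorem prepend_second_succ {Q : QuadraticForm K E} (x : Chain K E) (a : E) (τ : K)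
    (h0 : Q (x.dir 0) = 0) (i : ℕ) : (x.prepend a τ).second Q (i + 1) = x.second Q i := by
  cases i with
  | zero =>
    rw [second, second, zero_add, prepend_node_one]
    have h1 : Q (x.start + τ • x.dir 0) =
        Q x.start + τ * QuadraticMap.polar Q (x.dir 0) x.start := by
      have := map_comb Q 1 τ x.start (x.dir 0)
      rw [one_smul] at this
      rw [this, h0, QuadraticMap.polar_comm]
      ring
    have h2 : QuadraticMap.polar Q (x.dir 0) (x.start + τ • x.dir 0) =
        QuadraticMap.polar Q (x.dir 0) x.start := by
      simp [QuadraticMap.polar_add_right, QuadraticMap.polar_smul_right, h0]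
    change secondPoint Q (x.dir 0) _ = secondPoint Q (x.dir 0) x.start
    simp only [secondPoint, h1, h2]
    module
  | succ i =>
    rw [second, second, prepend_node_add_two]
    rfl

/-- A chain in the hyperplane `l = 0`, considered as a chain in the whole space. -/
def ofKer {l : Dual K E} (u : Chain K (LinearMap.ker l)) : Chain K E where
  start := u.start
  dir i := u.dir i
  c := u.c
  e := u.e

theorem ofKer_node {l : Dual K E} (u : Chain K (LinearMap.ker l)) (i : ℕ) :
    u.ofKer.node i = u.node i := by
  induction i with
  | zero => rfl
  | succ i ih =>
    rw [node_succ, ih, node_succ]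
    rfl

theorem ofKer_second {Q : QuadraticForm K E} {l : Dual K E} (u : Chain K (LinearMap.ker l))
    (i : ℕ) : u.ofKer.second Q i = u.second (restrictKer Q l) i := by
  rw [second, ofKer_node]
  rfl

/-- The point in which the line number `i` meets the hyperplane `l = 0`. -/
def cut {l : Dual K E} {e : E} (he : l e = 1) (x : Chain K E) (i : ℕ) : LinearMap.ker l :=
  projKer l e he (l (x.dir i) • x.node i - l (x.node i) • x.dir i)

theorem cut_coe {l : Dual K E} {e : E} (he : l e = 1) (x : Chain K E) (i : ℕ) :
    (x.cut he i : E) = l (x.dir i) • x.node i - l (x.node i) • x.dir i :=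
  congrArg Subtype.val (projKer_coe he ⟨_, by simp [mul_comm]⟩)

variable {Q : QuadraticForm K E} {k t : ℕ} {x : Chain K E}

/-- If the forms can be interpolated at the points of a chain, then the lines of
the chain meet the quadric in two different points. -/
theorem Surj.polar_ne_zero (hs : x.Surj Q t k) {i : ℕ} (hi : i < k) :
    QuadraticMap.polar Q (x.dir i) (x.node i) ≠ 0 := by
  intro h0
  obtain ⟨F, hF, h⟩ := hs 0 1
  obtain ⟨h1, h2⟩ := h i hi
  rw [second, secondPoint, h0, zero_smul, sub_zero, forms_smul hF, h1] at h2
  simp at h2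

theorem Surj.smooth (hs : x.Surj Q t k) (hx : x.OnQuadric Q k) : x.Smooth Q k :=
  fun i hi => ⟨hx i hi, _, hs.polar_ne_zero hi⟩

theorem Surj.mono {m : ℕ} (hs : x.Surj Q t k) (hm : m ≤ k) : x.Surj Q t m := fun y z => by
  obtain ⟨F, hF, h⟩ := hs y z
  exact ⟨F, hF, fun i hi => h i (by omega)⟩

/-- A chain whose lines meet the quadric outside of the hyperplane, and whose last line meets
the hyperplane in such a way that a given chain in the hyperplane can be continued from there. -/
theorem exists_transversal [Infinite K] [FiniteDimensional K E] {e₁ e₂ e₃ : E}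
    (hQ : ConicFrame Q e₁ e₂ e₃) {l : Dual K E} {e : E} (he : l e = 1) {f₁ f₂ : LinearMap.ker l}
    (hf : HypPair (restrictKer Q l) f₁ f₂) (hk : 1 ≤ k) (hx : x.Smooth Q k) (hs : x.Surj Q t k)
    {s m : ℕ} {u : Chain K (LinearMap.ker l)} (hu : u.OnQuadric (restrictKer Q l) m)
    (hus : u.Surj (restrictKer Q l) s m) :
    ∃ y : Chain K E, y.Smooth Q k ∧ y.Surj Q t k ∧
      (∀ i < k, l (y.dir i) ≠ 0 ∧ l (y.second Q i) ≠ 0) ∧ Q (y.cut he 0) ≠ 0 ∧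
      Surj (restrictKer Q l) s m { u with start := y.cut he (k - 1) } := by
  have hl : l ≠ 0 := by
    rintro rfl
    simp at he
  obtain ⟨a, ha, hla⟩ : ∃ a, SmoothVec Q a ∧ l a ≠ 0 := by
    obtain ⟨y, hy, hly, -⟩ := hQ.exists_isotropic_ne_zero hl hl
    exact hQ.exists_smooth (RegFun.linear l) hy hly
  have hcut (i : ℕ) (z : K → Chain K E) (hz : IsCurve Q k z) :
      PolyCurve fun s => (z s).cut he i :=
    ((((hz.node i).smul (hz.dir i l)).sub ((hz.dir i).smul (hz.node i l))).map (projKer l e he))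
  have open₂ : OpenCond Q k fun y => ∀ i < k, l (y.dir i) ≠ 0 ∧ l (y.second Q i) ≠ 0 :=
    OpenCond.forall_lt fun i _ => (OpenCond.of_ne_zero fun z hz => hz.dir i l).and
      (OpenCond.of_ne_zero fun z hz => hz.second i l)
  have open₃ : OpenCond Q k fun y => Q (y.cut he 0) ≠ 0 :=
    OpenCond.of_ne_zero fun z hz => quadraticForm_regFun (restrictKer Q l) _ (hcut 0 z hz)
  have open₄ : OpenCond Q k fun y =>
      Surj (restrictKer Q l) s m { u with start := y.cut he (k - 1) } := fun z hz =>
    openCond_surj (k := m) s m le_rfl (fun r => { u with start := (z r).cut he (k - 1) })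
      ⟨hcut (k - 1) z hz, fun i => PolyCurve.const _, fun i => const_mem_polyFun _,
        fun i => const_mem_polyFun _, fun _ => hu⟩
  obtain ⟨y, hy, hys, hy2, hy3⟩ := (openCond_surj t k le_rfl).exists_and hQ (open₂.and open₃)
    ⟨x, hx, hs⟩ (by
      set p : LinearMap.ker l := f₁ + f₂
      have hp : Q p = 1 := by
        have : restrictKer Q l p = 1 := by
          simp [p, QuadraticMap.map_add (restrictKer Q l), hf.fst, hf.snd, hf.polar]
        exact this
      have hlp : l p = 0 := p.2
      set z : Chain K E := star (p : E) fun _ => a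
      have hz (i : ℕ) : z.node i = p := star_node (p : E) _ i
      refine ⟨z, fun i _ => ha, fun i _ => ⟨hla, ?_⟩, ?_⟩
      · rw [second, hz, secondPoint, hp]
        simpa [z, star_dir, hlp] using hla
      · rw [cut_coe, hz, hlp]
        simpa [z, star_dir, QuadraticMap.map_smul, hp] using hla)
  obtain ⟨y, hy, ⟨h1, h2, h3⟩, h4⟩ := ((openCond_surj t k le_rfl).and (open₂.and open₃)).exists_and
    hQ open₄ ⟨y, hy, hys, hy2, hy3⟩ (by
      have hla' := (hy2 (k - 1) (by omega)).1
      set z : Chain K E := star ((l (y.dir (k - 1)))⁻¹ • u.start : E) y.dir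
      have hz (i : ℕ) : z.node i = (l (y.dir (k - 1)))⁻¹ • u.start := star_node _ _ i
      have hcut : z.cut he (k - 1) = u.start := by
        apply Subtype.ext
        have : l u.start = 0 := u.start.2
        rw [cut_coe, hz, map_smul, this]
        simp [z, star_dir, smul_smul, hla']
      refine ⟨z, hy, ?_⟩
      rw [hcut]
      exact hus)
  exact ⟨y, hy, h1, h2, h3, h4⟩

end Chain

/-! ### Lines through a point of a hyperplane section and a given line -/

section Step

variable {K : Type*} [Field K] {E : Type*} [AddCommGroup E] [Module K E]

/-- The extensions of a form on the hyperplane `l = 0`; the choice of `G` allows to prescribe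
values at points outside of the hyperplane. -/
theorem extend_mem_forms {l : Dual K E} {e : E} (he : l e = 1) {t : ℕ}
    {F : LinearMap.ker l → K} (hF : F ∈ forms K (LinearMap.ker l) (t + 1)) {G : E → K}
    (hG : G ∈ forms K E t) : (fun v => F (projKer l e he v) + l v * G v) ∈ forms K E (t + 1) :=
  add_mem (forms_comp (projKer l e he) hF) (linear_mul_mem_forms l hG)

/-- Let `L` be the line spanned by `p` and the smooth point `b`, not contained in the hyperplane
`l = 0`, and let `y` be a point of the quadric in general position. Then the plane spanned by
`L` and `y` contains a point `a` of the quadric in the hyperplane such that the line through `a`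
and `y` meets `L`. -/
theorem exists_secondPoint_eq [IsAlgClosed K] {Q : QuadraticForm K E} {l : Dual K E} {p b y : E}
    (hb : Q b = 0) (hlb : l b ≠ 0)
    (hq : Q (l b • p - l p • b) ≠ 0) (hy : Q y = 0) (hly : l y ≠ 0)
    (hyb : QuadraticMap.polar Q y b ≠ 0) (hyb' : QuadraticMap.polar Q y (secondPoint Q b p) ≠ 0) :
    ∃ (a : E) (τ c : K), l a = 0 ∧ Q a = 0 ∧ c ≠ 0 ∧ secondPoint Q a (p + τ • b) = c • y := by
  -- The line `L` meets the hyperplane in `q`, and the line through `y` and `b` meets it in `r`; so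
  -- `a` is one of the points of the quadric on the line through `q` and `r`.
  set q := l b • p - l p • b with hqdef
  set r := l b • y - l y • b with hrdef
  obtain ⟨θ, hθ⟩ := exists_root_quadratic (b := QuadraticMap.polar Q r q) (c := Q r) hq
  -- The intersection of `L` with the line through `a` and `y`.
  set p' := (θ * l b) • p + (- l y - θ * l p) • b with hp'
  have hap' : r + θ • q = l b • y + p' := by
    simp only [hp', hqdef, hrdef]
    module
  have hQa : Q (r + θ • q) = 0 := by
    have := map_comb Q 1 θ r q
    rw [one_smul] at this
    rw [this, ← hθ]
    ring
  have hQp' : Q p' ≠ 0 := by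
    intro h0
    have h1 : QuadraticMap.polar Q y p' = 0 := by
      have := map_comb Q (l b) 1 y p'
      rw [one_smul, ← hap', hQa, hy, h0] at this
      have h2 : l b * QuadraticMap.polar Q y p' = 0 := by linear_combination -this
      exact (mul_eq_zero.1 h2).resolve_left hlb
    have h2 : Q p' = θ * l b * (θ * l b * Q p + (- l y - θ * l p) * QuadraticMap.polar Q b p) := by
      rw [hp', map_comb, hb, QuadraticMap.polar_comm Q p b]
      ring
    rw [h0, eq_comm, mul_eq_zero] at h2
    rcases h2 with h2 | h2
    · have hθ0 : θ = 0 := (mul_eq_zero.1 h2).resolve_right hlb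
      rw [hp', hθ0] at h1
      simp [QuadraticMap.polar_smul_right, hly, hyb] at h1
    · have h3 : QuadraticMap.polar Q b p • p' = (- (θ * l b)) • secondPoint Q b p := by
        have h4 : (- l y - θ * l p) * QuadraticMap.polar Q b p = - (θ * l b * Q p) := by
          linear_combination h2
        rw [hp', secondPoint, smul_add, smul_smul, smul_smul, mul_comm _ (- l y - θ * l p), h4]
        module
      have h4 := congrArg (QuadraticMap.polarBilin Q y) h3
      simp only [map_smul, QuadraticMap.polarBilin_apply_apply, h1, smul_eq_mul, mul_zero] at h4
      rcases mul_eq_zero.1 h4.symm with h5 | h5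
      · have hθ0 : θ = 0 := (mul_eq_zero.1 (neg_eq_zero.1 h5)).resolve_right hlb
        rw [hp', hθ0] at h1
        simp [QuadraticMap.polar_smul_right, hly, hyb] at h1
      · exact hyb' h5
  have hβ : θ * l b ≠ 0 := by
    intro h0
    apply hQp'
    rw [hp', h0]
    simp [QuadraticMap.map_smul, hb]
  set β := θ * l b
  set τ := (- l y - θ * l p) / β
  have hp'' : p' = β • (p + τ • b) := by
    rw [hp', smul_add, smul_smul, mul_div_cancel₀ _ hβ]
  set a := r + θ • q
  have hpol : QuadraticMap.polar Q a p' = Q p' := by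
    have h1 : (l b) • y = a + (-1 : K) • p' := by rw [hap']; module
    have h2 := congrArg Q h1
    have h3 := map_comb Q 1 (-1) a p'
    rw [one_smul] at h3
    rw [h3, QuadraticMap.map_smul, hy, hQa] at h2
    simp at h2
    linear_combination h2
  have hsec : secondPoint Q a p' = (Q p' * l b) • y := by
    rw [secondPoint, hpol, hap']
    module
  refine ⟨a, τ, (β ^ 2)⁻¹ * (Q p' * l b), ?_, hQa,
    mul_ne_zero (inv_ne_zero (pow_ne_zero 2 hβ)) (mul_ne_zero hQp' hlb), ?_⟩
  · simp [a, hqdef, hrdef]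
    ring
  · have h1 : secondPoint Q a p' = β ^ 2 • secondPoint Q a (p + τ • b) := by
      rw [hp'']
      simp only [secondPoint, QuadraticMap.map_smul, QuadraticMap.polar_smul_right, smul_eq_mul]
      module
    rw [mul_smul, ← hsec, h1, smul_smul, inv_mul_cancel₀ (pow_ne_zero 2 hβ), one_smul]

end Step

/-! ### Chains of maximal rank for forms of higher degree -/

section Existence

variable {K : Type*} [Field K] {E : Type*} [AddCommGroup E] [Module K E]

/-- The induction step: a chain for forms of degree `t`, whose points lie outside of the hyperplane
`l = 0`, is continued by a chain in the hyperplane for forms of degree `t + 1`. If each of the two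
chains leaves one form undetermined, then a line with one point in the hyperplane is put in
front. -/
theorem HasGoodChain.succ [IsAlgClosed K] [FiniteDimensional K E] {Q : QuadraticForm K E}
    {e₁ e₂ e₃ : E} (hQ : ConicFrame Q e₁ e₂ e₃) {l : Dual K E} {e : E} (he : l e = 1)
    {f₁ f₂ : LinearMap.ker l} (hf : HypPair (restrictKer Q l) f₁ f₂) {t : ℕ}
    (hE : HasGoodChain Q t) {m : ℕ} {u : Chain K (LinearMap.ker l)}
    (hu : u.OnQuadric (restrictKer Q l) m) (hus : u.Surj (restrictKer Q l) (t + 1) m)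
    (hm : formsRank (restrictKer Q l) (t + 1) ≤ 2 * m ∨
      formsRank (restrictKer Q l) (t + 1) ≤ 2 * m + 1 ∧
        ∃ f₁ f₂ f₃ : LinearMap.ker l, ConicFrame (restrictKer Q l) f₁ f₂ f₃) :
    HasGoodChain Q (t + 1) := by
  have : Infinite K := IsAlgClosed.instInfinite
  obtain ⟨k, hk, x₀, hx₀, hs₀, hr₀⟩ := hE
  obtain ⟨x, hx, hxs, hxl, hcut, hus⟩ := Chain.exists_transversal hQ he hf hk
    (hs₀.smooth hx₀) hs₀ hu hus
  have hrank := formsRank_succ_le (Q := Q) he hf t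
  set v : Chain K (LinearMap.ker l) := { u with start := x.cut he (k - 1) }
  have hv : v.OnQuadric (restrictKer Q l) m := hu
  -- The end point of the last line is moved to the hyperplane.
  obtain ⟨x', hx'k, hx'dir, hx'node⟩ : ∃ x' : Chain K E, x'.node k = v.ofKer.start ∧
      x'.dir = x.dir ∧ ∀ i < k, x'.node i = x.node i := by
    set x' : Chain K E := ⟨x.start, x.dir,
      fun i => if i = k - 1 then l (x.dir i) else x.c i,
      fun i => if i = k - 1 then - l (x.node i) else x.e i⟩
    have hn (i : ℕ) (hi : i ≤ k - 1) : x'.node i = x.node i :=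
      Chain.node_congr (x := x') (y := x) (k := k - 1) rfl
        (fun j hj => by simp [x', hj.ne]) i hi
    refine ⟨x', ?_, rfl, fun i hi => hn i (by omega)⟩
    have h1 : x'.node k = x'.node (k - 1 + 1) := by congr 1; omega
    rw [h1, Chain.node_succ, hn (k - 1) le_rfl]
    change _ = (x.cut he (k - 1) : E)
    rw [Chain.cut_coe]
    simp [x', sub_eq_add_neg]
  have hx'sec (i : ℕ) (hi : i < k) : x'.second Q i = x.second Q i := by
    rw [Chain.second, Chain.second, hx'dir, hx'node i hi]
  set w := x'.append k v.ofKer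
  have hwdir (i : ℕ) (hi : i < k) : w.dir i = x.dir i := by
    rw [← hx'dir]
    exact Chain.append_dir_of_lt _ _ hi
  have hwsec (i : ℕ) (hi : i < k) : w.second Q i = x.second Q i := by
    rw [← hx'sec i hi, Chain.second, hwdir i hi, Chain.append_node_of_le _ _ hi.le, Chain.second,
      hx'dir]
  have hwdir' (i : ℕ) : w.dir (k + i) = v.dir i := Chain.append_dir_add _ _ _ _
  have hwsec' (i : ℕ) : w.second Q (k + i) = v.second (restrictKer Q l) i := by
    rw [Chain.second, Chain.append_node_add hx'k, ← Chain.ofKer_second, Chain.second]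
    congr 1
    exact hwdir' i
  have hw : w.OnQuadric Q (k + m) := by
    intro i hi
    by_cases hik : i < k
    · rw [hwdir i hik]
      exact (hx i hik).1
    · obtain ⟨j, rfl⟩ := Nat.exists_eq_add_of_le (not_lt.1 hik)
      rw [hwdir']
      exact hv j (by omega)
  -- Interpolation at the points of `w`, given interpolation on the two parts.
  have combine (y z : ℕ → K) {F : LinearMap.ker l → K}
      (hF : ∀ i < m, F (v.dir i) = y (k + i) ∧
        F (v.second (restrictKer Q l) i) = z (k + i)) {G : E → K}
      (hG : ∀ i < k, G (x.dir i) = (y i - F (projKer l e he (x.dir i))) / l (x.dir i) ∧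
        G (x.second Q i) = (z i - F (projKer l e he (x.second Q i))) / l (x.second Q i))
      (i : ℕ) (hi : i < k + m) :
      F (projKer l e he (w.dir i)) + l (w.dir i) * G (w.dir i) = y i ∧
      F (projKer l e he (w.second Q i)) + l (w.second Q i) * G (w.second Q i) = z i := by
    by_cases hik : i < k
    · obtain ⟨h1, h2⟩ := hxl i hik
      rw [hwdir i hik, hwsec i hik, (hG i hik).1, (hG i hik).2, mul_div_cancel₀ _ h1,
        mul_div_cancel₀ _ h2]
      constructor <;> ring
    · obtain ⟨j, rfl⟩ := Nat.exists_eq_add_of_le (not_lt.1 hik)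
      rw [hwdir', hwsec', projKer_coe, projKer_coe, (hF j (by omega)).1, (hF j (by omega)).2]
      simp
  by_cases hcase : formsRank (restrictKer Q l) (t + 1) ≤ 2 * m ∨ formsRank Q t ≤ 2 * k
  · refine ⟨k + m, by omega, w, hw, fun y z => ?_, by omega⟩
    obtain ⟨F, hF, hFv⟩ := hus (fun i => y (k + i)) fun i => z (k + i)
    obtain ⟨G, hG, hGx⟩ := hxs
      (fun i => (y i - F (projKer l e he (x.dir i))) / l (x.dir i))
      fun i => (z i - F (projKer l e he (x.second Q i))) / l (x.second Q i)
    exact ⟨_, extend_mem_forms he hF hG, combine y z hFv hGx⟩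
  · push Not at hcase
    obtain ⟨hm', f₁, f₂, f₃, hf'⟩ := hm.resolve_left (by omega)
    obtain ⟨F₀, hF₀, hF₀v, b₀, hb₀, hFb₀⟩ := hv.exists_form hcase.1
    obtain ⟨G₀, hG₀, hG₀x, c₀, hc₀, hGc₀⟩ := hx.onQuadric.exists_form hcase.2
    have hx0 := hx 0 hk
    have hpol0 := hxs.polar_ne_zero hk
    have hsec0 : SmoothVec Q (x.second Q 0) := ⟨hx.onQuadric.second hk, x.dir 0, by
      rw [Chain.second, polar_secondPoint_self hx0.1]
      exact neg_ne_zero.2 (pow_ne_zero 2 hpol0)⟩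
    have hl : l ≠ 0 := by
      rintro rfl
      simp at he
    -- A point of the quadric in general position.
    obtain ⟨y, hy, hGy, hly, hyb, hyb'⟩ : ∃ y, Q y = 0 ∧ G₀ y ≠ 0 ∧ l y ≠ 0 ∧
        QuadraticMap.polar Q y (x.dir 0) ≠ 0 ∧ QuadraticMap.polar Q y (x.second Q 0) ≠ 0 := by
      obtain ⟨y₁, hy₁, hly₁, -⟩ := hQ.exists_isotropic_ne_zero hl hl
      obtain ⟨y₂, hy₂, h1, h2⟩ :=
        hQ.exists_isotropic_ne_zero hx0.polarBilin_ne_zero hsec0.polarBilin_ne_zero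
      have hB := (RegFun.linear (QuadraticMap.polarBilin Q (x.dir 0))).mul
        (RegFun.linear (QuadraticMap.polarBilin Q (x.second Q 0)))
      have hG := (forms_regFun hG₀).mul (RegFun.linear l)
      obtain ⟨y₃, hy₃, h3, h4⟩ := hQ.exists_common (forms_regFun hG₀) (RegFun.linear l) hc₀ hGc₀
        hy₁ hly₁
      obtain ⟨y, hy, h5, h6⟩ := hQ.exists_common hG hB hy₃.1 (mul_ne_zero h3 h4) hy₂
        (mul_ne_zero h1 h2)
      refine ⟨y, hy.1, left_ne_zero_of_mul h5, right_ne_zero_of_mul h5, ?_, ?_⟩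
      · rw [QuadraticMap.polar_comm]
        exact left_ne_zero_of_mul h6
      · rw [QuadraticMap.polar_comm]
        exact right_ne_zero_of_mul h6
    rw [Chain.cut_coe] at hcut
    obtain ⟨a₁, τ, c, hla₁, hQa₁, hc, hsec⟩ := exists_secondPoint_eq hx0.1 (hxl 0 hk).1 hcut hy hly
      hyb hyb'
    set p := x.node 0 + τ • x.dir 0
    -- The point `a` of the additional line in the hyperplane.
    obtain ⟨a, ha, hFa, hab⟩ := hf'.exists_common (forms_regFun hF₀)
      (R := fun a : LinearMap.ker l => G₀ (secondPoint Q (a : E) p) * l (secondPoint Q (a : E) p))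
      (fun γ hγ => by
        have := (hγ.map (LinearMap.ker l).subtype).secondPoint (Q := Q) (PolyCurve.const p)
        exact mul_mem (forms_regFun hG₀ _ this) (this l)) hb₀ hFb₀ (z := ⟨a₁, hla₁⟩) hQa₁ (by
        change G₀ (secondPoint Q a₁ p) * l (secondPoint Q a₁ p) ≠ 0
        rw [hsec, forms_smul hG₀, map_smul]
        exact mul_ne_zero (mul_ne_zero (pow_ne_zero _ hc) hGy) (mul_ne_zero hc hly))
    have hGb := left_ne_zero_of_mul hab
    have hlb := right_ne_zero_of_mul hab
    set b := secondPoint Q (a : E) p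
    have hw0 : Q (w.dir 0) = 0 := hw 0 (by omega)
    set z := w.prepend a τ
    have hz0 : z.dir 0 = a := rfl
    have hz1 (i : ℕ) : z.dir (i + 1) = w.dir i := rfl
    have hz2 : z.second Q 0 = b := by
      have h1 : z.node 0 = p := by
        change x'.start + τ • w.dir 0 = p
        rw [hwdir 0 hk, ← Chain.node_zero, hx'node 0 hk]
      rw [Chain.second, h1, hz0]
    have hz3 (i : ℕ) : z.second Q (i + 1) = w.second Q i := Chain.prepend_second_succ w a τ hw0 i
    refine ⟨k + m + 1, by omega, z, ?_, fun y' z' => ?_, by omega⟩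
    · intro i hi
      cases i with
      | zero => exact ha.1
      | succ i => exact hw i (by omega)
    · obtain ⟨F₁, hF₁, hFv⟩ := hus (fun i => y' (k + i + 1)) fun i => z' (k + i + 1)
      set F := F₁ + ((y' 0 - F₁ a) / F₀ a) • F₀
      have hF : F ∈ forms K _ (t + 1) := add_mem hF₁ (Submodule.smul_mem _ _ hF₀)
      obtain ⟨G₁, hG₁, hGx⟩ := hxs
        (fun i => (y' (i + 1) - F (projKer l e he (x.dir i))) / l (x.dir i))
        fun i => (z' (i + 1) - F (projKer l e he (x.second Q i))) / l (x.second Q i)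
      set G := G₁ + (((z' 0 - F (projKer l e he b)) / l b - G₁ b) / G₀ b) • G₀
      have hG : G ∈ forms K E t := add_mem hG₁ (Submodule.smul_mem _ _ hG₀)
      refine ⟨_, extend_mem_forms he hF hG, fun i hi => ?_⟩
      cases i with
      | zero =>
        rw [hz0, hz2]
        constructor
        · rw [projKer_coe]
          simp [F, hFa]
        · simp only [G, Pi.add_apply, Pi.smul_apply, smul_eq_mul]
          field_simp
          ring
      | succ i =>
        rw [hz1, hz3]
        refine combine (fun i => y' (i + 1)) (fun i => z' (i + 1)) (fun j hj => ?_)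
          (fun j hj => ?_) i (by omega)
        · simp [F, hFv j hj, hF₀v j hj]
        · simp [G, hGx j hj, hG₀x j hj]

/-- Chains of maximal rank for a quadric which consists of two points of a line. -/
theorem HypPair.exists_chain {Q : QuadraticForm K E} {e₁ e₂ : E} (h : HypPair Q e₁ e₂)
    (hE : ∀ v, Q v = 0 → ∃ c : K, v = c • e₁ ∨ v = c • e₂) {t : ℕ} (ht : 1 ≤ t) :
    ∃ x : Chain K E, x.OnQuadric Q 1 ∧ x.Surj Q t 1 ∧ formsRank Q t ≤ 2 := by
  have h21 : QuadraticMap.polar Q e₂ e₁ = 1 := by rw [QuadraticMap.polar_comm, h.polar]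
  set x : Chain K E := ⟨e₁ + e₂, fun _ => e₁, 0, 0⟩
  have hsec : x.second Q 0 = (-1 : K) • e₂ := by
    have h1 : Q (e₁ + e₂) = 1 := by simp [QuadraticMap.map_add Q, h.fst, h.snd, h.polar]
    have h2 : QuadraticMap.polar Q e₁ (e₁ + e₂) = 1 := by
      simp [QuadraticMap.polar_add_right, h.fst, h.polar]
    change secondPoint Q e₁ (e₁ + e₂) = _
    rw [secondPoint, h1, h2]
    module
  refine ⟨x, fun _ _ => h.fst, fun y z => ?_, ?_⟩
  · refine ⟨(y 0 • fun v => QuadraticMap.polarBilin Q e₂ v ^ t) +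
      ((-1) ^ t * z 0) • fun v => QuadraticMap.polarBilin Q e₁ v ^ t,
      add_mem (Submodule.smul_mem _ _ (pow_mem_forms _ t))
        (Submodule.smul_mem _ _ (pow_mem_forms _ t)), fun i hi => ?_⟩
    obtain rfl : i = 0 := by omega
    rw [hsec]
    have ht0 : t ≠ 0 := by omega
    constructor
    · simp [x, h21, polar_self_eq_zero h.fst, ht0]
    · have h1 : ((-1 : K) ^ t) * (-1) ^ t = 1 := by rw [← mul_pow]; simp
      simp [QuadraticMap.polar_neg_right, polar_self_eq_zero h.snd, ht0, h.polar]
      linear_combination z 0 * h1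
  · set r := LinearMap.funLeft K K (Subtype.val : {v // Q v = 0} → E)
    set A : ({v // Q v = 0} → K) →ₗ[K] (Fin 2 → K) :=
      LinearMap.funLeft K K ![⟨e₁, h.fst⟩, ⟨e₂, h.snd⟩]
    have hA : Function.Injective (A.domRestrict ((forms K E t).map r)) := by
      rw [injective_iff_map_eq_zero]
      rintro ⟨_, F, hF, rfl⟩ h0
      have h1 : F e₁ = 0 := congrFun h0 0
      have h2 : F e₂ = 0 := congrFun h0 1
      refine Subtype.ext (funext fun v => ?_)
      change F v = 0
      obtain ⟨c, hc | hc⟩ := hE v.1 v.2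
      · rw [hc, forms_smul hF, h1, mul_zero]
      · rw [hc, forms_smul hF, h2, mul_zero]
    have h1 := LinearMap.finrank_le_finrank_of_injective hA
    rw [finrank_fintype_fun_eq_card, Fintype.card_fin] at h1
    exact h1

/-- For every degree `t ≥ 2` there are chains of maximal rank, by induction on the degree and on the
dimension, using a hyperplane which contains the frame. If the dimension is `3`, then the
hyperplane section of the quadric consists of two points. -/
theorem exists_hasGoodChain {K : Type*} [Field K] [IsAlgClosed K] (n : ℕ) :
    ∀ (E : Type*) [AddCommGroup E] [Module K E] [FiniteDimensional K E] (Q : QuadraticForm K E)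
      (e₁ e₂ e₃ : E), ConicFrame Q e₁ e₂ e₃ → finrank K E = n + 3 →
      ∀ t, HasGoodChain Q (t + 2) := by
  induction n with
  | zero =>
    intro E _ _ _ Q e₁ e₂ e₃ hQ hE t
    induction t with
    | zero => exact hQ.hasGoodChain_two
    | succ t ih =>
      set b := basisOfLinearIndependentOfCardEqFinrank hQ.linearIndependent (by simp [hE])
      have hb (i : Fin 3) : b i = ![e₁, e₂, e₃] i := by
        simp [b]
      have hcoord (i : Fin 3) : b.coord 2 (![e₁, e₂, e₃] i) = if i = 2 then 1 else 0 := by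
        rw [← hb, b.coord_apply, b.repr_self, Finsupp.single_apply]
      have h1 : b.coord 2 e₁ = 0 := hcoord 0
      have h2 : b.coord 2 e₂ = 0 := hcoord 1
      have h3 : b.coord 2 e₃ = 1 := hcoord 2
      have hf : HypPair (restrictKer Q (b.coord 2)) ⟨e₁, h1⟩ ⟨e₂, h2⟩ :=
        ⟨hQ.fst, hQ.snd, hQ.polar⟩
      have hiso (v : LinearMap.ker (b.coord 2)) (hv : restrictKer Q (b.coord 2) v = 0) :
          ∃ c : K, v = c • ⟨e₁, h1⟩ ∨ v = c • ⟨e₂, h2⟩ := by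
        have hv1 : v.1 = b.repr v.1 0 • e₁ + b.repr v.1 1 • e₂ := by
          conv_lhs => rw [← b.sum_repr v.1]
          have : b.repr v.1 2 = 0 := v.2
          simp [Fin.sum_univ_three, hb, this]
        have hv2 : Q v.1 = 0 := hv
        rw [hv1, map_comb, hQ.fst, hQ.snd, hQ.polar] at hv2
        have hv3 : b.repr v.1 0 * b.repr v.1 1 = 0 := by linear_combination hv2
        rcases mul_eq_zero.1 hv3 with h0 | h0
        · exact ⟨b.repr v.1 1, Or.inr (Subtype.ext (hv1.trans (by simp [h0])))⟩
        · exact ⟨b.repr v.1 0, Or.inl (Subtype.ext (hv1.trans (by simp [h0])))⟩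
      obtain ⟨u, hu, hus, hr⟩ := hf.exists_chain hiso (t := t + 2 + 1) (by omega)
      exact ih.succ hQ h3 hf hu hus (Or.inl (by omega))
  | succ n ihn =>
    intro E _ _ _ Q e₁ e₂ e₃ hQ hE t
    induction t with
    | zero => exact hQ.hasGoodChain_two
    | succ t ih =>
      have hspan := span_range_lt_top (K := K) e₁ e₂ e₃ (by omega)
      obtain ⟨l₀, hl₀, hle⟩ := Submodule.exists_le_ker_of_lt_top _ hspan
      obtain ⟨e, he⟩ := DFunLike.ne_iff.1 hl₀
      have hle' (i : Fin 3) : l₀ (![e₁, e₂, e₃] i) = 0 :=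
        hle (Submodule.subset_span (Set.mem_range_self i))
      have he' : l₀ ((l₀ e)⁻¹ • e) = 1 := by
        rw [map_smul, smul_eq_mul, inv_mul_cancel₀ (by simpa using he)]
      have hf : ConicFrame (restrictKer Q l₀) ⟨e₁, hle' 0⟩ ⟨e₂, hle' 1⟩ ⟨e₃, hle' 2⟩ :=
        { fst := hQ.fst, snd := hQ.snd, polar := hQ.polar, thd := hQ.thd, polar₁ := hQ.polar₁,
          polar₂ := hQ.polar₂ }
      have hH := finrank_ker_of_eq_one he'
      obtain ⟨m, -, u, hu, hus, hr⟩ := ihn (LinearMap.ker l₀) _ _ _ _ hf (by omega) (t + 1)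
      exact ih.succ hQ he' hf.toHypPair hu hus (Or.inr ⟨hr, _, _, _, hf⟩)

end Existence

/-! ### Frames for quadratic forms of large rank -/

section Frame

variable {K : Type*} [Field K] [IsAlgClosed K] {E : Type*} [AddCommGroup E] [Module K E]
  {Q : QuadraticForm K E}

/-- Otherwise every isotropic vector would belong to the radical, and every vector would be
congruent modulo the radical to a multiple of one fixed vector. -/
theorem exists_hypPair (h : 2 ≤ finrank K (E ⧸ Q.radical)) : ∃ e₁ e₂, HypPair Q e₁ e₂ := by
  by_cases hs : ∃ o, SmoothVec Q o
  · obtain ⟨o, ho, w, hw⟩ := hs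
    set c := (QuadraticMap.polar Q o w)⁻¹
    have hz : QuadraticMap.polar Q o (c • w) = 1 := by
      simp [QuadraticMap.polar_smul_right, c, hw]
    refine ⟨o, (1 : K) • (c • w) + (- Q (c • w)) • o, ho, ?_, ?_⟩
    · rw [map_comb, ho, QuadraticMap.polar_comm, hz]
      ring
    · rw [QuadraticMap.polar_add_right, QuadraticMap.polar_smul_right Q 1 o,
        QuadraticMap.polar_smul_right Q _ _ o, hz, polar_self_eq_zero ho]
      simp
  · have hrad (o : E) (ho : Q o = 0) : o ∈ Q.radical := by
      refine ⟨ho, LinearMap.ext fun w => ?_⟩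
      by_contra hw
      exact hs ⟨o, ho, w, hw⟩
    exfalso
    have hle : finrank K (E ⧸ Q.radical) ≤ 1 := by
      by_cases hu : ∃ u, Q u ≠ 0
      · obtain ⟨u, hu⟩ := hu
        refine finrank_le_one (Q.radical.mkQ u) fun w => ?_
        obtain ⟨w, rfl⟩ := Q.radical.mkQ_surjective w
        obtain ⟨z, hz⟩ := exists_root_quadratic (b := QuadraticMap.polar Q w u) (c := Q w) hu
        refine ⟨-z, ?_⟩
        have h1 : Q ((1 : K) • w + z • u) = 0 := by
          rw [map_comb, ← hz]
          ring
        have h2 := (Submodule.Quotient.mk_eq_zero _).2 (hrad _ h1)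
        rw [one_smul] at h2
        rw [neg_smul, eq_comm, eq_neg_iff_add_eq_zero]
        exact h2
      · push Not at hu
        refine finrank_le_one 0 fun w => ⟨0, ?_⟩
        obtain ⟨w, rfl⟩ := Q.radical.mkQ_surjective w
        rw [smul_zero]
        exact ((Submodule.Quotient.mk_eq_zero _).2 (hrad w (hu w))).symm
    omega

/-- Otherwise the form would vanish on the orthogonal complement of a hyperbolic pair, and every
vector would be congruent modulo the radical to a combination of the pair. -/
theorem exists_conicFrame (h : 3 ≤ finrank K (E ⧸ Q.radical)) :
    ∃ e₁ e₂ e₃, ConicFrame Q e₁ e₂ e₃ := by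
  obtain ⟨e₁, e₂, he⟩ := exists_hypPair (Q := Q) (by omega)
  -- The projection to the orthogonal complement.
  set p : E → E := fun w => w - QuadraticMap.polar Q e₂ w • e₁ - QuadraticMap.polar Q e₁ w • e₂
  have he' : QuadraticMap.polar Q e₂ e₁ = 1 := by rw [QuadraticMap.polar_comm, he.polar]
  have hp1 (w : E) : QuadraticMap.polar Q e₁ (p w) = 0 := by
    simp [p, QuadraticMap.polar_sub_right, QuadraticMap.polar_smul_right, he.polar, he.fst]
  have hp2 (w : E) : QuadraticMap.polar Q e₂ (p w) = 0 := by
    simp [p, QuadraticMap.polar_sub_right, QuadraticMap.polar_smul_right, he', he.snd]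
  by_cases hw : ∃ w, Q (p w) ≠ 0
  · obtain ⟨w, hw⟩ := hw
    obtain ⟨c, hc⟩ := exists_root_quadratic (b := 0) (c := -1) hw
    refine ⟨e₁, e₂, c • p w, he, ?_, ?_, ?_⟩
    · rw [QuadraticMap.map_smul, smul_eq_mul]
      linear_combination hc
    · rw [QuadraticMap.polar_smul_right, hp1, smul_zero]
    · rw [QuadraticMap.polar_smul_right, hp2, smul_zero]
  · push Not at hw
    have hrad (w : E) : p w ∈ Q.radical := by
      refine ⟨hw w, LinearMap.ext fun v => ?_⟩
      have h1 : v = p v + QuadraticMap.polar Q e₂ v • e₁ + QuadraticMap.polar Q e₁ v • e₂ := by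
        simp only [p]
        abel
      have h2 : QuadraticMap.polar Q (p w) (p v) = 0 := by
        have h3 : p w + p v = p (w + v) := by
          simp only [p, QuadraticMap.polar_add_right, add_smul]
          abel
        simp [QuadraticMap.polar, h3, hw]
      rw [QuadraticMap.polarBilin_apply_apply, h1, QuadraticMap.polar_add_right,
        QuadraticMap.polar_add_right, QuadraticMap.polar_smul_right, QuadraticMap.polar_smul_right,
        QuadraticMap.polar_comm Q _ e₁, QuadraticMap.polar_comm Q _ e₂, hp1, hp2, h2]
      simp
    have htop : Submodule.span K (Set.range ![Q.radical.mkQ e₁, Q.radical.mkQ e₂]) = ⊤ := by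
      refine eq_top_iff.2 fun w _ => ?_
      obtain ⟨w, rfl⟩ := Q.radical.mkQ_surjective w
      have h1 := (Submodule.Quotient.mk_eq_zero _).2 (hrad w)
      have h2 : Q.radical.mkQ w = QuadraticMap.polar Q e₂ w • Q.radical.mkQ e₁ +
          QuadraticMap.polar Q e₁ w • Q.radical.mkQ e₂ := by
        rw [← sub_eq_zero, ← h1]
        simp only [p, Submodule.mkQ_apply, Submodule.Quotient.mk_sub, Submodule.Quotient.mk_smul]
        abel
      rw [h2]
      exact add_mem (Submodule.smul_mem _ _ (Submodule.subset_span ⟨0, rfl⟩))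
        (Submodule.smul_mem _ _ (Submodule.subset_span ⟨1, rfl⟩))
    have h1 := finrank_range_le_card (R := K) ![Q.radical.mkQ e₁, Q.radical.mkQ e₂]
    rw [Set.finrank, htop, finrank_top, Fintype.card_fin] at h1
    omega

omit [IsAlgClosed K] in
/-- The rank of a quadratic form drops by at most `2` on a hyperplane. -/
theorem finrank_quotient_radical_le [FiniteDimensional K E] {l : Dual K E} {e : E} (he : l e = 1) :
    finrank K (E ⧸ Q.radical) ≤
      finrank K (LinearMap.ker l ⧸ (restrictKer Q l).radical) + 2 := by
  set S := (restrictKer Q l).radical.map (LinearMap.ker l).subtype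
  have hS : finrank K S = finrank K (restrictKer Q l).radical :=
    Submodule.finrank_map_subtype_eq _ _
  have hle : LinearMap.ker (QuadraticMap.polarBilin Q e) ⊓ S ≤ Q.radical := by
    rintro _ ⟨hv, v, hv', rfl⟩
    refine ⟨hv'.1, LinearMap.ext fun w => ?_⟩
    have h1 : QuadraticMap.polar Q v (proj l e w) = 0 :=
      LinearMap.congr_fun hv'.2 (projKer l e he w)
    have h2 : QuadraticMap.polar Q e v = 0 := hv
    rw [QuadraticMap.polarBilin_apply_apply, ← proj_add l e w, QuadraticMap.polar_add_right,
      QuadraticMap.polar_smul_right, QuadraticMap.polar_comm Q _ e]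
    simp [h1, h2]
  have h1 := finrank_le_add (A := ⊤) le_top hle
  rw [finrank_top, finrank_self] at h1
  have h2 := Q.radical.finrank_quotient_add_finrank
  have h3 := (restrictKer Q l).radical.finrank_quotient_add_finrank
  have h4 := finrank_ker_of_eq_one he
  omega

end Frame

/-! ### Sections and forms -/

section Sections

variable {K : Type*} [Field K] {n t : ℕ}

theorem prod_pow_mem_forms (s : Finset (Fin n)) (m : Fin n → ℕ) :
    (fun v => ∏ i ∈ s, v i ^ m i) ∈ forms K (Fin n → K) (∑ i ∈ s, m i) := by
  induction s using Finset.cons_induction with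
  | empty => simpa using const_mem_forms 1
  | cons a s ha ih =>
    simp only [Finset.prod_cons, Finset.sum_cons]
    exact mul_mem_forms (pow_mem_forms (LinearMap.proj a : Dual K (Fin n → K)) (m a)) ih

theorem eval_mem_forms {F : MvPolynomial (Fin n) K} (hF : F.IsHomogeneous t) :
    (fun v => MvPolynomial.eval v F) ∈ forms K (Fin n → K) t := by
  have : (fun v => MvPolynomial.eval v F) =
      ∑ m ∈ F.support, F.coeff m • fun v => ∏ i, v i ^ m i := by
    ext v
    simp [MvPolynomial.eval_eq']
  rw [this]
  refine sum_mem fun m hm => Submodule.smul_mem _ _ ?_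
  have h1 := prod_pow_mem_forms (K := K) Finset.univ m
  have h2 := hF (MvPolynomial.mem_support_iff.1 hm)
  rw [Finsupp.weight_apply, Finsupp.sum_fintype _ _ (by simp)] at h2
  simp only [Pi.one_apply, smul_eq_mul, mul_one] at h2
  rwa [h2] at h1

theorem exists_isHomogeneous_eval_eq {F : (Fin n → K) → K} (hF : F ∈ forms K (Fin n → K) t) :
    ∃ P : MvPolynomial (Fin n) K, P.IsHomogeneous t ∧ ∀ v, MvPolynomial.eval v P = F v := by
  induction t generalizing F with
  | zero =>
    obtain ⟨c, rfl⟩ := forms_zero_induction hF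
    exact ⟨_, MvPolynomial.isHomogeneous_C _ c, by simp⟩
  | succ t ih =>
    refine forms_succ_induction (p := fun F => ∃ P : MvPolynomial (Fin n) K,
      P.IsHomogeneous (t + 1) ∧ ∀ v, MvPolynomial.eval v P = F v) ?_ ?_ hF
    · intro φ F hF
      obtain ⟨P, hP, h⟩ := ih hF
      refine ⟨(∑ i, MvPolynomial.C (φ (Pi.single i 1)) * MvPolynomial.X i) * P, ?_, fun v => ?_⟩
      · rw [add_comm]
        refine MvPolynomial.IsHomogeneous.mul
          (MvPolynomial.IsHomogeneous.sum _ _ _ fun i _ => ?_) hP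
        simpa using (MvPolynomial.isHomogeneous_C (Fin n) (φ (Pi.single i 1))).mul
          (MvPolynomial.isHomogeneous_X K i)
      · have hφ : φ v = ∑ i, φ (Pi.single i 1) * v i := by
          conv_lhs => rw [pi_eq_sum_univ' v]
          simp [mul_comm]
        simp [h, hφ]
    · rintro F G ⟨P, hP, h⟩ ⟨R, hR, h'⟩
      exact ⟨P + R, hP.add hR, fun v => by simp [h, h']⟩

theorem forms_mem_sections (X : Set (PSpace K n)) {F : (Fin (n + 1) → K) → K}
    (hF : F ∈ forms K (Fin (n + 1) → K) t) :
    (fun v : puncturedCone X => F v.1) ∈ sections X t := fun _ => by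
  obtain ⟨P, hP, h⟩ := exists_isHomogeneous_eval_eq hF
  exact ⟨0, P, hP, fun v _ => by simp [h]⟩

theorem sections_smul {X : Set (PSpace K n)} {s : puncturedCone X → K} (hs : s ∈ sections X t)
    {v w : puncturedCone X} {c : K} (h : w.1 = c • v.1) : s w = c ^ t * s v := by
  obtain ⟨i, hi⟩ := Function.ne_iff.1 v.2.1
  have hc : c ≠ 0 := by
    rintro rfl
    exact w.2.1 (by simpa using h)
  obtain ⟨N, F, hF, hFs⟩ := hs i
  have hi' : v.1 i ≠ 0 := hi
  rw [hFs w (by simp [h, hc, hi']), hFs v hi', h]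
  have h1 := forms_smul (eval_mem_forms hF) c v.1
  rw [h1]
  simp only [Pi.smul_apply, smul_eq_mul]
  field_simp
  ring

theorem mem_puncturedCone_quadric {Q : QuadraticForm K (Fin (n + 1) → K)} {v : Fin (n + 1) → K} :
    v ∈ puncturedCone (quadric Q) ↔ v ≠ 0 ∧ Q v = 0 :=
  ⟨fun ⟨h0, h⟩ => ⟨h0, (mk_mem_quadric_iff Q h0).1 h⟩,
    fun ⟨h0, h⟩ => ⟨h0, (mk_mem_quadric_iff Q h0).2 h⟩⟩

/-- The sections over a quadric of rank at least `4` are given by forms. A section `s` is of the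
form `F / x₀ ^ N`; the form `F` vanishes on the hyperplane section `x₀ = 0` of the quadric, which
is reduced by the assumption on the rank, so that `N` can be decreased. -/
theorem exists_form_of_mem_sections [IsAlgClosed K] {Q : QuadraticForm K (Fin (n + 1) → K)}
    (hQ : 4 ≤ quadricRank Q) {s : puncturedCone (quadric Q) → K} (hs : s ∈ sections (quadric Q) t) :
    ∃ F ∈ forms K (Fin (n + 1) → K) t, ∀ v, s v = F v.1 := by
  have : Infinite K := IsAlgClosed.instInfinite
  have hrank : 4 ≤ finrank K ((Fin (n + 1) → K) ⧸ Q.radical) := hQ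
  obtain ⟨e₁, e₂, e₃, hfr⟩ := exists_conicFrame (Q := Q) (by omega)
  set x : Fin (n + 1) → Dual K (Fin (n + 1) → K) := fun i => LinearMap.proj i
  have hx (i : Fin (n + 1)) : x i ≠ 0 := DFunLike.ne_iff.2 ⟨Pi.single i 1, by simp [x]⟩
  have he : x 0 (Pi.single 0 1) = 1 := by simp [x]
  have hrank' := finrank_quotient_radical_le (Q := Q) he
  obtain ⟨f₁, f₂, hf⟩ := exists_hypPair (Q := restrictKer Q (x 0)) (by omega)
  suffices H : ∀ N, ∀ F ∈ forms K (Fin (n + 1) → K) (t + N),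
      (∀ v : puncturedCone (quadric Q), s v * x 0 v.1 ^ N = F v.1) →
      ∃ F ∈ forms K (Fin (n + 1) → K) t, ∀ v, s v = F v.1 by
    obtain ⟨N, F, hF, h⟩ := hs 0
    refine H (N + 1) _ (linear_mul_mem_forms (x 0) (eval_mem_forms hF)) fun v => ?_
    by_cases hv : v.1 0 = 0
    · simp [x, hv]
    · rw [h v hv]
      simp only [x, LinearMap.proj_apply]
      field_simp
      ring
  intro N
  induction N with
  | zero => exact fun F hF h => ⟨F, hF, fun v => by simpa using h v⟩
  | succ N ih =>
    intro F hF h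
    obtain ⟨G, hG, hFG⟩ := exists_eq_linear_mul he hf (t := t + N) hF fun v hv hv0 => by
      by_cases hv' : v = 0
      · have := forms_smul hF 0 0
        simpa [hv'] using this
      · have := h ⟨v, mem_puncturedCone_quadric.2 ⟨hv', hv⟩⟩
        simpa [hv0] using this.symm
    have hne (v : puncturedCone (quadric Q)) (hv : x 0 v.1 ≠ 0) : s v * x 0 v.1 ^ N = G v.1 := by
      have h1 := h v
      rw [hFG _ (mem_puncturedCone_quadric.1 v.2).2] at h1
      refine mul_left_cancel₀ hv ?_
      linear_combination h1
    refine ih G hG fun v => ?_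
    obtain ⟨i, hi⟩ := Function.ne_iff.1 v.2.1
    have hi' : v.1 i ≠ 0 := hi
    obtain ⟨M, P, hP, hPs⟩ := hs i
    -- The two expressions agree where `x 0` and `x i` do not vanish, hence everywhere.
    have hR : RegFun fun w => x i w ^ M * G w - x 0 w ^ N * MvPolynomial.eval w P :=
      ((forms_regFun (pow_mem_forms (x i) M)).mul (forms_regFun hG)).sub
        ((forms_regFun (pow_mem_forms (x 0) N)).mul (forms_regFun (eval_mem_forms hP)))
    have h0 : x i v.1 ^ M * G v.1 - x 0 v.1 ^ N * MvPolynomial.eval v.1 P = 0 := by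
      by_contra h0
      obtain ⟨o, ho, ho0, hoi⟩ := hfr.exists_isotropic_ne_zero (hx 0) (hx i)
      obtain ⟨w, hw, hw1, hw2⟩ := hfr.exists_common
        ((RegFun.linear (x 0)).mul (RegFun.linear (x i))) hR ho (mul_ne_zero ho0 hoi)
        (mem_puncturedCone_quadric.1 v.2).2 h0
      have hw0 : w ≠ 0 := by
        rintro rfl
        simp at hw1
      have h1 := hne ⟨w, mem_puncturedCone_quadric.2 ⟨hw0, hw.1⟩⟩ (left_ne_zero_of_mul hw1)
      have hwi : w i ≠ 0 := right_ne_zero_of_mul hw1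
      have h2 := hPs ⟨w, mem_puncturedCone_quadric.2 ⟨hw0, hw.1⟩⟩ hwi
      refine hw2 ?_
      rw [← h1, h2]
      simp only [x, LinearMap.proj_apply]
      field_simp
      ring
    have h1 := hPs v hi'
    rw [eq_div_iff (pow_ne_zero _ hi')] at h1
    rw [← h1] at h0
    refine mul_left_cancel₀ (pow_ne_zero M hi') ?_
    simp only [x, LinearMap.proj_apply] at h0 ⊢
    linear_combination -h0

/-- A restriction map to a finite set is surjective if there are forms with arbitrary values at
its points. -/
theorem surjective_restriction {X Z : Set (PSpace K n)} (hZX : Z ⊆ X) {ι : Type*}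
    {p : ι → Fin (n + 1) → K} (hp : ∀ i, p i ∈ puncturedCone Z)
    (hZ : ∀ v ∈ puncturedCone Z, ∃ i, ∃ c : K, v = c • p i)
    (h : ∀ y : ι → K, ∃ F ∈ forms K (Fin (n + 1) → K) t, ∀ i, F (p i) = y i) :
    Function.Surjective (restriction hZX t) := fun s => by
  obtain ⟨F, hF, hFs⟩ := h fun i => s.1 ⟨p i, hp i⟩
  refine ⟨⟨_, forms_mem_sections X hF⟩, Subtype.ext (funext fun v => ?_)⟩
  obtain ⟨i, c, hv⟩ := hZ v.1 v.2
  rw [sections_smul s.2 (v := ⟨p i, hp i⟩) hv, ← hFs, ← forms_smul hF, ← hv]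
  rfl

/-- A restriction map from the quadric is injective if the forms of the given degree which vanish
at the given points vanish on the quadric. -/
theorem injective_restriction [IsAlgClosed K] {Q : QuadraticForm K (Fin (n + 1) → K)}
    (hQ : 4 ≤ quadricRank Q) {Z : Set (PSpace K n)} (hZ : Z ⊆ quadric Q) {ι : Type*}
    {p : ι → Fin (n + 1) → K} (hp : ∀ i, p i ∈ puncturedCone Z)
    (h : ∀ F ∈ forms K (Fin (n + 1) → K) t, (∀ i, F (p i) = 0) → ∀ v, Q v = 0 → F v = 0) :
    Function.Injective (restriction hZ t) := by
  rw [← LinearMap.ker_eq_bot, LinearMap.ker_eq_bot']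
  intro s hs
  obtain ⟨F, hF, hFs⟩ := exists_form_of_mem_sections hQ s.2
  refine Subtype.ext (funext fun v => ?_)
  rw [hFs]
  refine h F hF (fun i => ?_) _ (mem_puncturedCone_quadric.1 v.2).2
  have h1 : s.1 ⟨p i, puncturedCone_mono hZ (hp i)⟩ = 0 :=
    congrFun (congrArg Subtype.val hs) ⟨p i, hp i⟩
  exact (hFs _).symm.trans h1

/-- Forms of large degree separate points: products of linear forms do. -/
theorem exists_form_eq {E : Type*} [AddCommGroup E] [Module K E] {ι : Type*} [Fintype ι]
    {p : ι → E} (hp : ∀ i, p i ≠ 0) (hp' : ∀ i j, i ≠ j → p i ∉ Submodule.span K {p j})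
    (ht : Fintype.card ι ≤ t + 1) (y : ι → K) : ∃ F ∈ forms K E t, ∀ i, F (p i) = y i := by
  classical
  have hφ (i j : ι) : ∃ φ : Dual K E, φ (p i) = 1 ∧ (i ≠ j → φ (p j) = 0) := by
    by_cases hij : i = j
    · obtain ⟨φ, hφ⟩ : ∃ φ : Dual K E, φ (p i) ≠ 0 := by
        by_contra! hcon
        exact hp i ((forall_dual_apply_eq_zero_iff K _).1 hcon)
      exact ⟨(φ (p i))⁻¹ • φ, by simp [hφ], fun h => (h hij).elim⟩
    · obtain ⟨φ, hφ, hφ'⟩ := Submodule.exists_le_ker_of_notMem (hp' i j hij)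
      have : φ (p j) = 0 := hφ' (Submodule.mem_span_singleton_self _)
      exact ⟨(φ (p i))⁻¹ • φ, by simp [hφ], fun _ => by simp [this]⟩
  choose φ hφ1 hφ2 using hφ
  set G : ι → E → K := fun i v => (∏ j ∈ Finset.univ.erase i, φ i j v) *
    φ i i v ^ (t + 1 - Fintype.card ι)
  have hG (i : ι) : G i ∈ forms K E t := by
    have := mul_mem_forms (prod_mem_forms (Finset.univ.erase i) (φ i))
      (pow_mem_forms (φ i i) (t + 1 - Fintype.card ι))
    have hc : (Finset.univ.erase i).card + (t + 1 - Fintype.card ι) = t := by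
      have : 0 < Fintype.card ι := Fintype.card_pos_iff.2 ⟨i⟩
      rw [Finset.card_erase_of_mem (Finset.mem_univ i), Finset.card_univ]
      omega
    rwa [hc] at this
  have hGp (i j : ι) : G i (p j) = if i = j then 1 else 0 := by
    split_ifs with hij
    · subst hij
      simp [G, hφ1]
    · have : ∏ k ∈ Finset.univ.erase i, φ i k (p j) = 0 :=
        Finset.prod_eq_zero (Finset.mem_erase.2 ⟨Ne.symm hij, Finset.mem_univ j⟩) (hφ2 i j hij)
      simp [G, this]
  exact ⟨∑ i, y i • G i, sum_mem fun i _ => Submodule.smul_mem _ _ (hG i),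
    fun j => by simp [hGp]⟩

end Sections

/-! ### Bamboos from chains -/

namespace Chain

section

variable {K : Type*} [Field K] {E : Type*} [AddCommGroup E] [Module K E]

/-- The lines of a chain, as planes through the origin. -/
def line (x : Chain K E) (i : ℕ) : Submodule K E :=
  Submodule.span K {x.node i, x.dir i}

/-- The points of the first `d` lines of a chain on the quadric. -/
def point (Q : QuadraticForm K E) (d : ℕ) (x : Chain K E) : Fin d ⊕ Fin d → E :=
  Sum.elim (fun i => x.dir i) fun i => x.second Q i

/-- Conditions on a chain which ensure that its first `d` lines form a bamboo which meets the
quadric transversally. -/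
structure IsBamboo (Q : QuadraticForm K E) (d : ℕ) (x : Chain K E) : Prop where
  onQuadric : x.OnQuadric Q d
  node_ne_zero : ∀ i < d, Q (x.node i) ≠ 0
  polar_ne_zero : ∀ i < d, QuadraticMap.polar Q (x.dir i) (x.node i) ≠ 0
  adjacent : ∀ i < d, i + 1 < d → LinearIndependent K ![x.node i, x.dir i, x.dir (i + 1)]
  distant : ∀ i < d, ∀ j < d, i + 2 ≤ j →
    LinearIndependent K ![x.node i, x.dir i, x.node j, x.dir j]

variable {Q : QuadraticForm K E} {d : ℕ} {x : Chain K E}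

theorem mem_line {i : ℕ} {v : E} :
    v ∈ x.line i ↔ ∃ α β : K, α • x.node i + β • x.dir i = v :=
  Submodule.mem_span_pair

theorem dir_mem_line (x : Chain K E) (i : ℕ) : x.dir i ∈ x.line i :=
  Submodule.subset_span (by simp)

theorem node_mem_line (x : Chain K E) (i : ℕ) : x.node i ∈ x.line i :=
  Submodule.subset_span (by simp)

theorem node_succ_mem_line (x : Chain K E) (i : ℕ) : x.node (i + 1) ∈ x.line i :=
  mem_line.2 ⟨x.c i, x.e i, rfl⟩

theorem second_mem_line (Q : QuadraticForm K E) (x : Chain K E) (i : ℕ) :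
    x.second Q i ∈ x.line i :=
  sub_mem (Submodule.smul_mem _ _ (x.dir_mem_line i)) (Submodule.smul_mem _ _ (x.node_mem_line i))

namespace IsBamboo

variable (h : x.IsBamboo Q d)
include h

theorem dir_ne_zero {i : ℕ} (hi : i < d) : x.dir i ≠ 0 := fun h0 =>
  h.polar_ne_zero i hi (by simp [h0])

theorem linearIndependent {i : ℕ} (hi : i < d) :
    LinearIndependent K ![x.node i, x.dir i] := by
  refine LinearIndependent.pair_iff.2 fun α β h0 => ?_
  have h1 := congrArg (QuadraticMap.polar Q (x.dir i)) h0
  rw [QuadraticMap.polar_add_right, QuadraticMap.polar_smul_right, QuadraticMap.polar_smul_right,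
    polar_self_eq_zero (h.onQuadric i hi)] at h1
  have h2 : α = 0 := by simpa [h.polar_ne_zero i hi] using h1
  exact ⟨h2, by simpa [h2, h.dir_ne_zero hi] using h0⟩

theorem eq_smul_node {i : ℕ} (hi : i + 1 < d) {v : E} (hv : v ∈ x.line i)
    (hv' : v ∈ x.line (i + 1)) : ∃ γ : K, v = γ • x.node (i + 1) := by
  obtain ⟨α, β, rfl⟩ := mem_line.1 hv
  obtain ⟨γ, δ, h0⟩ := mem_line.1 hv'
  have h1 := Fintype.linearIndependent_iff.1 (h.adjacent i (by omega) hi)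
    ![γ * x.c i - α, γ * x.e i - β, δ] (by
      rw [node_succ] at h0
      simp only [Fin.sum_univ_three, Matrix.cons_val_zero, Matrix.cons_val_one, Matrix.cons_val]
      rw [← sub_eq_zero] at h0
      rw [← h0]
      module) 2
  have h2 : δ = 0 := h1
  exact ⟨γ, by rw [← h0, h2, zero_smul, add_zero]⟩

theorem eq_zero_of_mem_line {i j : ℕ} (hj : j < d) (hij : i + 2 ≤ j) {v : E} (hv : v ∈ x.line i)
    (hv' : v ∈ x.line j) : v = 0 := by
  obtain ⟨α, β, rfl⟩ := mem_line.1 hv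
  obtain ⟨γ, δ, h0⟩ := mem_line.1 hv'
  have h1 := Fintype.linearIndependent_iff.1 (h.distant i (by omega) j hj hij)
    ![α, β, -γ, -δ] (by
      simp only [Fin.sum_univ_four, Matrix.cons_val_zero, Matrix.cons_val_one, Matrix.cons_val]
      rw [eq_comm, ← sub_eq_zero] at h0
      rw [← h0]
      module)
  have h2 : α = 0 := h1 0
  have h3 : β = 0 := h1 1
  simp [h2, h3]

/-- Different lines of the chain do not meet in points of the quadric. -/
theorem eq_of_mem_line {i j : ℕ} (hi : i < d) (hj : j < d) {v : E} (hv : v ∈ x.line i)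
    (hv' : v ∈ x.line j) (hv0 : v ≠ 0) (hQv : Q v = 0) : i = j := by
  wlog hij : i ≤ j generalizing i j
  · exact (this hj hi hv' hv (by omega)).symm
  rcases hij.eq_or_lt with rfl | hlt
  · rfl
  rcases (Nat.succ_le_of_lt hlt).eq_or_lt with rfl | hlt'
  · obtain ⟨γ, rfl⟩ := h.eq_smul_node hj hv hv'
    rw [QuadraticMap.map_smul, smul_eq_mul] at hQv
    have hγ : γ * γ = 0 := (mul_eq_zero.1 hQv).resolve_right (h.node_ne_zero _ hj)
    simp [mul_self_eq_zero.1 hγ] at hv0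
  · exact (hv0 (h.eq_zero_of_mem_line hj hlt' hv hv')).elim

theorem exists_eq_smul {i : ℕ} (hi : i < d) {v : E} (hv : v ∈ x.line i) (hQv : Q v = 0) :
    ∃ c : K, v = c • x.dir i ∨ v = c • x.second Q i := by
  obtain ⟨α, β, rfl⟩ := mem_line.1 hv
  rw [map_comb, h.onQuadric i hi, QuadraticMap.polar_comm] at hQv
  have h0 := h.polar_ne_zero i hi
  set b := QuadraticMap.polar Q (x.dir i) (x.node i) with hb
  by_cases hα : α = 0
  · exact ⟨β, Or.inl (by simp [hα])⟩
  · have h1 : α * Q (x.node i) + β * b = 0 := by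
      refine mul_left_cancel₀ hα ?_
      linear_combination hQv
    have h2 : β = - α * b⁻¹ * Q (x.node i) := by
      field_simp
      linear_combination h1
    refine ⟨- α * b⁻¹, Or.inr ?_⟩
    have h3 : α = α * b⁻¹ * b := by field_simp
    rw [second, secondPoint, ← hb, smul_sub, smul_smul, smul_smul, ← h2, neg_mul, neg_mul, ← h3]
    module

theorem polar_second {i : ℕ} (hi : i < d) :
    QuadraticMap.polar Q (x.second Q i) (x.dir i) ≠ 0 := by
  rw [second, polar_secondPoint_self (h.onQuadric i hi)]
  exact neg_ne_zero.2 (pow_ne_zero 2 (h.polar_ne_zero i hi))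

theorem second_ne_zero {i : ℕ} (hi : i < d) : x.second Q i ≠ 0 := fun h0 =>
  h.polar_second hi (by simp [h0])

theorem point_ne_zero (a : Fin d ⊕ Fin d) : x.point Q d a ≠ 0 := by
  rcases a with i | i
  · exact h.dir_ne_zero i.2
  · exact h.second_ne_zero i.2

theorem map_point (a : Fin d ⊕ Fin d) : Q (x.point Q d a) = 0 := by
  rcases a with i | i
  · exact h.onQuadric i i.2
  · exact h.onQuadric.second i.2

omit h in
theorem point_mem_line (a : Fin d ⊕ Fin d) : x.point Q d a ∈ x.line (Sum.elim id id a : Fin d) := by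
  rcases a with i | i
  · exact x.dir_mem_line i
  · exact x.second_mem_line Q i

theorem eq_of_point_eq_smul {a b : Fin d ⊕ Fin d} {c : K}
    (hab : x.point Q d a = c • x.point Q d b) : a = b := by
  have h1 : x.point Q d a ∈ x.line (Sum.elim id id b : Fin d) :=
    hab ▸ Submodule.smul_mem _ c (point_mem_line b)
  have h2 := Fin.ext (h.eq_of_mem_line (Fin.is_lt _) (Fin.is_lt _) (point_mem_line a) h1
    (h.point_ne_zero a) (h.map_point a))
  rcases a with i | i <;> rcases b with j | j <;> obtain rfl : i = j := h2
  · rfl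
  · have h3 := polar_self_eq_zero (h.onQuadric i i.2)
    have h4 : x.dir i = c • x.second Q i := hab
    rw [h4, QuadraticMap.polar_smul_left, ← h4, smul_eq_mul, mul_eq_zero] at h3
    rcases h3 with rfl | h3
    · exact (h.dir_ne_zero i.2 (by rw [h4, zero_smul])).elim
    · exact (h.polar_second i.2 h3).elim
  · have h4 : x.second Q i = c • x.dir i := hab
    refine (h.polar_second i.2 ?_).elim
    rw [h4, QuadraticMap.polar_smul_left, polar_self_eq_zero (h.onQuadric i i.2), smul_zero]
  · rfl

end IsBamboo

end

section

variable {K : Type*} [Field K] {n d : ℕ} {Q : QuadraticForm K (Fin (n + 1) → K)}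
  {x : Chain K (Fin (n + 1) → K)}

namespace IsBamboo

/-- The bamboo which is composed of the first `d` lines of a chain. -/
def toBamboo (h : x.IsBamboo Q d) : Bamboo K n d where
  line i := x.line i
  finrank_line i := by
    have h1 := finrank_span_eq_card (h.linearIndependent i.2)
    rwa [Matrix.range_cons_cons_empty, Fintype.card_fin] at h1
  line_injective i j hij := by
    have h1 : x.dir i ∈ x.line j := (congrArg (x.dir i ∈ ·) hij).mp (x.dir_mem_line i)
    exact Fin.ext (h.eq_of_mem_line i.2 j.2 (x.dir_mem_line i) h1 (h.dir_ne_zero i.2)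
      (h.onQuadric i i.2))
  meet_iff := by
    have key (i j : Fin d) (hij : (i : ℕ) ≤ j) : (∃ p : PSpace K n,
        p ∈ (x.line i).projectivization ∧ p ∈ (x.line j).projectivization) ↔ (j : ℕ) ≤ i + 1 := by
      constructor
      · rintro ⟨p, hp⟩
        induction p using Projectivization.ind with | h v hv =>
        by_contra hlt
        exact hv (h.eq_zero_of_mem_line j.2 (by omega) hp.1 hp.2)
      · intro hji
        rcases hij.eq_or_lt with heq | hlt
        · rw [← heq]
          exact ⟨Projectivization.mk K _ (h.dir_ne_zero i.2), x.dir_mem_line i, x.dir_mem_line i⟩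
        · have hj : (j : ℕ) = i + 1 := by omega
          have hn : x.node j ≠ 0 := fun h0 => h.node_ne_zero j j.2 (by simp [h0])
          exact ⟨Projectivization.mk K _ hn, by
            rw [Submodule.mk_mem_projectivization_iff, hj]
            exact x.node_succ_mem_line i, x.node_mem_line j⟩
    intro i j
    rcases le_total (i : ℕ) j with hij | hij
    · rw [key i j hij]
      omega
    · simp only [and_comm (a := _ ∈ (x.line i).projectivization)]
      rw [key j i hij]
      omega

theorem transverse (h : x.IsBamboo Q d) : h.toBamboo.Transverse Q := fun i v hv hv0 hQv => by
  refine ⟨fun j hj => Fin.ext (h.eq_of_mem_line j.2 i.2 hj hv hv0 hQv), ?_⟩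
  obtain ⟨c, rfl | rfl⟩ := h.exists_eq_smul i.2 hv hQv
  · refine ⟨x.node i, x.node_mem_line i, ?_⟩
    rw [QuadraticMap.polar_smul_left]
    exact smul_ne_zero (left_ne_zero_of_smul hv0) (h.polar_ne_zero i i.2)
  · refine ⟨x.dir i, x.dir_mem_line i, ?_⟩
    rw [QuadraticMap.polar_smul_left]
    exact smul_ne_zero (left_ne_zero_of_smul hv0) (h.polar_second i.2)

theorem point_mem_puncturedCone (h : x.IsBamboo Q d) (a : Fin d ⊕ Fin d) :
    x.point Q d a ∈ puncturedCone (h.toBamboo.carrier ∩ quadric Q) :=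
  ⟨h.point_ne_zero a, ⟨_, point_mem_line a⟩, (mk_mem_quadric_iff Q _).2 (h.map_point a)⟩

theorem exists_eq_smul_point (h : x.IsBamboo Q d) {v : Fin (n + 1) → K}
    (hv : v ∈ puncturedCone (h.toBamboo.carrier ∩ quadric Q)) :
    ∃ a, ∃ c : K, v = c • x.point Q d a := by
  obtain ⟨hv0, ⟨i, hi⟩, hQ⟩ := hv
  obtain ⟨c, hc | hc⟩ := h.exists_eq_smul i.2 hi ((mk_mem_quadric_iff Q hv0).1 hQ)
  · exact ⟨Sum.inl i, c, hc⟩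
  · exact ⟨Sum.inr i, c, hc⟩

theorem ncard_eq (h : x.IsBamboo Q d) : (h.toBamboo.carrier ∩ quadric Q).ncard = 2 * d := by
  set f : Fin d ⊕ Fin d → PSpace K n := fun a => Projectivization.mk K _ (h.point_ne_zero a)
  have hf : Function.Injective f := fun a b hab => by
    obtain ⟨c, hc⟩ := (Projectivization.mk_eq_mk_iff' K _ _ _ _).1 hab
    exact h.eq_of_point_eq_smul hc.symm
  have hr : h.toBamboo.carrier ∩ quadric Q = f '' Set.univ := by
    ext p
    rw [Set.image_univ]
    constructor
    · intro hp
      induction p using Projectivization.ind with | h v hv =>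
      obtain ⟨a, c, hc⟩ := h.exists_eq_smul_point ⟨hv, hp⟩
      exact ⟨a, (Projectivization.mk_eq_mk_iff' K _ _ _ _).2
        ⟨c⁻¹, by rw [hc, inv_smul_smul₀ (left_ne_zero_of_smul (hc ▸ hv))]⟩⟩
    · rintro ⟨a, rfl⟩
      exact (h.point_mem_puncturedCone a).2
  rw [hr, Set.ncard_image_of_injective _ hf, Set.ncard_univ, Nat.card_eq_fintype_card]
  simp [two_mul]

theorem hasMaximalRank [IsAlgClosed K] (hQ : 4 ≤ quadricRank Q) (h : x.IsBamboo Q d)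
    (hx : ∀ t < 2 * d, x.Surj Q t d ∨ x.Inj Q t d) :
    HasMaximalRank (Set.inter_subset_right : h.toBamboo.carrier ∩ quadric Q ⊆ quadric Q) := by
  intro t
  have hsurj := surjective_restriction (t := t)
    (Set.inter_subset_right : h.toBamboo.carrier ∩ quadric Q ⊆ quadric Q)
    h.point_mem_puncturedCone fun v hv => h.exists_eq_smul_point hv
  by_cases ht : t < 2 * d
  · rcases hx t ht with hx | hx
    · refine Or.inr (hsurj fun y => ?_)
      obtain ⟨⟨F, hF⟩, hFy⟩ := surj_iff.1 hx y
      exact ⟨F, hF, fun a => by rw [← hFy]; rfl⟩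
    · refine Or.inl (injective_restriction hQ _ h.point_mem_puncturedCone fun F hF hF0 => ?_)
      exact hx F hF fun i hi => ⟨hF0 (Sum.inl ⟨i, hi⟩), hF0 (Sum.inr ⟨i, hi⟩)⟩
  · refine Or.inr (hsurj (exists_form_eq h.point_ne_zero (fun a b hab hmem => hab ?_) ?_))
    · obtain ⟨c, hc⟩ := Submodule.mem_span_singleton.1 hmem
      exact h.eq_of_point_eq_smul hc.symm
    · simp
      omega

end IsBamboo

end

/-! ### Chains in general position -/

section

variable {K : Type*} [Field K] {E : Type*} [AddCommGroup E] [Module K E] [FiniteDimensional K E]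
  {Q : QuadraticForm K E} {e₁ e₂ e₃ : E}

/-- There are chains with lines in general position, which satisfy finitely many open
conditions. -/
theorem exists_isBamboo [Infinite K] (hQ : ConicFrame Q e₁ e₂ e₃) (hE : 4 ≤ finrank K E)
    {d m : ℕ} {U : ℕ → Chain K E → Prop} (hU : ∀ t < m, OpenCond Q d (U t))
    (hx : ∀ t < m, ∃ x, Smooth Q d x ∧ U t x) : ∃ x, x.IsBamboo Q d ∧ ∀ t < m, U t x := by
  obtain ⟨v, -, hv⟩ := SetLike.exists_of_lt (span_range_lt_top (K := K) e₁ e₂ e₃ hE)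
  have hli : LinearIndependent K ![v, e₁, e₂, e₃] :=
    linearIndependent_finCons.2 ⟨hQ.linearIndependent, hv⟩
  have hp1 := hQ.polar
  have hp2 : QuadraticMap.polar Q e₂ e₁ = 1 := by rw [QuadraticMap.polar_comm, hp1]
  have hs3 : SmoothVec Q (e₁ - e₂ + e₃) := by
    refine ⟨?_, e₁, ?_⟩
    · rw [QuadraticMap.map_add Q, QuadraticMap.polar_sub_left, hQ.polar₁, hQ.polar₂, hQ.thd,
        sub_eq_add_neg, QuadraticMap.map_add Q, QuadraticMap.map_neg, QuadraticMap.polar_neg_right,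
        hQ.fst, hQ.snd, hp1]
      ring
    · rw [QuadraticMap.polar_add_left, QuadraticMap.polar_sub_left, polar_self_eq_zero hQ.fst, hp2,
        QuadraticMap.polar_comm, hQ.polar₁]
      simp
  have hnode {i : ℕ} : OpenCond Q d fun x => Q (x.node i) ≠ 0 :=
    OpenCond.of_ne_zero fun x hx => quadraticForm_regFun Q _ (hx.node i)
  have hpolar {i : ℕ} : OpenCond Q d fun x => QuadraticMap.polar Q (x.dir i) (x.node i) ≠ 0 :=
    OpenCond.of_ne_zero fun x hx => polar_mem_polyFun Q (hx.dir i) (hx.node i)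
  have hadj {i : ℕ} : OpenCond Q d fun x => i + 1 < d →
      LinearIndependent K ![x.node i, x.dir i, x.dir (i + 1)] :=
    OpenCond.imp fun _ => by
      refine OpenCond.linearIndependent (g := fun j x => ![x.node i, x.dir i, x.dir (i + 1)] j)
        fun x hx j => ?_
      fin_cases j
      exacts [hx.node i, hx.dir i, hx.dir (i + 1)]
  have hdist {i j : ℕ} : OpenCond Q d fun x => i + 2 ≤ j →
      LinearIndependent K ![x.node i, x.dir i, x.node j, x.dir j] :=
    OpenCond.imp fun _ => by
      refine OpenCond.linearIndependent (g := fun k x => ![x.node i, x.dir i, x.node j, x.dir j] k)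
        fun x hx k => ?_
      fin_cases k
      exacts [hx.node i, hx.dir i, hx.node j, hx.dir j]
  have hgeneral := (OpenCond.forall_lt (m := d) fun i _ => hnode (i := i)).and
    (OpenCond.forall_lt (m := d) fun i _ => hpolar (i := i))
  have hgeneral' : ∃ x, Smooth Q d x ∧ (∀ i < d, Q (x.node i) ≠ 0) ∧
      ∀ i < d, QuadraticMap.polar Q (x.dir i) (x.node i) ≠ 0 := by
    refine ⟨star (e₁ + e₂) fun _ => e₁, fun _ _ => hQ.smooth₁, fun i _ => ?_, fun i _ => ?_⟩
    · simp [star_node, QuadraticMap.map_add Q, hQ.fst, hQ.snd, hp1]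
    · simp [star_node, star_dir, QuadraticMap.polar_add_right, hQ.fst, hp1]
  have hadj' (i : ℕ) : ∃ x, Smooth Q d x ∧
      (i + 1 < d → LinearIndependent K ![x.node i, x.dir i, x.dir (i + 1)]) := by
    refine ⟨star v fun j => if j = i then e₁ else e₂, fun j _ => ?_, fun _ => ?_⟩
    · by_cases hj : j = i
      · simp [star_dir, hj, hQ.smooth₁]
      · simp [star_dir, hj, hQ.smooth₂]
    · have h0 := hli.comp ![0, 1, 2] (by decide)
      convert h0 using 1
      ext j
      fin_cases j <;> simp [star_node, star_dir]
  have hdist' (i j : ℕ) : ∃ x, Smooth Q d x ∧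
      (i + 2 ≤ j → LinearIndependent K ![x.node i, x.dir i, x.node j, x.dir j]) := by
    -- The line number `j` contains `v + e₂` if `i + 2 ≤ j`.
    set x : Chain K E := ⟨v, fun k => if k = i then e₁ else if k = j then e₁ - e₂ + e₃ else e₂,
      fun _ => 1, fun k => if k = i + 1 then 1 else 0⟩ with hxdef
    refine ⟨x, fun k _ => ?_, fun hij => ?_⟩
    · simp only [hxdef]
      split_ifs
      exacts [hQ.smooth₁, hs3, hQ.smooth₂]
    · have hn (k : ℕ) : x.node k = if k ≤ i + 1 then v else v + e₂ := by
        induction k with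
        | zero => rfl
        | succ k ih =>
          rw [node_succ, ih]
          rcases lt_trichotomy k (i + 1) with hk | rfl | hk
          · simp [hxdef, hk.ne, hk.le, Nat.succ_le_of_lt hk]
          · have hj : i + 1 ≠ j := by omega
            simp [hxdef, hj]
          · simp [hxdef, hk.ne', hk.not_ge, (hk.trans (Nat.lt_succ_self k)).not_ge]
      have hi : x.dir i = e₁ := if_pos rfl
      have hj : x.dir j = e₁ - e₂ + e₃ := by
        have : j ≠ i := by omega
        simp [hxdef, this]
      rw [hn, hn, hi, hj, if_pos (Nat.le_succ i), if_neg (by omega),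
        Fintype.linearIndependent_iff]
      intro g hg
      have h0 := Fintype.linearIndependent_iff.1 hli ![g 0 + g 2, g 1 + g 3, g 2 - g 3, g 3] (by
        rw [← hg]
        simp only [Fin.sum_univ_four, Matrix.cons_val_zero, Matrix.cons_val_one, Matrix.cons_val]
        module)
      have h3 : g 3 = 0 := h0 3
      have h2 : g 2 = 0 := by simpa [h3] using h0 2
      have h1 : g 1 = 0 := by simpa [h3] using h0 1
      have h0 : g 0 = 0 := by simpa [h2] using h0 0
      intro k
      fin_cases k
      exacts [h0, h1, h2, h3]
  have hadj₂ := OpenCond.exists_forall_lt hQ (m := d) (fun i _ => hadj (i := i)) fun i _ => hadj' i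
  have hdist₂ := OpenCond.exists_forall_lt hQ (m := d)
    (fun i _ => OpenCond.forall_lt (m := d) fun j _ => hdist (i := i) (j := j))
    fun i _ => OpenCond.exists_forall_lt hQ (fun j _ => hdist (i := i) (j := j))
      fun j _ => hdist' i j
  have hadjo := OpenCond.forall_lt (m := d) fun i _ => hadj (i := i)
  have hdisto := OpenCond.forall_lt (m := d) fun i _ => OpenCond.forall_lt (m := d)
    fun j _ => hdist (i := i) (j := j)
  have hUo := OpenCond.forall_lt hU
  obtain ⟨x, hx, ⟨⟨h1, h2⟩, h3⟩, h4, h5⟩ := OpenCond.exists_and hQ (hgeneral.and hadjo)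
    (hdisto.and hUo) (OpenCond.exists_and hQ hgeneral hadjo hgeneral' hadj₂)
    (OpenCond.exists_and hQ hdisto hUo hdist₂ (OpenCond.exists_forall_lt hQ hU hx))
  exact ⟨x, ⟨hx.onQuadric, h1, h2, h3, h4⟩, h5⟩

/-- The smooth points of the quadric span the space. -/
theorem exists_basis_smooth [Infinite K] (hQ : ConicFrame Q e₁ e₂ e₃) {n : ℕ}
    (hE : finrank K E = n) : ∃ b : Basis (Fin n) K E, ∀ i, SmoothVec Q (b i) := by
  have htop : Submodule.span K {v | SmoothVec Q v} = ⊤ := by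
    by_contra hne
    obtain ⟨l, hl, hle⟩ := Submodule.exists_le_ker_of_lt_top _ (lt_top_iff_ne_top.2 hne)
    obtain ⟨o, ho, hlo, -⟩ := hQ.exists_isotropic_ne_zero hl hl
    obtain ⟨z, hz, hlz⟩ := hQ.exists_smooth (RegFun.linear l) ho hlo
    exact hlz (hle (Submodule.subset_span hz))
  set b := Basis.ofSpan htop.ge
  have : Fintype _ := FiniteDimensional.fintypeBasisIndex b
  have hc := (finrank_eq_card_basis b).symm.trans hE
  refine ⟨b.reindex (Fintype.equivFinOfCardEq hc), fun i => ?_⟩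
  rw [b.reindex_apply]
  exact Basis.ofSpan_subset htop.ge ⟨_, rfl⟩

/-- The lines which join a smooth point of the quadric to the other elements of a basis of smooth
points meet the quadric in points which span the space. -/
theorem exists_inj_one [Infinite K] (hQ : ConicFrame Q e₁ e₂ e₃) {n d : ℕ}
    (hE : finrank K E = n + 1) (hd : n ≤ d) : ∃ x, Smooth Q d x ∧ x.Inj Q 1 d := by
  obtain ⟨b, hb⟩ := exists_basis_smooth hQ hE
  set p := b (Fin.last n)
  set x : Chain K E := star p fun i => if hi : i < n then b (Fin.castSucc ⟨i, hi⟩) else p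
  have hxi (i : ℕ) (hi : i < n) : x.dir i = b (Fin.castSucc ⟨i, hi⟩) := dif_pos hi
  refine ⟨x, fun i _ => ?_, fun F hF hF0 v _ => ?_⟩
  · by_cases hi : i < n
    · exact hxi i hi ▸ hb _
    · have : x.dir i = p := dif_neg hi
      exact this ▸ hb _
  · obtain ⟨φ, rfl⟩ := exists_linear_of_mem_forms_one hF
    have h1 (i : Fin n) : φ (b i.castSucc) = 0 := by
      rw [← (hF0 i (i.2.trans_le hd)).1, hxi i i.2]
    -- Some of the lines are not tangent at `p`, since `p` is a smooth point.
    obtain ⟨i, hi⟩ : ∃ i : Fin n, QuadraticMap.polar Q p (b i.castSucc) ≠ 0 := by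
      by_contra! hcon
      refine (hb (Fin.last n)).polarBilin_ne_zero (b.ext fun i => ?_)
      induction i using Fin.lastCases with
      | last => exact polar_self_eq_zero (hb _).1
      | cast i => exact hcon i
    have h2 : φ p = 0 := by
      have := (hF0 i (i.2.trans_le hd)).2
      have hs : x.second Q i = - QuadraticMap.polar Q p (b i.castSucc) • p := by
        rw [second, hxi i i.2, star_node, secondPoint_of_isotropic (hb _).1,
          QuadraticMap.polar_comm]
      rw [hs, map_smul, smul_eq_mul] at this
      exact (mul_eq_zero.1 this).resolve_left (neg_ne_zero.2 hi)
    have : φ = 0 := b.ext fun i => by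
      induction i using Fin.lastCases with
      | last => exact h2
      | cast i => exact h1 i
    simp [this]

/-- A chain which is good in degree `t` can be truncated or extended to any length. -/
theorem _root_.BambooQuadric.HasGoodChain.exists_surj_or_inj [Infinite K]
    (hQ : ConicFrame Q e₁ e₂ e₃) {t : ℕ} (h : HasGoodChain Q t) (d : ℕ) :
    ∃ x, Smooth Q d x ∧ (x.Surj Q t d ∨ x.Inj Q t d) := by
  obtain ⟨k, -, x, hx, hs, hr⟩ := h
  rcases le_or_gt d k with hd | hd
  · exact ⟨x, (hs.mono hd).smooth fun i hi => hx i (hi.trans_le hd), Or.inl (hs.mono hd)⟩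
  · obtain ⟨F₀, hF₀, ⟨v, hv, hF₀v⟩, H⟩ := hs.exists_form hQ.toHypPair hx hr
    obtain ⟨a, ha, hF₀a⟩ := hQ.exists_smooth (forms_regFun hF₀) hv hF₀v
    set y := x.append k (star 0 fun _ => a)
    have hya (i : ℕ) : y.dir (k + i) = a := append_dir_add x _ k i
    have hyx (i : ℕ) (hi : i < k) : y.dir i = x.dir i := append_dir_of_lt x _ hi
    refine ⟨y, fun i hi => ?_, Or.inr fun F hF hF0 => H a ha.1 hF₀a F hF (fun i hi => ?_) ?_⟩
    · rcases lt_or_ge i k with hik | hik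
      · rw [hyx i hik]
        exact hs.smooth hx i hik
      · obtain ⟨j, rfl⟩ := Nat.exists_eq_add_of_le hik
        rwa [hya]
    · have h1 := hF0 i (hi.trans hd)
      rwa [second, append_node_of_le x _ hi.le, hyx i hi] at h1
    · rw [← hya 0]
      exact (hF0 k hd).1

/-- In each degree there is a chain of the given length which has maximal rank in this degree. -/
theorem exists_surj_or_inj [IsAlgClosed K] (hQ : ConicFrame Q e₁ e₂ e₃) {n d : ℕ} (hn : 2 ≤ n)
    (hE : finrank K E = n + 1) (hd : n ≤ d) (t : ℕ) :
    ∃ x, Smooth Q d x ∧ (x.Surj Q t d ∨ x.Inj Q t d) := by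
  have : Infinite K := IsAlgClosed.instInfinite
  match t with
  | 0 =>
    refine ⟨star 0 fun _ => e₁, fun _ _ => hQ.smooth₁, Or.inr fun F hF hF0 v _ => ?_⟩
    obtain ⟨c, rfl⟩ := forms_zero_induction hF
    exact (hF0 0 (by omega)).1
  | 1 =>
    obtain ⟨x, hx, h⟩ := exists_inj_one hQ hE hd
    exact ⟨x, hx, Or.inr h⟩
  | t + 2 =>
    exact (exists_hasGoodChain (n - 2) E Q e₁ e₂ e₃ hQ (by omega) t).exists_surj_or_inj hQ d

end

end Chain

end BambooQuadric

end


open BambooQuadric in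
theorem theorem2 {K : Type*} [Field K] [IsAlgClosed K] (n d : ℕ) (hn : 3 ≤ n) (hd : n ≤ d)
    (Q : QuadraticForm K (Fin (n + 1) → K)) (hQ : 4 ≤ quadricRank Q) :
    ∃ T : Bamboo K n d, T.Transverse Q ∧
      (T.carrier ∩ quadric Q).ncard = 2 * d ∧
      HasMaximalRank (Set.inter_subset_right : T.carrier ∩ quadric Q ⊆ quadric Q) := by
  have : Infinite K := IsAlgClosed.instInfinite
  have hrank : 4 ≤ Module.finrank K ((Fin (n + 1) → K) ⧸ Q.radical) := hQ
  obtain ⟨e₁, e₂, e₃, hfr⟩ := exists_conicFrame (Q := Q) (by omega)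
  have hE : Module.finrank K (Fin (n + 1) → K) = n + 1 := by simp
  obtain ⟨x, hx, hmax⟩ := Chain.exists_isBamboo hfr (by omega)
    (fun t (_ : t < 2 * d) => (Chain.openCond_surj t d le_rfl).or (Chain.openCond_inj t))
    fun t _ => Chain.exists_surj_or_inj hfr (by omega) hE hd t
  exact ⟨hx.toBamboo, hx.transverse, hx.ncard_eq, hx.hasMaximalRank hQ hmax⟩
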